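/- Let $k$ be a field of characteristic zero and let $G$ be either (a) an algebraic supergroup over $k$, i.e. a group object in the category of superschemes of finite type over $k$, or (b) an analytic supergroup over $k$, where $k$ is a complete non-trivially valued field (for example $\mathbb R$, $\mathbb C$ or $\mathbb Q_p$), i.e. a group object in the category of analytic supermanifolds over $k$. Let $\mu : G\times G\to G$ be the multiplication, $e\in G(k)$ the identity, $\mathcal O_{G,e}$ the stalk at $e$ of the structure sheaf and $m$ its maximal ideal. Let $D(G,e)$ be the super vector space of all $k$-linear forms on $\mathcal O_{G,e}$ that vanish on $m^{n+1}$ for some $n\ge 0$, and let $\mathfrak g=\mathrm{Lie}(G)=(m/m^2)^*$ be the subspace of those that vanish on $m^2$ and on $1$. For all $\phi,\psi\in D(G,e)$ there is exactly one distribution $\phi\otimes\psi$ on $G\times G$ supported at $(e,e)$ (a linear form on $\mathcal O_{G\times G,(e,e)}$ vanishing on a power of the maximal ideal) with $(\phi\otimes\psi)(p_1^*f\cdot p_2^*g)=(-1)^{|f||g|}\phi(f)\psi(g)$ for homogeneous $f,g\in\mathcal O_{G,e}$. The convolution product $(\phi\star\psi)(f)=(\phi\otimes\psi)(\mu^*f)$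 makes $D(G,e)$ an associative superalgebra whose unit is the evaluation $\mathrm{ev}_e$. The subspace $\mathfrak g$ is a Lie superalgebra for the supercommutator $[x,y]=x\star y-(-1)^{|x||y|}y\star x$, and the unique homomorphism of unital algebras $$\alpha:\ \mathcal U(\mathfrak g)\longrightarrow D(G,e)$$ from the universal enveloping superalgebra that restricts to the inclusion on $\mathfrak g$ is an isomorphism of superalgebras. -/

import Mathlib

open TopologicalSpace

universe u

namespace Super

/-! ### Superalgebras -/

/-- The Koszul sign `(-1)^(i j)`. -/
def koszul (k : Type u) [Field k] (i j : ZMod 2) : k := if i = 1 ∧ j = 1 then -1 else 1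

/-- `A = A₀ ⊕ A₁` is a superalgebra over `k` for the grading `gr`. -/
structure IsSuperalgebra {k A : Type u} [Field k] [Ring A] [Algebra k A]
    (gr : ZMod 2 → Submodule k A) : Prop where
  isCompl : IsCompl (gr 0) (gr 1)
  one_mem : (1 : A) ∈ gr 0
  mul_mem : ∀ {i j : ZMod 2} {a b : A}, a ∈ gr i → b ∈ gr j → a * b ∈ gr (i + j)

/-- Supercommutativity: `a b = (-1)^(|a| |b|) b a`. -/
def IsSupercommutative {k A : Type u} [Field k] [Ring A] [Algebra k A]
    (gr : ZMod 2 → Submodule k A) : Prop :=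
  ∀ {i j : ZMod 2} {a b : A}, a ∈ gr i → b ∈ gr j → a * b = koszul k i j • (b * a)

/-! ### Superspaces -/

/-- A topological space with a presheaf of superalgebras over `k`. -/
structure PreSuperSpace (k : Type u) [Field k] where
  carrier : Type u
  [top : TopologicalSpace carrier]
  /-- sections over an open set -/
  sec : Opens carrier → Type u
  [ring : ∀ U, Ring (sec U)]
  [alg : ∀ U, Algebra k (sec U)]
  /-- even and odd sections -/
  gr : ∀ U, ZMod 2 → Submodule k (sec U)
  isSuperalgebra : ∀ U, IsSuperalgebra (gr U)
  /-- restriction -/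
  res : ∀ {U V : Opens carrier}, U ≤ V → (sec V →ₐ[k] sec U)
  res_id : ∀ {U : Opens carrier} (s : sec U), res le_rfl s = s
  res_res : ∀ {U V W : Opens carrier} (h : U ≤ V) (h' : V ≤ W) (s : sec W),
    res h (res h' s) = res (h.trans h') s
  res_gr : ∀ {U V : Opens carrier} (h : U ≤ V) {i : ZMod 2} {s : sec V},
    s ∈ gr V i → res h s ∈ gr U i

namespace PreSuperSpace

attribute [instance] PreSuperSpace.top PreSuperSpace.ring PreSuperSpace.alg

variable {k : Type u} [Field k] (X : PreSuperSpace k)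

/-- Restriction between neighbourhoods of `x`, ordered by reverse inclusion. -/
def resNhds (x : X.carrier) (U V : (OpenNhdsOf x)ᵒᵈ) (h : U ≤ V) :
    X.sec (OrderDual.ofDual U).toOpens →ₐ[k] X.sec (OrderDual.ofDual V).toOpens :=
  X.res (U := (OrderDual.ofDual V).toOpens) (V := (OrderDual.ofDual U).toOpens) h

instance directedSystem (x : X.carrier) :
    DirectedSystem (fun U : (OpenNhdsOf x)ᵒᵈ => X.sec (OrderDual.ofDual U).toOpens)
      (fun U V h => X.resNhds x U V h) where
  map_self _ s := X.res_id s
  map_map _ _ _ hij hjk s := X.res_res (U := _) hjk hij s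

/-- The stalk at `x`: the direct limit of the sections over the open neighbourhoods of `x`. -/
def Stalk (x : X.carrier) : Type u :=
  DirectLimit (fun U : (OpenNhdsOf x)ᵒᵈ => X.sec (OrderDual.ofDual U).toOpens) (X.resNhds x)

noncomputable instance (x : X.carrier) : Ring (X.Stalk x) :=
  inferInstanceAs (Ring (DirectLimit
    (fun U : (OpenNhdsOf x)ᵒᵈ => X.sec (OrderDual.ofDual U).toOpens) (X.resNhds x)))

variable {X}

/-- The germ at `x` of a section over an open set containing `x`, as a ring homomorphism. -/
noncomputable def germRingHom {x : X.carrier} {U : Opens X.carrier} (hx : x ∈ U) :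
    X.sec U →+* X.Stalk x where
  toFun s := (⟦⟨OrderDual.toDual ⟨U, hx⟩, s⟩⟧ : DirectLimit
    (fun U : (OpenNhdsOf x)ᵒᵈ => X.sec (OrderDual.ofDual U).toOpens) (X.resNhds x))
  map_one' := (DirectLimit.one_def (f := X.resNhds x) (OrderDual.toDual ⟨U, hx⟩)).symm
  map_mul' s t := (DirectLimit.mul_def (f := X.resNhds x) (OrderDual.toDual ⟨U, hx⟩) s t).symm
  map_zero' := (DirectLimit.zero_def (f := X.resNhds x) (OrderDual.toDual ⟨U, hx⟩)).symm
  map_add' s t := (DirectLimit.add_def (f := X.resNhds x) (OrderDual.toDual ⟨U, hx⟩) s t).symm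

theorem germRingHom_res {x : X.carrier} {U V : Opens X.carrier} (h : U ≤ V) (hx : x ∈ U)
    (s : X.sec V) : germRingHom hx (X.res h s) = germRingHom (h hx) s :=
  DirectLimit.mk_apply (F := fun U : (OpenNhdsOf x)ᵒᵈ => X.sec (OrderDual.ofDual U).toOpens)
    (f := X.resNhds x) (OrderDual.toDual ⟨V, h hx⟩) (OrderDual.toDual ⟨U, hx⟩) s h

theorem exists_germRingHom {x : X.carrier} (a : X.Stalk x) :
    ∃ (U : Opens X.carrier) (hx : x ∈ U) (s : X.sec U), germRingHom hx s = a := by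
  obtain ⟨U, s, rfl⟩ := DirectLimit.exists_eq_mk (f := X.resNhds x) a
  exact ⟨(OrderDual.ofDual U).toOpens, (OrderDual.ofDual U).mem', s, rfl⟩

theorem germRingHom_algebraMap {x : X.carrier} {U : Opens X.carrier} (hx : x ∈ U) (c : k) :
    germRingHom hx (algebraMap k (X.sec U) c) =
      germRingHom (Opens.mem_top x) (algebraMap k (X.sec ⊤) c) := by
  rw [← germRingHom_res (le_top : U ≤ ⊤) hx, AlgHom.commutes]

noncomputable instance (x : X.carrier) : Algebra k (X.Stalk x) :=
  RingHom.toAlgebra' ((germRingHom (Opens.mem_top x)).comp (algebraMap k (X.sec ⊤))) (by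
    intro c a
    obtain ⟨U, hx, s, rfl⟩ := exists_germRingHom a
    rw [RingHom.comp_apply, ← germRingHom_algebraMap hx, ← map_mul, ← map_mul,
      Algebra.commutes])

/-- The germ at `x` of a section over an open set containing `x`. -/
noncomputable def germ {x : X.carrier} {U : Opens X.carrier} (hx : x ∈ U) :
    X.sec U →ₐ[k] X.Stalk x :=
  { germRingHom hx with commutes' := fun c => germRingHom_algebraMap hx c }

theorem germ_res {x : X.carrier} {U V : Opens X.carrier} (h : U ≤ V) (hx : x ∈ U)
    (s : X.sec V) : germ hx (X.res h s) = germ (h hx) s :=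
  germRingHom_res h hx s

theorem exists_germ {x : X.carrier} (a : X.Stalk x) :
    ∃ (U : Opens X.carrier) (hx : x ∈ U) (s : X.sec U), germ hx s = a :=
  exists_germRingHom a

theorem germ_eq_iff {x : X.carrier} {U V : Opens X.carrier} (hU : x ∈ U) (hV : x ∈ V)
    (s : X.sec U) (t : X.sec V) : germ hU s = germ hV t ↔
      ∃ (W : Opens X.carrier) (_ : x ∈ W) (h : W ≤ U) (h' : W ≤ V), X.res h s = X.res h' t := by
  constructor
  · intro h
    obtain ⟨W, h₁, h₂, e⟩ := Quotient.exact
      (s := DirectLimit.setoid (X.resNhds x)) h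
    exact ⟨(OrderDual.ofDual W).toOpens, (OrderDual.ofDual W).mem', h₁, h₂, e⟩
  · rintro ⟨W, hW, h, h', e⟩
    rw [← germ_res h hW, ← germ_res h' hW, e]

variable (X)

/-- Germs of even, respectively odd, sections. -/
noncomputable def stalkGr (x : X.carrier) (i : ZMod 2) : Submodule k (X.Stalk x) :=
  ⨆ (U : Opens X.carrier) (hx : x ∈ U), (X.gr U i).map (germ hx).toLinearMap

end PreSuperSpace

open PreSuperSpace

/-- A superspace over `k`: a topological space with a sheaf of supercommutative superalgebras over
`k` whose stalks are local. -/
structure SuperSpace (k : Type u) [Field k] extends PreSuperSpace k where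
  supercommutative : ∀ U, IsSupercommutative (gr U)
  sheaf : ∀ {ι : Type u} (V : ι → Opens carrier) (s : ∀ i, sec (V i)),
    (∀ i j, res (inf_le_left : V i ⊓ V j ≤ V i) (s i) = res (inf_le_right : V i ⊓ V j ≤ V j) (s j)) →
    ∃! t : sec (iSup V), ∀ i, res (le_iSup V i) t = s i
  isLocalRing : ∀ x : carrier, IsLocalRing (toPreSuperSpace.Stalk x)

/-- A morphism of superspaces over `k`: a continuous map together with a morphism of sheaves of
superalgebras `𝒪_Y → f_* 𝒪_X` which is local on stalks. -/
structure Hom {k : Type u} [Field k] (X Y : SuperSpace k) where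
  base : C(X.carrier, Y.carrier)
  pull : ∀ U : Opens Y.carrier, Y.sec U →ₐ[k] X.sec (Opens.comap base U)
  pull_res : ∀ {U V : Opens Y.carrier} (h : U ≤ V) (s : Y.sec V),
    pull U (Y.res h s) = X.res (Opens.comap_mono base h) (pull V s)
  pull_gr : ∀ {U : Opens Y.carrier} {i : ZMod 2} {s : Y.sec U},
    s ∈ Y.gr U i → pull U s ∈ X.gr _ i
  isUnit_of_pull : ∀ {U : Opens Y.carrier} (s : Y.sec U) (x : X.carrier) (hx : base x ∈ U),
    IsUnit (germ (X := X.toPreSuperSpace) (x := x) (U := Opens.comap base U) hx (pull U s)) →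
      IsUnit (germ (X := Y.toPreSuperSpace) hx s)

namespace Hom

variable {k : Type u} [Field k] {X Y Z : SuperSpace k}

/-- Composition, `g.comp f = g ∘ f`. -/
def comp (g : Hom Y Z) (f : Hom X Y) : Hom X Z where
  base := g.base.comp f.base
  pull U := (f.pull (Opens.comap g.base U)).comp (g.pull U)
  pull_res h s := by
    exact (congrArg (f.pull _) (g.pull_res h s)).trans (f.pull_res _ _)
  pull_gr hs := f.pull_gr (g.pull_gr hs)
  isUnit_of_pull s x hx h := g.isUnit_of_pull s (f.base x) hx (f.isUnit_of_pull (g.pull _ s) x hx h)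

/-- The identity morphism. -/
def id (X : SuperSpace k) : Hom X X where
  base := ContinuousMap.id _
  pull U := AlgHom.id k (X.sec U)
  pull_res _ _ := rfl
  pull_gr hs := hs
  isUnit_of_pull _ _ _ h := h

/-- The map of stalks underlying `stalkMap`. -/
noncomputable def stalkFun (f : Hom X Y) {x : X.carrier} {y : Y.carrier} (h : f.base x = y) :
    Y.Stalk y → X.Stalk x :=
  DirectLimit.lift (Y.resNhds y)
    (fun U s => germ (X := X.toPreSuperSpace) (x := x)
      (U := Opens.comap f.base (OrderDual.ofDual U).toOpens)
      (show f.base x ∈ (OrderDual.ofDual U).toOpens from h ▸ (OrderDual.ofDual U).mem')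
      (f.pull (OrderDual.ofDual U).toOpens s))
    (fun U V hUV s => by
      refine Eq.trans ?_ (congrArg (germ (X := X.toPreSuperSpace) (x := x)
        (U := Opens.comap f.base (OrderDual.ofDual V).toOpens)
        (show f.base x ∈ (OrderDual.ofDual V).toOpens from h ▸ (OrderDual.ofDual V).mem'))
        (f.pull_res (U := (OrderDual.ofDual V).toOpens) (V := (OrderDual.ofDual U).toOpens)
          hUV s).symm)
      exact (germ_res (X := X.toPreSuperSpace) (x := x)
        (U := Opens.comap f.base (OrderDual.ofDual V).toOpens)
        (V := Opens.comap f.base (OrderDual.ofDual U).toOpens) (Opens.comap_mono f.base hUV) _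
        (f.pull (OrderDual.ofDual U).toOpens s)).symm)

theorem stalkFun_germ (f : Hom X Y) {x : X.carrier} {y : Y.carrier} (h : f.base x = y)
    {U : Opens Y.carrier} (hy : y ∈ U) (s : Y.sec U) :
    f.stalkFun h (germ hy s) = germ (X := X.toPreSuperSpace) (U := Opens.comap f.base U)
      (show f.base x ∈ U from h ▸ hy) (f.pull U s) :=
  rfl

/-- The homomorphism of stalks `𝒪_{Y,y} → 𝒪_{X,x}` for `y = f(x)`. -/
noncomputable def stalkMap (f : Hom X Y) {x : X.carrier} {y : Y.carrier} (h : f.base x = y) :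
    Y.Stalk y →ₐ[k] X.Stalk x :=
  have key : ∀ a b : Y.Stalk y, ∃ (U : Opens Y.carrier) (hy : y ∈ U) (s t : Y.sec U),
      germ hy s = a ∧ germ hy t = b := by
    intro a b
    obtain ⟨U, hU, s, rfl⟩ := exists_germ a
    obtain ⟨V, hV, t, rfl⟩ := exists_germ b
    exact ⟨U ⊓ V, ⟨hU, hV⟩, Y.res inf_le_left s, Y.res inf_le_right t, germ_res _ _ _,
      germ_res _ _ _⟩
  have hc : ∀ c : k, f.stalkFun h (algebraMap k _ c) = algebraMap k _ c := by
    intro c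
    rw [← AlgHom.commutes (germ (X := Y.toPreSuperSpace) (Opens.mem_top y)) c, stalkFun_germ,
      AlgHom.commutes, AlgHom.commutes]
  { toFun := f.stalkFun h
    map_one' := by simpa using hc 1
    map_zero' := by simpa using hc 0
    map_mul' := fun a b => by
      obtain ⟨U, hy, s, t, rfl, rfl⟩ := key a b
      rw [← map_mul, stalkFun_germ, stalkFun_germ, stalkFun_germ, map_mul, map_mul]
    map_add' := fun a b => by
      obtain ⟨U, hy, s, t, rfl, rfl⟩ := key a b
      rw [← map_add, stalkFun_germ, stalkFun_germ, stalkFun_germ, map_add, map_add]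
    commutes' := hc }

theorem stalkMap_germ (f : Hom X Y) {x : X.carrier} {y : Y.carrier} (h : f.base x = y)
    {U : Opens Y.carrier} (hy : y ∈ U) (s : Y.sec U) :
    f.stalkMap h (germ hy s) = germ (X := X.toPreSuperSpace) (U := Opens.comap f.base U)
      (show f.base x ∈ U from h ▸ hy) (f.pull U s) :=
  rfl

end Hom

/-- The presheaf of `k^{0|0}`: on a space with one point, the sections over `U` are the functions
`U → k`. -/
def pointPre (k : Type u) [Field k] : PreSuperSpace k where
  carrier := PUnit.{u + 1}
  sec U := U → k
  gr U i := if i = 0 then ⊤ else ⊥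
  isSuperalgebra U :=
    { isCompl := by simpa using isCompl_top_bot
      one_mem := by simp
      mul_mem := by
        intro i j a b ha hb
        by_cases hi : i = 0
        · by_cases hj : j = 0
          · simp [hi, hj]
          · have : b = 0 := by simpa [hj] using hb
            simp [this]
        · have : a = 0 := by simpa [hi] using ha
          simp [this] }
  res h :=
    { toFun := fun s x => s ⟨x.1, h x.2⟩
      map_one' := rfl
      map_mul' := fun _ _ => rfl
      map_zero' := rfl
      map_add' := fun _ _ => rfl
      commutes' := fun _ => rfl }
  res_id _ := rfl
  res_res _ _ _ := rfl
  res_gr h i s hs := by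
    by_cases hi : i = 0
    · simp [hi]
    · have : s = 0 := by simpa [hi] using hs
      simp [this]

theorem pointPre_isUnit {k : Type u} [Field k] {U : Opens (pointPre k).carrier}
    {x : (pointPre k).carrier} (hx : x ∈ U) (s : U → k) (h : s ⟨x, hx⟩ ≠ 0) :
    IsUnit (M := (pointPre k).sec U) s := by
  refine (Pi.isUnit_iff (M := fun _ : U => k)).2 fun y => ?_
  have : y = ⟨x, hx⟩ := Subtype.ext (Subsingleton.elim (α := PUnit.{u + 1}) _ _)
  rw [this]
  exact h.isUnit

theorem pointPre_germ_eq_iff {k : Type u} [Field k] {U V : Opens (pointPre k).carrier}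
    {x : (pointPre k).carrier} (hU : x ∈ U) (hV : x ∈ V) (s : U → k) (t : V → k) :
    germ (X := pointPre k) hU s = germ (X := pointPre k) hV t ↔ s ⟨x, hU⟩ = t ⟨x, hV⟩ := by
  refine (germ_eq_iff (X := pointPre k) hU hV s t).trans ?_
  constructor
  · rintro ⟨W, hW, h, h', e⟩
    exact congrFun e ⟨x, hW⟩
  · intro e
    refine ⟨U ⊓ V, ⟨hU, hV⟩, inf_le_left, inf_le_right, funext fun y => ?_⟩
    have : y = ⟨x, hU, hV⟩ := Subtype.ext (Subsingleton.elim (α := PUnit.{u + 1}) _ _)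
    rw [this]
    exact e

theorem pointPre_isLocalRing {k : Type u} [Field k] (x : (pointPre k).carrier) :
    IsLocalRing ((pointPre k).Stalk x) := by
  have h01 : (0 : (pointPre k).Stalk x) ≠ 1 := by
    rw [← map_zero (germ (X := pointPre k) (Opens.mem_top x)),
      ← map_one (germ (X := pointPre k) (Opens.mem_top x)), Ne]
    exact fun h => zero_ne_one (α := k) ((pointPre_germ_eq_iff _ _ _ _).1 h)
  have : Nontrivial ((pointPre k).Stalk x) := ⟨⟨0, 1, h01⟩⟩
  refine { isUnit_or_isUnit_of_add_one := ?_ }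
  intro a b hab
  obtain ⟨U, hU, s, rfl⟩ := exists_germ a
  obtain ⟨V, hV, t, rfl⟩ := exists_germ b
  by_cases h : s ⟨x, hU⟩ = (0 : k)
  · right
    refine (pointPre_isUnit hV t fun h' => h01 ?_).map (germ (X := pointPre k) hV)
    have hs : germ (X := pointPre k) hU s = 0 := by
      rw [← map_zero (germ (X := pointPre k) hU)]
      exact (pointPre_germ_eq_iff _ _ _ _).2 h
    have ht : germ (X := pointPre k) hV t = 0 := by
      rw [← map_zero (germ (X := pointPre k) hV)]
      exact (pointPre_germ_eq_iff _ _ _ _).2 h'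
    rw [← hab, hs, ht, add_zero]
  · exact Or.inl ((pointPre_isUnit hU s h).map (germ (X := pointPre k) hU))

/-- The superspace `k^{0|0}`. -/
def point (k : Type u) [Field k] : SuperSpace k where
  toPreSuperSpace := pointPre k
  supercommutative U := by
    intro i j a b ha hb
    by_cases hi : i = 0
    · have : a * b = b * a := funext fun x => mul_comm (G := k) _ _
      simp [koszul, hi, this]
    · have ha' : a ∈ (if i = 0 then ⊤ else ⊥ : Submodule k ((pointPre k).sec U)) := ha
      have : a = 0 := by rwa [if_neg hi, Submodule.mem_bot] at ha'
      simp [this]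
  sheaf V s hs := by
    have hx : ∀ x : (iSup V : Opens (pointPre k).carrier), ∃ i, x.1 ∈ V i := fun x =>
      Opens.mem_iSup.1 x.2
    choose i hi using hx
    refine ⟨fun x => s (i x) ⟨x.1, hi x⟩, fun j => ?_, fun t ht => ?_⟩
    · funext x
      exact congrFun (hs (i ⟨x.1, le_iSup V j x.2⟩) j) ⟨x.1, hi _, x.2⟩
    · funext x
      exact congrFun (ht (i x)) ⟨x.1, hi x⟩
  isLocalRing := pointPre_isLocalRing

/-- The point of `k^{0|0}`. -/
def pt (k : Type u) [Field k] : (point k).carrier := PUnit.unit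

/-! ### Algebraic superschemes -/

section Algebraic

variable {k : Type u} [Field k] (X : SuperSpace k)

/-- The even sections over `U`. -/
def evenPart (U : Opens X.carrier) : Subalgebra k (X.sec U) :=
  { X.gr U 0 with
    mul_mem' := fun {a b} ha hb => by
      simpa using (X.isSuperalgebra U).mul_mem (i := 0) (j := 0) ha hb
    one_mem' := (X.isSuperalgebra U).one_mem
    algebraMap_mem' := fun c => by
      change algebraMap k (X.sec U) c ∈ X.gr U 0
      rw [Algebra.algebraMap_eq_smul_one]
      exact (X.gr U 0).smul_mem c (X.isSuperalgebra U).one_mem }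

instance (U : Opens X.carrier) : CommRing (evenPart X U) :=
  { (inferInstance : Ring (evenPart X U)) with
    mul_comm := fun a b => Subtype.ext (by
      simpa [koszul] using X.supercommutative U (i := 0) (j := 0) a.2 b.2) }

/-- The open subspace `U` is `Spec A` for a finitely generated superalgebra `A` over `k`, namely for
`A = 𝒪(U)`: its points are the primes of `A₀`, the prime of `x` being the set of `f` that vanish at
`x`, and for `f ∈ A₀` the sections over the basic open set `D(f)` are the localization `A_f`. -/
structure IsAffineAlgebraic (U : Opens X.carrier) : Prop where
  finiteType : Algebra.FiniteType k (X.sec U)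
  spec : ∃ h : U ≃ₜ PrimeSpectrum (evenPart X U), ∀ (x : U) (f : evenPart X U),
    f ∈ (h x).asIdeal ↔ ¬ IsUnit (germ (X := X.toPreSuperSpace) x.2 f.1)
  isUnit_res : ∀ (f : evenPart X U) (V : Opens X.carrier) (hV : V ≤ U),
    (∀ x : U, x.1 ∈ V ↔ IsUnit (germ (X := X.toPreSuperSpace) x.2 f.1)) → IsUnit (X.res hV f.1)
  exists_pow_mul_eq : ∀ (f : evenPart X U) (V : Opens X.carrier) (hV : V ≤ U),
    (∀ x : U, x.1 ∈ V ↔ IsUnit (germ (X := X.toPreSuperSpace) x.2 f.1)) →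
      ∀ s : X.sec V, ∃ (n : ℕ) (a : X.sec U), X.res hV f.1 ^ n * s = X.res hV a
  exists_pow_mul_eq_zero : ∀ (f : evenPart X U) (V : Opens X.carrier) (hV : V ≤ U),
    (∀ x : U, x.1 ∈ V ↔ IsUnit (germ (X := X.toPreSuperSpace) x.2 f.1)) →
      ∀ a : X.sec U, X.res hV a = 0 → ∃ n : ℕ, f.1 ^ n * a = 0

/-- Algebraic superschemes over `k`: superschemes of finite type over `k`. -/
def IsAlgebraicSuperscheme : Prop :=
  CompactSpace X.carrier ∧ ∀ x : X.carrier, ∃ U : Opens X.carrier, x ∈ U ∧ IsAffineAlgebraic X U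

variable {X} in
theorem isAlgebraicSuperscheme_of_subsingleton [Subsingleton X.carrier] (x : X.carrier)
    (hfin : Module.Finite k (X.sec ⊤)) (hunit : ∀ s : X.sec ⊤, s = 0 ∨ IsUnit s)
    (heven : ∀ s : X.sec ⊤, s ∈ X.gr ⊤ 0) (hbot : Subsingleton (X.sec ⊥)) :
    IsAlgebraicSuperscheme X := by
  have hloc := X.isLocalRing x
  have hV : ∀ V : Opens X.carrier, V = ⊤ ∨ V = ⊥ := by
    intro V
    by_cases hx : x ∈ V
    · exact Or.inl (Opens.ext (Set.eq_univ_of_forall fun y => Subsingleton.elim x y ▸ hx))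
    · exact Or.inr (Opens.ext (Set.eq_empty_of_forall_notMem fun y hy =>
        hx (Subsingleton.elim y x ▸ hy)))
  have hg0 : germ (X := X.toPreSuperSpace) (Opens.mem_top x) 0 = 0 := map_zero _
  have hne : (0 : X.sec ⊤) ≠ 1 := fun h => zero_ne_one (α := X.Stalk x) (by
    rw [← map_one (germ (X := X.toPreSuperSpace) (Opens.mem_top x)), ← h, hg0])
  have hgerm : ∀ (s : X.sec ⊤) (y : (⊤ : Opens X.carrier)),
      IsUnit (germ (X := X.toPreSuperSpace) y.2 s) ↔ s ≠ 0 := by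
    intro s y
    have hy := X.isLocalRing y.1
    constructor
    · rintro h rfl
      rw [map_zero] at h
      exact not_isUnit_zero h
    · intro h
      exact ((hunit s).resolve_left h).map _
  have hE : ∀ f : evenPart X ⊤, f ≠ 0 → IsUnit f := by
    intro f hf
    obtain ⟨v, hv⟩ := (hunit f.1).resolve_left fun h => hf (Subtype.ext h)
    refine ⟨⟨f, ⟨(↑v⁻¹ : X.sec ⊤), heven _⟩, Subtype.ext ?_, Subtype.ext ?_⟩, rfl⟩
    · change f.1 * ↑v⁻¹ = 1
      rw [← hv, Units.mul_inv]
    · change ↑v⁻¹ * f.1 = 1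
      rw [← hv, Units.inv_mul]
  have : Nontrivial (evenPart X ⊤) := ⟨⟨0, 1, fun h => hne (congrArg Subtype.val h)⟩⟩
  have hprime : ∀ P : PrimeSpectrum (evenPart X ⊤), P.asIdeal = ⊥ := by
    intro P
    refine (Submodule.eq_bot_iff _).2 fun f hf => ?_
    by_contra h0
    exact P.isPrime.ne_top (Ideal.eq_top_of_isUnit_mem _ hf (hE f h0))
  have hdom : (⊥ : Ideal (evenPart X ⊤)).IsPrime := by
    refine Ideal.isPrime_iff.2 ⟨bot_ne_top, fun {a b} hab => ?_⟩
    by_contra hc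
    rw [not_or] at hc
    have := (hE a hc.1).mul (hE b hc.2)
    rw [(Submodule.mem_bot _).1 hab] at this
    exact not_isUnit_zero this
  have : Unique (PrimeSpectrum (evenPart X ⊤)) :=
    { default := ⟨⊥, hdom⟩, uniq := fun P => PrimeSpectrum.ext (hprime P) }
  have : Unique (⊤ : Opens X.carrier) :=
    { default := ⟨x, trivial⟩, uniq := fun y => Subtype.ext (Subsingleton.elim _ _) }
  refine ⟨inferInstance, fun y => ⟨⊤, trivial, inferInstance,
    ⟨Homeomorph.homeomorphOfUnique _ _, fun z f => ?_⟩, fun f V hVT h => ?_,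
    fun f V hVT h s => ?_, fun f V hVT h a ha => ?_⟩⟩
  · rw [hprime, Submodule.mem_bot, hgerm, not_not]
    exact ⟨congrArg Subtype.val, fun h => Subtype.ext h⟩
  · rcases hV V with rfl | rfl
    · rw [X.res_id]
      exact (hunit f.1).resolve_left ((hgerm f.1 ⟨x, trivial⟩).1 ((h ⟨x, trivial⟩).1 trivial))
    · exact isUnit_of_subsingleton _
  · rcases hV V with rfl | rfl
    · exact ⟨0, s, by rw [X.res_id s, pow_zero, _root_.one_mul]⟩
    · exact ⟨0, 0, Subsingleton.elim _ _⟩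
  · rcases hV V with rfl | rfl
    · exact ⟨0, by rwa [X.res_id, ← _root_.one_mul a, ← pow_zero f.1] at ha⟩
    · refine ⟨1, ?_⟩
      have hf : f.1 = 0 := by
        by_contra hf
        exact ((h ⟨x, trivial⟩).2 ((hgerm f.1 ⟨x, trivial⟩).2 hf)).elim
      rw [hf, pow_one, zero_mul]

theorem isAlgebraicSuperscheme_point (k : Type u) [Field k] :
    IsAlgebraicSuperscheme (point k) := by
  have : Subsingleton (point k).carrier := inferInstanceAs (Subsingleton PUnit.{u + 1})
  refine isAlgebraicSuperscheme_of_subsingleton (pt k) ?_ (fun s => ?_) (fun s => ?_) ?_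
  · exact inferInstanceAs (Module.Finite k ((⊤ : Opens PUnit.{u + 1}) → k))
  · by_cases h : (s : (⊤ : Opens (pointPre k).carrier) → k) ⟨pt k, trivial⟩ = 0
    · left
      funext y
      have : y = ⟨pt k, trivial⟩ := Subtype.ext (Subsingleton.elim _ _)
      rw [this]
      exact h
    · exact Or.inr (pointPre_isUnit (U := ⊤) (x := pt k) trivial s h)
  · exact Submodule.mem_top (R := k) (M := (⊤ : Opens PUnit.{u + 1}) → k)
  · exact ⟨fun a b => funext fun y => y.2.elim⟩

end Algebraic

/-! ### Analytic supermanifolds -/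

section Analytic

variable {k : Type u} [NontriviallyNormedField k] (X : SuperSpace k)

/-- An isomorphism of the open subspace `U` with an open subspace of `k^{p|q}`, whose sections over an
open set `V ⊆ k^p` are the analytic functions `V → Λ(k^q)`. -/
structure AnalyticChart (U : Opens X.carrier) (p q : ℕ) where
  target : Opens (Fin p → k)
  coord : U ≃ₜ target
  /-- the section `s`, viewed as a function with values in `Λ(k^q)` -/
  val : ∀ {W : Opens X.carrier}, W ≤ U → (X.sec W →ₐ[k] (W → ExteriorAlgebra k (Fin q → k)))
  val_res : ∀ {W W' : Opens X.carrier} (h : W' ≤ W) (hW : W ≤ U) (s : X.sec W) (x : W'),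
    val (h.trans hW) (X.res h s) x = val hW s ⟨x.1, h x.2⟩
  val_gr : ∀ {W : Opens X.carrier} (hW : W ≤ U) {i : ZMod 2} {s : X.sec W}, s ∈ X.gr W i →
    ∀ x, val hW s x ∈ CliffordAlgebra.evenOdd (0 : QuadraticForm k (Fin q → k)) i
  val_injective : ∀ {W : Opens X.carrier} (hW : W ≤ U), Function.Injective (val hW)
  /-- analyticity means that all components with respect to a basis of `Λ(k^q)` are analytic -/
  mem_range_val : ∀ {W : Opens X.carrier} (hW : W ≤ U) (F : W → ExteriorAlgebra k (Fin q → k)),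
    F ∈ Set.range (val hW) ↔
      ∃ E : (Fin p → k) → ExteriorAlgebra k (Fin q → k),
        (∀ x : W, F x = E (coord ⟨x.1, hW x.2⟩).1) ∧
        ∀ (l : Module.Dual k (ExteriorAlgebra k (Fin q → k))) (x : W),
          AnalyticAt k (fun y => l (E y)) (coord ⟨x.1, hW x.2⟩).1

/-- Analytic supermanifolds over `k`. -/
def IsAnalyticSupermanifold : Prop :=
  T2Space X.carrier ∧ ∀ x : X.carrier, ∃ U : Opens X.carrier, x ∈ U ∧
    ∃ p q : ℕ, Nonempty (AnalyticChart X U p q)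

theorem isAnalyticSupermanifold_point (k : Type u) [NontriviallyNormedField k] :
    IsAnalyticSupermanifold (point k) := by
  have hsub : Subsingleton (point k).carrier := inferInstanceAs (Subsingleton PUnit.{u + 1})
  have hu : Unique (⊤ : Opens (point k).carrier) :=
    { default := ⟨pt k, trivial⟩, uniq := fun y => Subtype.ext (Subsingleton.elim _ _) }
  have hu' : Unique (⊤ : Opens (Fin 0 → k)) :=
    { default := ⟨0, trivial⟩, uniq := fun y => Subtype.ext (Subsingleton.elim _ _) }
  have hsurj : Function.Surjective (algebraMap k (ExteriorAlgebra k (Fin 0 → k))) := by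
    intro v
    induction v using ExteriorAlgebra.induction with
    | algebraMap r => exact ⟨r, rfl⟩
    | ι x => exact ⟨0, by rw [Subsingleton.elim x 0, map_zero, map_zero]⟩
    | mul a b ha hb =>
      obtain ⟨r, rfl⟩ := ha
      obtain ⟨t, rfl⟩ := hb
      exact ⟨r * t, map_mul _ _ _⟩
    | add a b ha hb =>
      obtain ⟨r, rfl⟩ := ha
      obtain ⟨t, rfl⟩ := hb
      exact ⟨r + t, map_add _ _ _⟩
  have hinj : Function.Injective (algebraMap k (ExteriorAlgebra k (Fin 0 → k))) :=
    FaithfulSMul.algebraMap_injective _ _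
  refine ⟨inferInstanceAs (T2Space PUnit.{u + 1}), fun x => ⟨⊤, trivial, 0, 0, ⟨{
    target := ⊤
    coord := Homeomorph.homeomorphOfUnique _ _
    val := fun {W} _ =>
      { toFun := fun s y => algebraMap k _ ((s : W → k) y)
        map_one' := funext fun y => map_one _
        map_mul' := fun s t => funext fun y => map_mul _ _ _
        map_zero' := funext fun y => map_zero _
        map_add' := fun s t => funext fun y => map_add _ _ _
        commutes' := fun c => rfl }
    val_res := fun _ _ _ _ => rfl
    val_gr := ?_
    val_injective := ?_
    mem_range_val := ?_ }⟩⟩⟩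
  · intro W hW i s hs y
    by_cases hi : i = 0
    · subst hi
      exact CliffordAlgebra.one_le_evenOdd_zero _ (Submodule.mem_one.2 ⟨(s : W → k) y, rfl⟩)
    · have hs' : ∀ v : W → k, v ∈ (if i = 0 then ⊤ else ⊥ : Submodule k (W → k)) → v = 0 := by
        intro v hv
        rwa [if_neg hi, Submodule.mem_bot] at hv
      have h0 : algebraMap k (ExteriorAlgebra k (Fin 0 → k)) ((s : W → k) y) ∈
          CliffordAlgebra.evenOdd (0 : QuadraticForm k (Fin 0 → k)) i := by
        rw [hs' s hs, Pi.zero_apply, map_zero]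
        exact zero_mem _
      exact h0
  · intro W hW s t h
    exact funext fun y => hinj (congrFun h y)
  · intro W hW F
    constructor
    · intro _
      by_cases hne : Nonempty W
      · obtain ⟨y⟩ := hne
        refine ⟨fun _ => F y, fun z => ?_, fun _ _ => analyticAt_const⟩
        have : z = y := Subtype.ext (Subsingleton.elim _ _)
        rw [this]
      · exact ⟨0, fun z => (hne ⟨z⟩).elim, fun _ z => (hne ⟨z⟩).elim⟩
    · intro _
      choose r hr using fun y => hsurj (F y)
      exact ⟨(r : W → k), funext hr⟩

end Analytic

/-! ### Distributions -/

section Distributions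

variable {k : Type u} [Field k] (X : SuperSpace k) (x : X.carrier)

/-- The maximal ideal `m_{X,x}` of the stalk. -/
def maximalIdeal : Submodule k (X.Stalk x) where
  carrier := {a | ¬ IsUnit a}
  zero_mem' := by
    have := X.isLocalRing x
    exact not_isUnit_zero
  add_mem' := by
    have := X.isLocalRing x
    intro a b ha hb h
    obtain ⟨u, hu⟩ := h
    have e : (↑u⁻¹ * a) + (↑u⁻¹ * b) = 1 := by rw [← mul_add, ← hu, Units.inv_mul]
    rcases IsLocalRing.isUnit_or_isUnit_of_add_one e with h | h
    · exact ha ((Units.isUnit_units_mul _ _).1 h)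
    · exact hb ((Units.isUnit_units_mul _ _).1 h)
  smul_mem' := by
    have := X.isLocalRing x
    intro c a ha h
    by_cases hc : c = 0
    · rw [hc, zero_smul] at h
      exact not_isUnit_zero h
    · exact ha ((isUnit_smul_iff (Units.mk0 c hc) a).1 h)

theorem mul_mem_maximalIdeal {a b : X.Stalk x} (ha : a ∈ maximalIdeal X x) :
    a * b ∈ maximalIdeal X x := by
  have := X.isLocalRing x
  intro h
  apply ha
  obtain ⟨u, hu⟩ := h
  set r := b * ↑u⁻¹ with hr
  have har : a * r = 1 := by rw [hr, ← mul_assoc, ← hu, Units.mul_inv]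
  have hid : (r * a) * (r * a) = r * a := by
    rw [mul_assoc, ← mul_assoc a r a, har, one_mul]
  rcases IsLocalRing.isUnit_or_isUnit_of_add_one (add_sub_cancel (r * a) 1) with h1 | h1
  · have : r * a = 1 := h1.mul_left_cancel (by rw [hid, mul_one])
    exact ⟨⟨a, r, har, this⟩, rfl⟩
  · have : r * a = 0 := h1.mul_left_cancel (by rw [sub_mul, one_mul, hid, sub_self, mul_zero])
    exfalso
    have h0 : a = 0 := by rw [← one_mul a, ← har, mul_assoc, this, mul_zero]
    rw [h0, zero_mul] at har
    exact zero_ne_one har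

theorem maximalIdeal_pow_le {m n : ℕ} (h : m ≤ n) :
    maximalIdeal X x ^ (n + 1) ≤ maximalIdeal X x ^ (m + 1) := by
  induction n, h using Nat.le_induction with
  | base => exact le_rfl
  | succ n _ ih =>
    refine le_trans ?_ ih
    rw [pow_succ' _ (n + 1), pow_succ' _ n, ← mul_assoc]
    exact mul_le_mul_left (Submodule.mul_le.2 fun a ha b _ => mul_mem_maximalIdeal X x ha) _

/-- The space `D(X,x)` of distributions supported at `x`: the linear forms on the stalk at `x` which
vanish on `m^(n+1)` for some `n`. -/
def Distributions : Submodule k (Module.Dual k (X.Stalk x)) where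
  carrier := {φ | ∃ n : ℕ, ∀ a ∈ maximalIdeal X x ^ (n + 1), φ a = 0}
  zero_mem' := ⟨0, fun _ _ => rfl⟩
  add_mem' := by
    rintro φ ψ ⟨m, hm⟩ ⟨n, hn⟩
    refine ⟨max m n, fun a ha => ?_⟩
    rw [LinearMap.add_apply, hm a (maximalIdeal_pow_le X x (le_max_left m n) ha),
      hn a (maximalIdeal_pow_le X x (le_max_right m n) ha), add_zero]
  smul_mem' := by
    rintro c φ ⟨n, hn⟩
    exact ⟨n, fun a ha => by rw [LinearMap.smul_apply, hn a ha, smul_zero]⟩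

/-- A distribution has parity `i` when it vanishes on the germs of the other parity. -/
def distGr (i : ZMod 2) : Submodule k (Distributions X x) where
  carrier := {φ | ∀ j, j ≠ i → ∀ a ∈ X.stalkGr x j, φ.1 a = 0}
  zero_mem' := fun _ _ _ _ => rfl
  add_mem' := fun {φ ψ} hφ hψ j hj a ha => by
    simp [hφ j hj a ha, hψ j hj a ha]
  smul_mem' := fun c φ hφ j hj a ha => by
    simp [hφ j hj a ha]

/-- The tangent space `D_1(X,x)^+ = (m/m²)^*`: the distributions vanishing on `m²` and on `1`. -/
def tangentSpace : Submodule k (Module.Dual k (X.Stalk x)) where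
  carrier := {φ | φ 1 = 0 ∧ ∀ a ∈ maximalIdeal X x ^ 2, φ a = 0}
  zero_mem' := ⟨rfl, fun _ _ => rfl⟩
  add_mem' := fun {φ ψ} hφ hψ =>
    ⟨by simp [hφ.1, hψ.1], fun a ha => by simp [hφ.2 a ha, hψ.2 a ha]⟩
  smul_mem' := fun c φ hφ => ⟨by simp [hφ.1], fun a ha => by simp [hφ.2 a ha]⟩

theorem tangentSpace_le : tangentSpace X x ≤ Distributions X x := fun _ hφ => ⟨1, hφ.2⟩

end Distributions

/-! ### Supergroups -/

/-- `P`, with the projections `p₁` and `p₂`, is a product of `X` and `Y` in the category of the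
superspaces with property `Q`. -/
def IsProduct {k : Type u} [Field k] (Q : SuperSpace k → Prop) {X Y P : SuperSpace k}
    (p₁ : Hom P X) (p₂ : Hom P Y) : Prop :=
  ∀ T : SuperSpace k, Q T → ∀ (a : Hom T X) (b : Hom T Y),
    ∃! c : Hom T P, p₁.comp c = a ∧ p₂.comp c = b

/-- The morphism `(a, b)` to a product. -/
noncomputable def IsProduct.lift {k : Type u} [Field k] {Q : SuperSpace k → Prop}
    {X Y P : SuperSpace k} {p₁ : Hom P X} {p₂ : Hom P Y} (h : IsProduct Q p₁ p₂)
    {T : SuperSpace k} (hT : Q T) (a : Hom T X) (b : Hom T Y) : Hom T P :=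
  (h T hT a b).choose

theorem IsProduct.lift_spec {k : Type u} [Field k] {Q : SuperSpace k → Prop}
    {X Y P : SuperSpace k} {p₁ : Hom P X} {p₂ : Hom P Y} (h : IsProduct Q p₁ p₂)
    {T : SuperSpace k} (hT : Q T) (a : Hom T X) (b : Hom T Y) :
    p₁.comp (h.lift hT a b) = a ∧ p₂.comp (h.lift hT a b) = b :=
  (h T hT a b).choose_spec.1

/-- A group object `G` in the category of the superspaces with property `Q`, with multiplication `m`,
identity `e` and inverse `inv`. The axioms say that they make the `T`-points of `G` a group, for all
`T`; for the morphism `t` of `T` to the terminal object `k^{0|0}`, `e.comp t` is the identity. -/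
structure Supergroup {k : Type u} [Field k] (Q : SuperSpace k → Prop) (hQ : Q (point k)) where
  G : SuperSpace k
  hG : Q G
  /-- the product `G × G` -/
  GG : SuperSpace k
  hGG : Q GG
  p₁ : Hom GG G
  p₂ : Hom GG G
  isProduct : IsProduct Q p₁ p₂
  m : Hom GG G
  e : Hom (point k) G
  inv : Hom G G
  assoc : ∀ (T : SuperSpace k) (hT : Q T) (a b c : Hom T G),
    m.comp (isProduct.lift hT (m.comp (isProduct.lift hT a b)) c) =
      m.comp (isProduct.lift hT a (m.comp (isProduct.lift hT b c)))
  one_mul : ∀ (T : SuperSpace k) (hT : Q T) (t : Hom T (point k)) (a : Hom T G),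
    m.comp (isProduct.lift hT (e.comp t) a) = a
  mul_one : ∀ (T : SuperSpace k) (hT : Q T) (t : Hom T (point k)) (a : Hom T G),
    m.comp (isProduct.lift hT a (e.comp t)) = a
  inv_mul : ∀ (T : SuperSpace k) (hT : Q T) (t : Hom T (point k)) (a : Hom T G),
    m.comp (isProduct.lift hT (inv.comp a) a) = e.comp t
  mul_inv : ∀ (T : SuperSpace k) (hT : Q T) (t : Hom T (point k)) (a : Hom T G),
    m.comp (isProduct.lift hT a (inv.comp a)) = e.comp t

/-! ### Lie superalgebras and their enveloping superalgebras -/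

/-- Lie superalgebras over a field of characteristic zero. -/
structure LieSuperalgebra (k g : Type u) [Field k] [AddCommGroup g] [Module k g] where
  gr : ZMod 2 → Submodule k g
  isCompl : IsCompl (gr 0) (gr 1)
  bracket : g →ₗ[k] g →ₗ[k] g
  bracket_mem : ∀ {i j : ZMod 2} {x y : g}, x ∈ gr i → y ∈ gr j → bracket x y ∈ gr (i + j)
  skew : ∀ {i j : ZMod 2} {x y : g}, x ∈ gr i → y ∈ gr j →
    bracket x y = -(koszul k i j • bracket y x)
  jacobi : ∀ {i j : ZMod 2} {x y : g} (z : g), x ∈ gr i → y ∈ gr j →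
    bracket x (bracket y z) = bracket (bracket x y) z + koszul k i j • bracket y (bracket x z)

namespace LieSuperalgebra

variable {k g : Type u} [Field k] [AddCommGroup g] [Module k g] (L : LieSuperalgebra k g)

/-- The relations `x y - (-1)^(|x| |y|) y x = [x, y]`. -/
inductive Rel : TensorAlgebra k g → TensorAlgebra k g → Prop
  | of {i j : ZMod 2} {x y : g} (hx : x ∈ L.gr i) (hy : y ∈ L.gr j) :
      Rel (TensorAlgebra.ι k x * TensorAlgebra.ι k y -
        koszul k i j • (TensorAlgebra.ι k y * TensorAlgebra.ι k x))
        (TensorAlgebra.ι k (L.bracket x y))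

/-- The universal enveloping superalgebra. -/
abbrev Enveloping : Type u := RingQuot L.Rel

/-- The canonical map of `g` to its universal enveloping superalgebra. -/
noncomputable def ι : g →ₗ[k] L.Enveloping :=
  (RingQuot.mkAlgHom k L.Rel).toLinearMap ∘ₗ TensorAlgebra.ι k

/-- The grading: a product of homogeneous elements of `g` has the sum of their parities. -/
def envelopingGr (i : ZMod 2) : Submodule k L.Enveloping :=
  Submodule.span k {v | ∃ l : List (Σ j : ZMod 2, L.gr j),
    (l.map Sigma.fst).sum = i ∧ v = (l.map fun a => L.ι a.2.1).prod}

end LieSuperalgebra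

/-! ### The convolution superalgebra of a supergroup -/

/-- The bilinear product `mul` with unit `one` makes `A = A₀ ⊕ A₁` an associative superalgebra. -/
structure IsSuperalgebraProduct {k A : Type u} [Field k] [AddCommGroup A] [Module k A]
    (gr : ZMod 2 → Submodule k A) (mul : A →ₗ[k] A →ₗ[k] A) (one : A) : Prop where
  isCompl : IsCompl (gr 0) (gr 1)
  one_mem : one ∈ gr 0
  mul_mem : ∀ {i j : ZMod 2} {a b : A}, a ∈ gr i → b ∈ gr j → mul a b ∈ gr (i + j)
  one_mul : ∀ a, mul one a = a
  mul_one : ∀ a, mul a one = a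
  mul_assoc : ∀ a b c, mul (mul a b) c = mul a (mul b c)

namespace Supergroup

variable {k : Type u} [Field k] {Q : SuperSpace k → Prop} {hQ : Q (point k)} (H : Supergroup Q hQ)

/-- The point `(e, e)` of `G × G`. -/
noncomputable def ee : Hom (point k) H.GG := H.isProduct.lift hQ H.e H.e

theorem m_comp_ee : H.m.comp H.ee = H.e := H.one_mul (point k) hQ (Hom.id _) H.e

/-- The identity, as a point of the underlying space of `G`. -/
def idPt : H.G.carrier := H.e.base (pt k)

/-- The point `(e, e)` of the underlying space of `G × G`. -/
noncomputable def idPt₂ : H.GG.carrier := H.ee.base (pt k)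

theorem p₁_idPt₂ : H.p₁.base H.idPt₂ = H.idPt :=
  congrArg (fun f : Hom (point k) H.G => f.base (pt k))
    (H.isProduct.lift_spec hQ H.e H.e).1

theorem p₂_idPt₂ : H.p₂.base H.idPt₂ = H.idPt :=
  congrArg (fun f : Hom (point k) H.G => f.base (pt k))
    (H.isProduct.lift_spec hQ H.e H.e).2

theorem m_idPt₂ : H.m.base H.idPt₂ = H.idPt :=
  congrArg (fun f : Hom (point k) H.G => f.base (pt k)) H.m_comp_ee

/-- The space `D(G,e)`. -/
abbrev D : Type u := Distributions H.G H.idPt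

/-- The space `Lie(G) = D_1(G,e)^+`. -/
abbrev Lie : Type u := tangentSpace H.G H.idPt

/-- The inclusion of `Lie(G)` in `D(G,e)`. -/
noncomputable def incl : H.Lie →ₗ[k] H.D := Submodule.inclusion (tangentSpace_le H.G H.idPt)

/-- `T` is the distribution `φ ⊗ ψ` on `G × G` at `(e, e)`: on the products `f ⊗ g` of functions on the
two factors, `(φ ⊗ ψ)(f ⊗ g) = (-1)^(|ψ| |f|) φ(f) ψ(g)`. The sign may be written `(-1)^(|f| |g|)`,
since a homogeneous `ψ` vanishes on the homogeneous `g` of the other parity. -/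
def IsTensor (φ ψ : H.D) (T : Distributions H.GG H.idPt₂) : Prop :=
  ∀ (i j : ZMod 2) (f g : H.G.Stalk H.idPt), f ∈ H.G.stalkGr H.idPt i → g ∈ H.G.stalkGr H.idPt j →
    T.1 (H.p₁.stalkMap H.p₁_idPt₂ f * H.p₂.stalkMap H.p₂_idPt₂ g) = koszul k i j * (φ.1 f * ψ.1 g)

/-- `mul` is the convolution product `(φ ⋆ ψ)(f) = (φ ⊗ ψ)(m^* f)` of `D(G,e)`, including that
`φ ⊗ ψ` is well-defined. -/
structure IsConvolution (mul : H.D →ₗ[k] H.D →ₗ[k] H.D) : Prop where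
  existsUnique_tensor : ∀ φ ψ : H.D, ∃! T : Distributions H.GG H.idPt₂, H.IsTensor φ ψ T
  mul_apply : ∀ (φ ψ : H.D) (T : Distributions H.GG H.idPt₂), H.IsTensor φ ψ T →
    ∀ f : H.G.Stalk H.idPt, (mul φ ψ).1 f = T.1 (H.m.stalkMap H.m_idPt₂ f)

/-- `one` is the evaluation `ev_e : 𝒪_{G,e} → k`, the homomorphism given by the point `e`. -/
def IsEvaluation (one : H.D) : Prop :=
  ∀ f : H.G.Stalk H.idPt,
    H.e.stalkMap (x := pt k) (y := H.idPt) rfl f =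
      algebraMap k ((point k).toPreSuperSpace.Stalk (pt k)) (one.1 f)

/-- `L` is the Lie superalgebra structure of `Lie(G)`: the grading is that of `D(G,e)`, and the bracket
is the supercommutator for the convolution product `mul`. -/
structure IsLieStructure (mul : H.D →ₗ[k] H.D →ₗ[k] H.D) (L : LieSuperalgebra k H.Lie) : Prop where
  mem_gr : ∀ (i : ZMod 2) (x : H.Lie), x ∈ L.gr i ↔ H.incl x ∈ distGr H.G H.idPt i
  bracket_eq : ∀ {i j : ZMod 2} {x y : H.Lie}, x ∈ L.gr i → y ∈ L.gr j →
    H.incl (L.bracket x y) =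
      mul (H.incl x) (H.incl y) - koszul k i j • mul (H.incl y) (H.incl x)

/-- `a` is a homomorphism of unital algebras from `U(g)`, `g = Lie(G)`, to `D(G,e)` that restricts to
the inclusion on `g`. -/
structure IsExtension (mul : H.D →ₗ[k] H.D →ₗ[k] H.D) (one : H.D) (L : LieSuperalgebra k H.Lie)
    (a : L.Enveloping →ₗ[k] H.D) : Prop where
  map_one : a 1 = one
  map_mul : ∀ v w, a (v * w) = mul (a v) (a w)
  map_ι : ∀ x : H.Lie, a (L.ι x) = H.incl x

/-- The convolution product is well-defined and makes `D(G,e)` a superalgebra with unit `ev_e`;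
`Lie(G)` is a Lie superalgebra for the supercommutator; its inclusion in `D(G,e)` extends uniquely to
a homomorphism of algebras `a : U(Lie(G)) → D(G,e)`, and `a` is an isomorphism of superalgebras. -/
def EnvelopingIsoDistributions : Prop :=
  ∃ (mul : H.D →ₗ[k] H.D →ₗ[k] H.D) (one : H.D) (L : LieSuperalgebra k H.Lie)
    (a : L.Enveloping →ₗ[k] H.D),
    H.IsConvolution mul ∧ H.IsEvaluation one ∧
    IsSuperalgebraProduct (distGr H.G H.idPt) mul one ∧
    H.IsLieStructure mul L ∧
    H.IsExtension mul one L a ∧ (∀ b, H.IsExtension mul one L b → b = a) ∧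
    Function.Bijective a ∧
    ∀ i : ZMod 2, (L.envelopingGr i).map a = distGr H.G H.idPt i

end Supergroup

end Super

/-! Everything is tested on superpoints: one-point superspaces whose functions form a
finite-dimensional Grassmann algebra `Λ`. They lie in both categories, and a morphism from a
superpoint to `X` over a rational point is the same as a homomorphism of augmented superalgebras
from the stalk there to `Λ`. So the universal property of `G × G` and the group axioms become
statements about homomorphisms from stalks to Grassmann algebras (`FormalSupergroup`,
`Supergroup.formal`), and no description of the stalk of `G × G` is needed.

Tensor products are unique by density. If a tangent vector `Z` of `G × G` kills the pullbacks of `m`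
under both projections, then `ε + Z c` and `ε` are two points with the same projections, so `Z = 0`.
Hence the maximal ideal of `G × G` is `p₁ m + p₂ m` modulo its square (`exists_sub_mem`), and the
products `p₁ f * p₂ g` span the stalk modulo every power of that ideal (`dist_ext`). Tensor products
exist for linear forms that factor through a Grassmann point (`Rep`): pair the two points and apply
the product of the forms (`exists_isTens`). The augmentation and the tangent vectors are of this
kind, convolution preserves the kind, and its associativity and unit laws are those of the group of
points (`isTens_assoc`).

Let `X i` be a homogeneous basis of the tangent space and `f i` in `m` dual elements. The unit laws
give `μ f ≡ p₁ f + p₂ f` modulo the square of the maximal ideal (`μ_sub_mem`), so in leading order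
convolution with `X s` acts on products of the `f i` as a derivation that removes a letter `s`. A
monomial in the `X i` and a canonical monomial in the `f i` of the same length therefore pair to a
nonzero number exactly when their words are rearrangements of each other (`mono_apply_prod`); the
number is, up to sign, a product of factorials of multiplicities, nonzero in characteristic zero. It
follows that the canonical monomials in the `X i` are a basis of the space of distributions
(`dist_le_span_mono`, `mono_independent`). In particular the forms of type `Rep` span it, and
convolution extends to all of it by linearity.

In the supercommutator of two tangent vectors the leading terms cancel, so it is a tangent vector.
In `U(g)` the canonical words span, by reordering (`span_canonical_eq_top`), and `α` sends them to a
basis, so `α` is bijective. The independence half of Poincaré–Birkhoff–Witt is never assumed.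

Of the two categories only two facts are used: superpoints belong to them, and `m/m²` is
finite-dimensional. The latter follows from finite type in the algebraic case and from Hadamard's
lemma in the analytic one. -/

namespace Super

/-! ### Signs and parity components -/

section Parity

theorem parity_cases (i : ZMod 2) : i = 0 ∨ i = 1 := by
  revert i
  decide

variable (k : Type u) [Field k]

@[simp] theorem koszul_zero_left (i : ZMod 2) : koszul k 0 i = 1 := by simp [koszul]

@[simp] theorem koszul_zero_right (i : ZMod 2) : koszul k i 0 = 1 := by simp [koszul]

@[simp] theorem koszul_one_one : koszul k 1 1 = -1 := by simp [koszul]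

theorem koszul_comm (i j : ZMod 2) : koszul k i j = koszul k j i := by
  simp only [koszul, and_comm]

@[simp] theorem koszul_mul_self (i j : ZMod 2) : koszul k i j * koszul k i j = 1 := by
  unfold koszul
  split_ifs <;> simp

theorem koszul_add_left (i j l : ZMod 2) : koszul k (i + j) l = koszul k i l * koszul k j l := by
  have h2 : (1 : ZMod 2) + 1 = 0 := by decide
  rcases parity_cases i with rfl | rfl <;> rcases parity_cases j with rfl | rfl <;>
    rcases parity_cases l with rfl | rfl <;> simp [h2]

theorem koszul_add_right (i j l : ZMod 2) : koszul k l (i + j) = koszul k l i * koszul k l j := by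
  rw [koszul_comm, koszul_add_left, koszul_comm k i, koszul_comm k j]

variable {k}
variable {V : Type*} [AddCommGroup V] [Module k V] {gr : ZMod 2 → Submodule k V}

/-- The component of parity `i`. -/
noncomputable def component (h : IsCompl (gr 0) (gr 1)) (i : ZMod 2) : V →ₗ[k] V :=
  if i = 0 then (gr 0).projection (gr 1) h else (gr 1).projection (gr 0) h.symm

theorem component_mem (h : IsCompl (gr 0) (gr 1)) (i : ZMod 2) (v : V) :
    component h i v ∈ gr i := by
  rcases parity_cases i with rfl | rfl
  · simp [component]
  · simp [component]

theorem component_of_mem (h : IsCompl (gr 0) (gr 1)) {i : ZMod 2} {v : V} (hv : v ∈ gr i) :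
    component h i v = v := by
  rcases parity_cases i with rfl | rfl
  · simpa [component] using Submodule.projection_apply_of_mem_left h hv
  · simpa [component] using Submodule.projection_apply_of_mem_left h.symm hv

theorem component_of_mem_ne (h : IsCompl (gr 0) (gr 1)) {i j : ZMod 2} (hij : j ≠ i) {v : V}
    (hv : v ∈ gr j) : component h i v = 0 := by
  have key : ∀ {p q : Submodule k V} (h : IsCompl p q), v ∈ q → p.projection q h v = 0 := by
    intro p q h hv
    rw [Submodule.projection_apply, (Submodule.projectionOnto_apply_eq_zero_iff h).2 hv]
    rfl
  rcases parity_cases i with rfl | rfl <;> rcases parity_cases j with rfl | rfl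
  · exact absurd rfl hij
  · simpa [component] using key h hv
  · simpa [component] using key h.symm hv
  · exact absurd rfl hij

theorem component_add (h : IsCompl (gr 0) (gr 1)) (v : V) :
    component h 0 v + component h 1 v = v := by
  obtain ⟨a, ha, b, hb, rfl⟩ := Submodule.mem_sup.1
    (h.sup_eq_top ▸ Submodule.mem_top : v ∈ gr 0 ⊔ gr 1)
  simp only [map_add, component_of_mem h ha, component_of_mem h hb,
    component_of_mem_ne h (i := 1) (j := 0) (by decide) ha,
    component_of_mem_ne h (i := 0) (j := 1) (by decide) hb, add_zero, zero_add]

theorem homogeneous_induction (h : IsCompl (gr 0) (gr 1)) {p : V → Prop}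
    (hom : ∀ i, ∀ v ∈ gr i, p v) (add : ∀ v w, p v → p w → p (v + w)) (v : V) : p v := by
  rw [← component_add h v]
  exact add _ _ (hom 0 _ (component_mem h 0 v)) (hom 1 _ (component_mem h 1 v))

theorem eq_zero_of_mem_ne (h : IsCompl (gr 0) (gr 1)) {i j : ZMod 2} (hij : j ≠ i) {v : V}
    (hi : v ∈ gr i) (hj : v ∈ gr j) : v = 0 := by
  rw [← component_of_mem h hi, component_of_mem_ne h hij hj]

theorem linearMap_ext_homogeneous (h : IsCompl (gr 0) (gr 1)) {W : Type*} [AddCommGroup W]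
    [Module k W] {f g : V →ₗ[k] W} (hfg : ∀ i, ∀ v ∈ gr i, f v = g v) : f = g :=
  LinearMap.ext (homogeneous_induction h hfg fun v w hv hw => by rw [map_add, map_add, hv, hw])

end Parity

/-! ### Augmented superalgebras -/

/-- A supercommutative superalgebra with an augmentation, of which `m` is the kernel. -/
structure AugSuperalgebra (k A : Type u) [Field k] [Ring A] [Algebra k A] where
  gr : ZMod 2 → Submodule k A
  isSuper : IsSuperalgebra gr
  comm : IsSupercommutative gr
  ε : A →ₐ[k] k
  m : Submodule k A
  mem_m : ∀ a, a ∈ m ↔ ε a = 0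

namespace AugSuperalgebra

variable {k A A' : Type u} [Field k] [Ring A] [Algebra k A] [Ring A'] [Algebra k A']

section

variable (P : AugSuperalgebra k A)

/-- The filtration of `A` by the powers of `m`, starting with `A`. -/
def filt : ℕ → Submodule k A
  | 0 => ⊤
  | n + 1 => P.m ^ (n + 1)

/-- Homomorphisms of augmented superalgebras. -/
structure IsHom (P : AugSuperalgebra k A) (P' : AugSuperalgebra k A') (ρ : A →ₐ[k] A') : Prop where
  map_gr : ∀ {i a}, a ∈ P.gr i → ρ a ∈ P'.gr i
  map_ε : ∀ a, P'.ε (ρ a) = P.ε a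

/-- The even linear automorphism which multiplies elements of parity `j` by `(-1)^(i j)`. -/
noncomputable def twistLin (i : ZMod 2) : A →ₗ[k] A :=
  component P.isSuper.isCompl 0 + koszul k i 1 • component P.isSuper.isCompl 1

theorem twistLin_of_mem (i : ZMod 2) {j : ZMod 2} {a : A} (ha : a ∈ P.gr j) :
    P.twistLin i a = koszul k i j • a := by
  rcases parity_cases j with rfl | rfl
  · simp [twistLin, component_of_mem _ ha,
      component_of_mem_ne P.isSuper.isCompl (i := 1) (j := 0) (by decide) ha]
  · simp [twistLin, component_of_mem _ ha,
      component_of_mem_ne P.isSuper.isCompl (i := 0) (j := 1) (by decide) ha]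

/-- The automorphism which multiplies elements of parity `j` by `(-1)^(i j)`. -/
noncomputable def twist (i : ZMod 2) : A →ₐ[k] A :=
  AlgHom.ofLinearMap (P.twistLin i)
    (by rw [twistLin_of_mem P i P.isSuper.one_mem, koszul_zero_right, one_smul])
    (by
      intro x y
      refine homogeneous_induction P.isSuper.isCompl (p := fun x =>
        P.twistLin i (x * y) = P.twistLin i x * P.twistLin i y) (fun j x hx => ?_)
        (fun x x' h h' => by rw [add_mul, map_add, map_add, h, h', add_mul]) x
      refine homogeneous_induction P.isSuper.isCompl (p := fun y =>
        P.twistLin i (x * y) = P.twistLin i x * P.twistLin i y) (fun l y hy => ?_)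
        (fun x x' h h' => by rw [mul_add, map_add, map_add, h, h', mul_add]) y
      rw [twistLin_of_mem P i hx, twistLin_of_mem P i hy,
        twistLin_of_mem P i (P.isSuper.mul_mem hx hy), smul_mul_smul_comm, koszul_add_right])

theorem twist_of_mem (i : ZMod 2) {j : ZMod 2} {a : A} (ha : a ∈ P.gr j) :
    P.twist i a = koszul k i j • a :=
  P.twistLin_of_mem i ha

/-- Commuting past an element of parity `i` acts on the other factor by an automorphism, so that
factor need not be split into parity components. -/
theorem mul_comm_of_mem {i : ZMod 2} {a : A} (ha : a ∈ P.gr i) (b : A) :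
    b * a = a * P.twist i b :=
  homogeneous_induction P.isSuper.isCompl (p := fun b => b * a = a * P.twist i b)
    (fun j b hb => by rw [twist_of_mem P i hb, P.comm hb ha, mul_smul_comm, koszul_comm])
    (fun b c hb hc => by rw [add_mul, hb, hc, map_add, mul_add]) b

theorem algebraMap_mem (c : k) : algebraMap k A c ∈ P.gr 0 := by
  rw [Algebra.algebraMap_eq_smul_one]
  exact (P.gr 0).smul_mem c P.isSuper.one_mem

section CharZero

variable [CharZero k]

theorem mul_self_of_odd {a : A} (ha : a ∈ P.gr 1) : a * a = 0 := by
  have h := P.comm ha ha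
  rw [koszul_one_one, neg_smul, one_smul] at h
  have : (2 : k) • (a * a) = 0 := by
    rw [two_smul]
    nth_rewrite 1 [h]
    rw [neg_add_cancel]
  exact (smul_eq_zero.1 this).resolve_left two_ne_zero

/-- Odd elements have square zero, and a field has no nilpotents. -/
theorem ε_odd {a : A} (ha : a ∈ P.gr 1) : P.ε a = 0 := by
  have := congrArg P.ε (P.mul_self_of_odd ha)
  rwa [map_mul, map_zero, mul_self_eq_zero] at this

theorem ε_of_ne {i : ZMod 2} (hi : i ≠ 0) {a : A} (ha : a ∈ P.gr i) : P.ε a = 0 := by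
  rcases parity_cases i with rfl | rfl
  · exact absurd rfl hi
  · exact P.ε_odd ha

theorem koszul_mul_ε (i : ZMod 2) {j : ZMod 2} {a : A} (ha : a ∈ P.gr j) :
    koszul k i j * P.ε a = P.ε a := by
  rcases parity_cases j with rfl | rfl
  · rw [koszul_zero_right, one_mul]
  · rw [P.ε_odd ha, mul_zero]

theorem isHom_twist (i : ZMod 2) : IsHom P P (P.twist i) where
  map_gr ha := by
    rw [P.twist_of_mem i ha]
    exact Submodule.smul_mem _ _ ha
  map_ε := homogeneous_induction P.isSuper.isCompl (p := fun a => P.ε (P.twist i a) = P.ε a)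
    (fun j a ha => by rw [P.twist_of_mem i ha, map_smul, smul_eq_mul, P.koszul_mul_ε i ha])
    (fun a b ha hb => by rw [map_add, map_add, map_add, ha, hb])

/-- The even part is an average over the parity automorphism. Hence every subspace stable under
`twist 1` contains the parity components of its elements. -/
theorem component_zero_eq (a : A) :
    component P.isSuper.isCompl 0 a = (2⁻¹ : k) • (a + P.twist 1 a) := by
  rw [eq_inv_smul_iff₀ two_ne_zero, two_smul]
  conv_rhs => rw [← component_add P.isSuper.isCompl a]
  simp only [map_add, P.twist_of_mem 1 (component_mem P.isSuper.isCompl _ a), koszul_zero_right,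
    koszul_one_one]
  module

end CharZero

theorem sub_ε_mem (a : A) : a - algebraMap k A (P.ε a) ∈ P.m := by
  rw [P.mem_m, map_sub, AlgHom.commutes]
  exact sub_self _

theorem mul_mem_m_left (a : A) {b : A} (hb : b ∈ P.m) : a * b ∈ P.m := by
  rw [P.mem_m] at hb ⊢
  rw [map_mul, hb, mul_zero]

theorem mul_mem_m_right (a : A) {b : A} (hb : b ∈ P.m) : b * a ∈ P.m := by
  rw [P.mem_m] at hb ⊢
  rw [map_mul, hb, zero_mul]

theorem filt_zero : P.filt 0 = ⊤ := rfl

theorem filt_one : P.filt 1 = P.m := pow_one _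

/-- `filt 0` is all of `A`, while `m ^ 0` would be the line spanned by `1`; absorbing `⊤` into `m`
makes the recursion for `filt` hold at index zero too. -/
theorem top_mul_m : (⊤ : Submodule k A) * P.m = P.m := by
  refine le_antisymm (Submodule.mul_le.2 fun a _ b hb => P.mul_mem_m_left a hb) fun a ha => ?_
  rw [← one_mul a]
  exact Submodule.mul_mem_mul trivial ha

theorem m_mul_top : P.m * (⊤ : Submodule k A) = P.m := by
  refine le_antisymm (Submodule.mul_le.2 fun a ha b _ => P.mul_mem_m_right b ha) fun a ha => ?_
  rw [← mul_one a]
  exact Submodule.mul_mem_mul ha trivial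

theorem m_mul_filt (n : ℕ) : P.m * P.filt n = P.filt (n + 1) := by
  cases n with
  | zero => rw [filt_zero, m_mul_top, filt_one]
  | succ n => exact (pow_succ' P.m (n + 1)).symm

theorem filt_mul_m (n : ℕ) : P.filt n * P.m = P.filt (n + 1) := by
  cases n with
  | zero => rw [filt_zero, top_mul_m, filt_one]
  | succ n => exact (pow_succ P.m (n + 1)).symm

theorem filt_succ_le (n : ℕ) : P.filt (n + 1) ≤ P.filt n := by
  induction n with
  | zero => exact le_top
  | succ n ih =>
    rw [← P.m_mul_filt (n + 1)]
    nth_rewrite 2 [← P.m_mul_filt n]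
    exact Submodule.mul_le.2 fun x hx y hy => Submodule.mul_mem_mul hx (ih hy)

theorem filt_antitone : Antitone P.filt := antitone_nat_of_succ_le P.filt_succ_le

theorem filt_mul_filt (a b : ℕ) : P.filt a * P.filt b ≤ P.filt (a + b) := by
  induction a with
  | zero =>
    cases b with
    | zero => exact le_top
    | succ b =>
      rw [← P.m_mul_filt b, ← mul_assoc, filt_zero, top_mul_m, zero_add, m_mul_filt]
  | succ a ih =>
    rw [← P.m_mul_filt, mul_assoc, add_right_comm, ← P.m_mul_filt]
    exact Submodule.mul_le.2 fun x hx y hy => Submodule.mul_mem_mul hx (ih hy)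

theorem mul_mem_filt {a b : ℕ} {x y : A} (hx : x ∈ P.filt a) (hy : y ∈ P.filt b) :
    x * y ∈ P.filt (a + b) :=
  P.filt_mul_filt a b (Submodule.mul_mem_mul hx hy)

theorem mul_mem_filt_left (x : A) {b : ℕ} {y : A} (hy : y ∈ P.filt b) : x * y ∈ P.filt b := by
  simpa using P.mul_mem_filt (a := 0) (x := x) trivial hy

/-- The distributions: linear forms which vanish on a power of `m`. -/
def dist : Submodule k (Module.Dual k A) where
  carrier := {φ | ∃ n : ℕ, ∀ a ∈ P.m ^ (n + 1), φ a = 0}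
  zero_mem' := ⟨0, fun _ _ => rfl⟩
  add_mem' := by
    rintro φ ψ ⟨m, hm⟩ ⟨n, hn⟩
    refine ⟨max m n, fun a ha => ?_⟩
    rw [LinearMap.add_apply, hm a (P.filt_antitone (Nat.succ_le_succ (le_max_left m n)) ha),
      hn a (P.filt_antitone (Nat.succ_le_succ (le_max_right m n)) ha), add_zero]
  smul_mem' := by
    rintro c φ ⟨n, hn⟩
    exact ⟨n, fun a ha => by rw [LinearMap.smul_apply, hn a ha, smul_zero]⟩

theorem mem_dist {φ : Module.Dual k A} : φ ∈ P.dist ↔ ∃ n, ∀ a ∈ P.filt n, φ a = 0 := by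
  constructor
  · rintro ⟨n, hn⟩
    exact ⟨n + 1, hn⟩
  · rintro ⟨n, hn⟩
    exact ⟨n, fun a ha => hn a (P.filt_succ_le n ha)⟩

variable {P} {P' : AugSuperalgebra k A'}

theorem IsHom.map_m {ρ : A →ₐ[k] A'} (hρ : IsHom P P' ρ) {a : A} (ha : a ∈ P.m) :
    ρ a ∈ P'.m := by
  rw [mem_m] at ha ⊢
  rw [hρ.map_ε, ha]

theorem IsHom.map_filt {ρ : A →ₐ[k] A'} (hρ : IsHom P P' ρ) {n : ℕ} {a : A} (ha : a ∈ P.filt n) :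
    ρ a ∈ P'.filt n := by
  cases n with
  | zero => trivial
  | succ n =>
    have h : (P.m ^ (n + 1)).map ρ.toLinearMap ≤ P'.m ^ (n + 1) := by
      rw [Submodule.map_pow]
      exact pow_le_pow_left' (by rintro _ ⟨b, hb, rfl⟩; exact hρ.map_m hb) _
    exact h ⟨a, ha, rfl⟩

theorem IsHom.twist {ρ : A →ₐ[k] A'} (hρ : IsHom P P' ρ) (i : ZMod 2) (a : A) :
    ρ (P.twist i a) = P'.twist i (ρ a) :=
  homogeneous_induction P.isSuper.isCompl (p := fun a => ρ (P.twist i a) = P'.twist i (ρ a))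
    (fun j a ha => by rw [P.twist_of_mem i ha, map_smul, P'.twist_of_mem i (hρ.map_gr ha)])
    (fun a b ha hb => by rw [map_add, map_add, map_add, ha, hb, map_add]) a

theorem IsHom.comp {A'' : Type u} [Ring A''] [Algebra k A''] {P'' : AugSuperalgebra k A''}
    {ρ' : A' →ₐ[k] A''} (hρ' : IsHom P' P'' ρ') {ρ : A →ₐ[k] A'} (hρ : IsHom P P' ρ) :
    IsHom P P'' (ρ'.comp ρ) :=
  ⟨fun h => hρ'.map_gr (hρ.map_gr h), fun a => (hρ'.map_ε _).trans (hρ.map_ε a)⟩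

/-- The trivial point. -/
noncomputable def unitHom (P : AugSuperalgebra k A) (_P' : AugSuperalgebra k A') : A →ₐ[k] A' :=
  (Algebra.ofId k A').comp P.ε

theorem unitHom_apply (P : AugSuperalgebra k A) (P' : AugSuperalgebra k A') (a : A) :
    P.unitHom P' a = algebraMap k A' (P.ε a) := rfl

theorem isHom_unitHom [CharZero k] (P : AugSuperalgebra k A) (P' : AugSuperalgebra k A') :
    IsHom P P' (P.unitHom P') where
  map_gr {i a} ha := by
    rw [unitHom_apply]
    rcases parity_cases i with rfl | rfl
    · exact P'.algebraMap_mem _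
    · rw [P.ε_odd ha, map_zero]
      exact zero_mem _
  map_ε a := AlgHom.commutes _ _

/-- The parity automorphism is a homomorphism of augmented superalgebras, so it preserves the powers
of `m`; now average. -/
theorem component_mem_filt [CharZero k] (P : AugSuperalgebra k A) (i : ZMod 2) {n : ℕ} {a : A}
    (ha : a ∈ P.filt n) : component P.isSuper.isCompl i a ∈ P.filt n := by
  have h0 : component P.isSuper.isCompl 0 a ∈ P.filt n := by
    rw [component_zero_eq]
    exact Submodule.smul_mem _ _ (add_mem ha ((P.isHom_twist 1).map_filt ha))
  rcases parity_cases i with rfl | rfl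
  · exact h0
  · rw [← (eq_sub_of_add_eq' (component_add P.isSuper.isCompl a)).symm]
    exact sub_mem ha h0

end

end AugSuperalgebra

end Super

namespace Super

/-! ### Grassmann algebras -/

section Grassmann

open CliffordAlgebra

variable (k M M₁ M₂ : Type u) [Field k] [AddCommGroup M] [Module k M] [AddCommGroup M₁]
  [Module k M₁] [AddCommGroup M₂] [Module k M₂]

/-- The Grassmann algebra `Λ(M)` with its canonical augmentation. -/
noncomputable def grassmann : AugSuperalgebra k (ExteriorAlgebra k M) where
  gr := evenOdd (0 : QuadraticForm k M)
  isSuper :=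
    { isCompl := evenOdd_isCompl _
      one_mem := SetLike.GradedOne.one_mem
      mul_mem := fun ha hb => SetLike.GradedMul.mul_mem ha hb }
  comm := by
    intro i j a b ha hb
    -- Elements of orthogonal subspaces supercommute in a Clifford algebra; for the zero form the
    -- whole space is orthogonal to itself.
    have h := map_mul_map_of_isOrtho_of_mem_evenOdd (Q₁ := (0 : QuadraticForm k M))
      (Q₂ := (0 : QuadraticForm k M)) (Qₙ := (0 : QuadraticForm k M)) (.id _) (.id _)
      (fun x y => by simp [QuadraticMap.IsOrtho]) a b ha hb
    simp only [CliffordAlgebra.map_id, AlgHom.id_apply] at h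
    rw [h]
    rcases parity_cases i with rfl | rfl <;> rcases parity_cases j with rfl | rfl <;> simp
  ε := ExteriorAlgebra.algebraMapInv
  m := LinearMap.ker (ExteriorAlgebra.algebraMapInv (R := k) (M := M)).toLinearMap
  mem_m _ := Iff.rfl

variable {k M M₁ M₂}

theorem grassmann_ε_ι (x : M) : (grassmann k M).ε (ExteriorAlgebra.ι k x) = 0 := by
  simp [grassmann, ExteriorAlgebra.algebraMapInv]

theorem grassmann_sub_ε_mem (a : ExteriorAlgebra k M) :
    a - algebraMap k _ ((grassmann k M).ε a) ∈
      LinearMap.range (ExteriorAlgebra.ι k (M := M)) * ⊤ := by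
  induction a using ExteriorAlgebra.induction with
  | algebraMap r =>
    rw [AlgHom.commutes, Algebra.algebraMap_self, RingHom.id_apply, sub_self]
    exact zero_mem _
  | ι x =>
    rw [grassmann_ε_ι, map_zero, sub_zero, ← mul_one (ExteriorAlgebra.ι k x)]
    exact Submodule.mul_mem_mul ⟨x, rfl⟩ trivial
  | mul a b ha hb =>
    have h : a * b - algebraMap k _ ((grassmann k M).ε (a * b)) =
        (a - algebraMap k _ ((grassmann k M).ε a)) * b +
          (grassmann k M).ε a • (b - algebraMap k _ ((grassmann k M).ε b)) := by
      rw [map_mul, map_mul, Algebra.smul_def]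
      noncomm_ring
    rw [h]
    refine add_mem ?_ (Submodule.smul_mem _ _ hb)
    have := Submodule.mul_mem_mul ha (Submodule.mem_top (x := b) (R := k))
    rw [mul_assoc] at this
    exact Submodule.mul_le.2 (fun x hx y _ => Submodule.mul_mem_mul hx Submodule.mem_top) this
  | add a b ha hb =>
    rw [map_add, map_add, add_sub_add_comm]
    exact add_mem ha hb

theorem grassmann_m_le :
    (grassmann k M).m ≤ LinearMap.range (ExteriorAlgebra.ι k (M := M)) * ⊤ := fun a ha => by
  have h := grassmann_sub_ε_mem a
  rwa [((grassmann k M).mem_m a).1 ha, map_zero, sub_zero] at h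

/-- A coefficient passes a vector at no cost: a product `y c` with `c` in `M` lies in the
augmentation ideal, hence in `M Λ`. -/
theorem grassmann_top_mul_le (n : ℕ) :
    ⊤ * LinearMap.range (ExteriorAlgebra.ι k (M := M)) ^ n ≤
      LinearMap.range (ExteriorAlgebra.ι k (M := M)) ^ n * ⊤ := by
  induction n with
  | zero => rw [pow_zero, mul_one, one_mul]
  | succ n ih =>
    refine Submodule.mul_le.2 fun a _ b hb => ?_
    rw [pow_succ] at hb
    refine Submodule.mul_induction_on hb (fun b hb c hc => ?_) fun x y hx hy => by
      rw [mul_add]; exact add_mem hx hy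
    rw [← mul_assoc]
    refine Submodule.mul_induction_on (ih (Submodule.mul_mem_mul trivial hb))
      (fun x hx y _ => ?_) fun x y hx hy => by rw [add_mul]; exact add_mem hx hy
    obtain ⟨v, rfl⟩ := hc
    rw [mul_assoc, pow_succ, mul_assoc]
    refine Submodule.mul_mem_mul hx (grassmann_m_le ?_)
    rw [(grassmann k M).mem_m, map_mul, grassmann_ε_ι, mul_zero]

theorem grassmann_m_pow_le (n : ℕ) :
    (grassmann k M).m ^ n ≤ LinearMap.range (ExteriorAlgebra.ι k (M := M)) ^ n * ⊤ := by
  induction n with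
  | zero =>
    rw [pow_zero, pow_zero, one_mul]
    exact le_top
  | succ n ih =>
    rw [pow_succ', pow_succ']
    refine Submodule.mul_le.2 fun a ha b hb => ?_
    refine Submodule.mul_induction_on (grassmann_m_le ha)
      (fun x hx y _ => ?_) fun x y hx hy => by rw [add_mul]; exact add_mem hx hy
    refine Submodule.mul_induction_on (ih hb)
      (fun z hz w _ => ?_) fun x y hx hy => by rw [mul_add]; exact add_mem hx hy
    rw [mul_assoc x y, ← mul_assoc y]
    have h := Submodule.mul_mem_mul hx (Submodule.mul_mem_mul
      (grassmann_top_mul_le n (Submodule.mul_mem_mul (Submodule.mem_top (x := y)) hz))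
      (Submodule.mem_top (x := w) (R := k)))
    rw [← mul_assoc, ← mul_assoc, mul_assoc] at h
    refine Submodule.mul_le.2 (fun x hx y _ => Submodule.mul_mem_mul hx Submodule.mem_top) h

/-- The `n`-th power of the augmentation ideal lies in `Λⁿ(M) Λ`, which is zero for `n = dim M + 1`.
This nilpotence makes the superpoint local and makes every form that factors through `Λ` a
distribution. -/
theorem grassmann_filt_eq_bot [Module.Finite k M] : ∃ n, (grassmann k M).filt n = ⊥ := by
  refine ⟨Module.finrank k M + 1, le_bot_iff.1 ((grassmann_m_pow_le _).trans ?_)⟩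
  have h : Module.finrank k (⋀[k]^(Module.finrank k M + 1) M) = 0 := by
    rw [exteriorPower.finrank_eq, Nat.choose_succ_self]
  have h' : LinearMap.range (ExteriorAlgebra.ι k (M := M)) ^ (Module.finrank k M + 1) = ⊥ :=
    Submodule.finrank_eq_zero.1 h
  rw [h', Submodule.bot_mul]

theorem map_gr_of_ι {A : Type u} [Ring A] [Algebra k A] (P : AugSuperalgebra k A)
    (ρ : ExteriorAlgebra k M →ₐ[k] A) (hρ : ∀ x, ρ (ExteriorAlgebra.ι k x) ∈ P.gr 1) {i : ZMod 2}
    {a : ExteriorAlgebra k M} (ha : a ∈ (grassmann k M).gr i) : ρ a ∈ P.gr i := by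
  have key : ∀ (n : ℕ) (a : ExteriorAlgebra k M)
      (_ : a ∈ LinearMap.range (ExteriorAlgebra.ι k (M := M)) ^ n), ρ a ∈ P.gr (n : ZMod 2) := by
    intro n a ha
    induction ha using Submodule.pow_induction_on_left' with
    | algebraMap r =>
      rw [AlgHom.commutes, Nat.cast_zero]
      exact P.algebraMap_mem r
    | add x y i hx hy h h' =>
      rw [map_add]
      exact add_mem h h'
    | mem_mul x hx i y hy h =>
      obtain ⟨v, rfl⟩ := hx
      rw [map_mul, Nat.cast_succ, add_comm]
      exact P.isSuper.mul_mem (hρ v) h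
  have h : (grassmann k M).gr i ≤ (P.gr i).comap ρ.toLinearMap := by
    refine iSup_le fun n a ha => ?_
    have := key n.1 a ha
    rwa [n.2] at this
  exact h ha

theorem isHom_map (f : M₁ →ₗ[k] M₂) :
    (grassmann k M₁).IsHom (grassmann k M₂) (ExteriorAlgebra.map f) where
  map_gr ha := map_gr_of_ι _ _ (fun x => by
    rw [ExteriorAlgebra.map_apply_ι]
    exact ι_mem_evenOdd_one _ _) ha
  map_ε a := by
    have : (ExteriorAlgebra.algebraMapInv (R := k) (M := M₂)).comp (ExteriorAlgebra.map f) =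
        ExteriorAlgebra.algebraMapInv := by
      apply ExteriorAlgebra.hom_ext
      ext x
      simp [ExteriorAlgebra.algebraMapInv]
    exact DFunLike.congr_fun this a

open scoped TensorProduct in
/-- The product of linear forms on two Grassmann algebras. -/
theorem exists_product_form (l₁ : Module.Dual k (ExteriorAlgebra k M₁))
    (l₂ : Module.Dual k (ExteriorAlgebra k M₂)) :
    ∃ L : Module.Dual k (ExteriorAlgebra k (M₂ × M₁)), ∀ u v,
      L (ExteriorAlgebra.map (.inl k M₂ M₁) v * ExteriorAlgebra.map (.inr k M₂ M₁) u) =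
        l₁ u * l₂ v := by
  -- The zero form on `M₂ × M₁` is the orthogonal sum of two zero forms, and the Clifford algebra of
  -- an orthogonal sum is the graded tensor product of the Clifford algebras.
  let F : ExteriorAlgebra k (M₂ × M₁) →ₐ[k]
      (evenOdd (0 : QuadraticForm k M₂) ᵍ⊗[k] evenOdd (0 : QuadraticForm k M₁)) :=
    (ofProd _ _).comp (CliffordAlgebra.map
      { toLinearMap := LinearMap.id, map_app' := fun x => by simp })
  have h₁ : F.comp (ExteriorAlgebra.map (.inl k M₂ M₁)) = GradedTensorProduct.includeLeft _ _ := by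
    apply ExteriorAlgebra.hom_ext
    ext x
    have hF : F (ExteriorAlgebra.ι k (x, 0)) = _ :=
      (congrArg (ofProd _ _) (CliffordAlgebra.map_apply_ι _ _)).trans (ofProd_ι_mk _ _ x 0)
    simp only [LinearMap.comp_apply, AlgHom.toLinearMap_apply, AlgHom.comp_apply,
      ExteriorAlgebra.map_apply_ι, LinearMap.inl_apply]
    rw [hF, map_zero, GradedTensorProduct.includeLeft_apply]
    exact add_eq_left.2 (TensorProduct.tmul_zero _ _)
  have h₂ : F.comp (ExteriorAlgebra.map (.inr k M₂ M₁)) = GradedTensorProduct.includeRight _ _ := by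
    apply ExteriorAlgebra.hom_ext
    ext x
    have hF : F (ExteriorAlgebra.ι k (0, x)) = _ :=
      (congrArg (ofProd _ _) (CliffordAlgebra.map_apply_ι _ _)).trans (ofProd_ι_mk _ _ 0 x)
    simp only [LinearMap.comp_apply, AlgHom.toLinearMap_apply, AlgHom.comp_apply,
      ExteriorAlgebra.map_apply_ι, LinearMap.inr_apply]
    rw [hF, map_zero, GradedTensorProduct.includeRight_apply]
    exact add_eq_right.2 (TensorProduct.zero_tmul _ _)
  -- The second form is applied to the left factor, so no sign occurs here; the Koszul sign will
  -- come from exchanging the factors when this form is used.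
  refine ⟨TensorProduct.lift ((LinearMap.mul k k).compl₁₂ l₂ l₁) ∘ₗ
    (GradedTensorProduct.of k (evenOdd (0 : QuadraticForm k M₂))
      (evenOdd (0 : QuadraticForm k M₁))).symm.toLinearMap ∘ₗ F.toLinearMap, fun u v => ?_⟩
  have e₁ := DFunLike.congr_fun h₁ v
  have e₂ := DFunLike.congr_fun h₂ u
  simp only [AlgHom.comp_apply] at e₁ e₂
  simp only [LinearMap.comp_apply, AlgHom.toLinearMap_apply, map_mul, e₁, e₂]
  rw [GradedTensorProduct.includeLeft_apply, GradedTensorProduct.includeRight_apply,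
    GradedTensorProduct.tmul_one_mul_one_tmul]
  exact (TensorProduct.lift.tmul v u).trans (mul_comm _ _)

/-- The Grassmann algebra in two variables has elements `c` of both parities, with `c² = 0`. -/
theorem exists_grassmann_parameter (i : ZMod 2) :
    ∃ (c : ExteriorAlgebra k (Fin 2 → k)) (l : Module.Dual k (ExteriorAlgebra k (Fin 2 → k))),
      c ∈ (grassmann k (Fin 2 → k)).gr i ∧ c * c = 0 ∧ (grassmann k (Fin 2 → k)).ε c = 0 ∧
        l 1 = 0 ∧ l c = 1 := by
  have key : ∃ c : ExteriorAlgebra k (Fin 2 → k), c ∈ (grassmann k (Fin 2 → k)).gr i ∧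
      c * c = 0 ∧ (grassmann k (Fin 2 → k)).ε c = 0 ∧ c ≠ 0 := by
    have h1 : ExteriorAlgebra.ι k (Pi.single 1 1 : Fin 2 → k) ≠ 0 := by
      simp [ExteriorAlgebra.ι_eq_zero_iff]
    rcases parity_cases i with rfl | rfl
    -- An even parameter of square zero is the product of the two odd variables.
    · refine ⟨ExteriorAlgebra.ι k (Pi.single 0 1) * ExteriorAlgebra.ι k (Pi.single 1 1),
        ι_mul_ι_mem_evenOdd_zero _ _ _, ?_, ?_, fun h => ?_⟩
      · have h := (grassmann k (Fin 2 → k)).comm (i := 1) (j := 1) (ι_mem_evenOdd_one _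
          (Pi.single 1 1)) (ι_mem_evenOdd_one _ (Pi.single 0 1))
        rw [koszul_one_one, neg_smul, one_smul] at h
        rw [mul_assoc, ← mul_assoc (ExteriorAlgebra.ι k (Pi.single 1 1))]
        erw [h]
        rw [neg_mul, mul_neg, ← mul_assoc, ← mul_assoc]
        erw [ExteriorAlgebra.ι_sq_zero]
        rw [zero_mul, zero_mul, neg_zero]
      · rw [map_mul, grassmann_ε_ι, zero_mul]
      -- Contraction with the first coordinate form turns the product of the two variables into the
      -- second one, which is not zero.
      · have h' := congrArg (contractLeft (Q := (0 : QuadraticForm k (Fin 2 → k)))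
          (LinearMap.proj 0)) h
        erw [contractLeft_ι_mul, contractLeft_ι, map_zero] at h'
        rw [LinearMap.map_zero, mul_zero, sub_zero] at h'
        simp only [LinearMap.coe_proj, Function.eval, Pi.single_eq_same, one_smul] at h'
        exact h1 h'

    · exact ⟨ExteriorAlgebra.ι k (Pi.single 1 1), ι_mem_evenOdd_one _ _,
        ExteriorAlgebra.ι_sq_zero _, grassmann_ε_ι _, h1⟩
  obtain ⟨c, hc, hc2, hε, h0⟩ := key
  obtain ⟨l, hl⟩ := Module.Projective.exists_dual_eq_one k h0
  -- The correction by a multiple of the augmentation forces the value at `1` to vanish and leaves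
  -- the value at `c` alone, because `ε c = 0`.
  refine ⟨c, l - l 1 • (grassmann k (Fin 2 → k)).ε.toLinearMap, hc, hc2, hε, ?_, ?_⟩
  · simp
  · simp [hε, hl]

end Grassmann

end Super

namespace Super

namespace AugSuperalgebra

/-! ### Tangent vectors and the linear forms that factor through Grassmann points -/

section Tangent

variable {k A A' : Type u} [Field k] [Ring A] [Algebra k A] [Ring A'] [Algebra k A']
  (P : AugSuperalgebra k A) (P' : AugSuperalgebra k A')

/-- Homogeneous tangent vectors of parity `i`. -/
structure IsTangent (i : ZMod 2) (Z : Module.Dual k A) : Prop where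
  map_one : Z 1 = 0
  map_sq : ∀ a ∈ P.filt 2, Z a = 0
  map_ne : ∀ j, j ≠ i → ∀ a ∈ P.gr j, Z a = 0

variable {P P'}

/-- Expand `(a - ε a) * (b - ε b)`, an element of `m²`: a form that kills `1` and `m²` is a
derivation along the augmentation. -/
theorem map_mul_of_tangent {Z : Module.Dual k A} (h1 : Z 1 = 0) (h2 : ∀ a ∈ P.filt 2, Z a = 0)
    (a b : A) : Z (a * b) = P.ε a * Z b + Z a * P.ε b := by
  have h := h2 _ (P.mul_mem_filt (a := 1) (b := 1) (P.filt_one.symm ▸ P.sub_ε_mem a)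
    (P.filt_one.symm ▸ P.sub_ε_mem b))
  have e : a * b = (a - algebraMap k A (P.ε a)) * (b - algebraMap k A (P.ε b)) +
      P.ε a • b + P.ε b • a - (P.ε a * P.ε b) • (1 : A) := by
    simp only [Algebra.algebraMap_eq_smul_one, sub_mul, mul_sub, smul_mul_assoc, mul_smul_comm,
      one_mul, mul_one]
    module
  rw [e, map_sub, map_add, map_add, h, map_smul, map_smul, map_smul, h1]
  simp only [smul_eq_mul]
  ring

theorem IsTangent.map_mul {i : ZMod 2} {Z : Module.Dual k A} (hZ : P.IsTangent i Z) (a b : A) :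
    Z (a * b) = P.ε a * Z b + Z a * P.ε b :=
  map_mul_of_tangent hZ.map_one hZ.map_sq a b

/-- The point `ε + Z c` defined by a tangent vector `Z` and a parameter `c` with `c² = 0`. -/
noncomputable def expHom {i : ZMod 2} {Z : Module.Dual k A} (hZ : P.IsTangent i Z) {c : A'}
    (hc : c * c = 0) : A →ₐ[k] A' :=
  AlgHom.ofLinearMap ((Algebra.ofId k A').toLinearMap ∘ₗ P.ε.toLinearMap + Z.smulRight c)
    (by simp [hZ.map_one])
    (by
      intro a b
      simp only [LinearMap.add_apply, LinearMap.comp_apply, AlgHom.toLinearMap_apply,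
        LinearMap.smulRight_apply, hZ.map_mul, _root_.map_mul, Algebra.ofId_apply,
        Algebra.algebraMap_eq_smul_one, add_mul, mul_add, smul_mul_assoc, mul_smul_comm, one_mul,
        mul_one, hc, smul_zero, add_zero]
      module)

theorem expHom_apply {i : ZMod 2} {Z : Module.Dual k A} (hZ : P.IsTangent i Z) {c : A'}
    (hc : c * c = 0) (a : A) : expHom hZ hc a = algebraMap k A' (P.ε a) + Z a • c := rfl

theorem isHom_expHom [CharZero k] {i : ZMod 2} {Z : Module.Dual k A} (hZ : P.IsTangent i Z) {c : A'}
    (hc : c * c = 0) (hci : c ∈ P'.gr i) (hε : P'.ε c = 0) : P.IsHom P' (expHom hZ hc) where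
  map_gr {j a} ha := by
    rw [expHom_apply]
    refine add_mem ((isHom_unitHom P P').map_gr ha) ?_
    by_cases hj : j = i
    · exact Submodule.smul_mem _ _ (hj ▸ hci)
    · rw [hZ.map_ne j hj a ha, zero_smul]
      exact zero_mem _
  map_ε a := by
    rw [expHom_apply, map_add, map_smul, hε, smul_zero, add_zero, AlgHom.commutes]
    rfl

theorem component_mem_of_twist [CharZero k] {N : Submodule k A}
    (hN : ∀ a ∈ N, P.twist 1 a ∈ N) (i : ZMod 2) {a : A} (ha : a ∈ N) :
    component P.isSuper.isCompl i a ∈ N := by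
  have h0 : component P.isSuper.isCompl 0 a ∈ N := by
    rw [component_zero_eq]
    exact Submodule.smul_mem _ _ (add_mem ha (hN a ha))
  rcases parity_cases i with rfl | rfl
  · exact h0
  · rw [← (eq_sub_of_add_eq' (component_add P.isSuper.isCompl a)).symm]
    exact sub_mem ha h0

/-- Since `u` lies in `m`, it is outside `N + k`, so some linear form kills `N` and `1` but not `u`.
Its two parity components still kill `N`, which is stable under parity, and one of them is nonzero
at `u`. -/
theorem exists_tangent [CharZero k] {N : Submodule k A} (h2 : P.filt 2 ≤ N) (hm : N ≤ P.m)
    (hN : ∀ a ∈ N, P.twist 1 a ∈ N) {u : A} (hu : u ∈ P.m) (huN : u ∉ N) :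
    ∃ i Z, P.IsTangent i Z ∧ (∀ a ∈ N, Z a = 0) ∧ Z u ≠ 0 := by
  have hu' : u ∉ N ⊔ Submodule.span k {1} := by
    intro h
    obtain ⟨a, ha, b, hb, e⟩ := Submodule.mem_sup.1 h
    obtain ⟨c, rfl⟩ := Submodule.mem_span_singleton.1 hb
    have h' := (P.mem_m u).1 hu
    rw [← e, map_add, (P.mem_m a).1 (hm ha), map_smul, map_one, zero_add, smul_eq_mul,
      mul_one] at h'
    rw [h', zero_smul, add_zero] at e
    exact huN (e ▸ ha)
  obtain ⟨f, hfu, hf⟩ := Submodule.exists_le_ker_of_notMem hu'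
  have hfN : ∀ a ∈ N, f a = 0 := fun a ha => hf (Submodule.mem_sup_left ha)
  have hf1 : f 1 = 0 := hf (Submodule.mem_sup_right (Submodule.mem_span_singleton_self 1))
  have key : ∀ i, P.IsTangent i (f ∘ₗ component P.isSuper.isCompl i) ∧
      ∀ a ∈ N, (f ∘ₗ component P.isSuper.isCompl i) a = 0 := by
    intro i
    have hN' : ∀ a ∈ N, (f ∘ₗ component P.isSuper.isCompl i) a = 0 := fun a ha =>
      hfN _ (component_mem_of_twist hN i ha)
    refine ⟨⟨?_, fun a ha => hN' a (h2 ha), fun j hj a ha => ?_⟩, hN'⟩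
    · rcases parity_cases i with rfl | rfl
      · rw [LinearMap.comp_apply, component_of_mem _ P.isSuper.one_mem, hf1]
      · rw [LinearMap.comp_apply, component_of_mem_ne _ (by decide) P.isSuper.one_mem, map_zero]
    · rw [LinearMap.comp_apply, component_of_mem_ne _ hj ha, map_zero]
  by_cases h0 : f (component P.isSuper.isCompl 0 u) = 0
  · refine ⟨1, _, (key 1).1, (key 1).2, fun h1 => hfu ?_⟩
    rw [← component_add P.isSuper.isCompl u, map_add, h0, zero_add]
    exact h1
  · exact ⟨0, _, (key 0).1, (key 0).2, h0⟩

/-- The linear forms which factor through a point with values in a Grassmann algebra. -/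
def Rep (P : AugSuperalgebra k A) (φ : Module.Dual k A) : Prop :=
  ∃ (M : Type u) (_ : AddCommGroup M) (_ : Module k M) (_ : Module.Finite k M)
    (ρ : A →ₐ[k] ExteriorAlgebra k M) (l : Module.Dual k (ExteriorAlgebra k M)),
    P.IsHom (grassmann k M) ρ ∧ ∀ a, φ a = l (ρ a)

theorem mem_dist_of_isHom {M : Type u} [AddCommGroup M] [Module k M] [Module.Finite k M]
    {ρ : A →ₐ[k] ExteriorAlgebra k M} (hρ : P.IsHom (grassmann k M) ρ)
    (l : Module.Dual k (ExteriorAlgebra k M)) : l ∘ₗ ρ.toLinearMap ∈ P.dist := by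
  obtain ⟨n, hn⟩ := grassmann_filt_eq_bot (k := k) (M := M)
  refine P.mem_dist.2 ⟨n, fun a ha => ?_⟩
  have h := hρ.map_filt ha
  rw [hn, Submodule.mem_bot] at h
  rw [LinearMap.comp_apply, AlgHom.toLinearMap_apply, h, map_zero]

theorem Rep.mem_dist {φ : Module.Dual k A} (h : P.Rep φ) : φ ∈ P.dist := by
  obtain ⟨M, _, _, _, ρ, l, hρ, hl⟩ := h
  have : φ = l ∘ₗ ρ.toLinearMap := LinearMap.ext hl
  exact this ▸ mem_dist_of_isHom hρ l

/-- The same point represents the new form. The Leibniz rule is applied to such forms, so they must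
stay in the class. -/
theorem Rep.mulLeft {φ : Module.Dual k A} (h : P.Rep φ) (f : A) :
    P.Rep (φ ∘ₗ LinearMap.mulLeft k f) := by
  obtain ⟨M, _, _, _, ρ, l, hρ, hl⟩ := h
  exact ⟨M, _, _, inferInstance, ρ, l ∘ₗ LinearMap.mulLeft k (ρ f), hρ, fun a => by
    simp [hl]⟩

theorem rep_ε [CharZero k] : P.Rep P.ε.toLinearMap :=
  ⟨PUnit, inferInstance, inferInstance, inferInstance, P.unitHom (grassmann k PUnit),
    (grassmann k PUnit).ε.toLinearMap, isHom_unitHom _ _, fun a =>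
      ((isHom_unitHom P (grassmann k PUnit)).map_ε a).symm⟩

/-- The point is `ε + Z c`, and the form on the Grassmann algebra reads off the coefficient of `c`.
-/
theorem IsTangent.rep [CharZero k] {i : ZMod 2} {Z : Module.Dual k A} (hZ : P.IsTangent i Z) :
    P.Rep Z := by
  obtain ⟨c, l, hci, hc, hε, hl1, hlc⟩ := exists_grassmann_parameter (k := k) i
  refine ⟨_, _, _, inferInstance, expHom hZ hc, l, isHom_expHom hZ hc hci hε, fun a => ?_⟩
  rw [expHom_apply, Algebra.algebraMap_eq_smul_one, map_add, map_smul, map_smul, hl1, hlc]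
  simp

end Tangent

end AugSuperalgebra

open AugSuperalgebra

/-- What the theory of distributions at the identity uses of a supergroup: the stalks `A` of `G` at
`e` and `B` of `G × G` at `(e, e)`, and the group law on the points in Grassmann algebras. -/
structure FormalSupergroup (k A B : Type u) [Field k] [Ring A] [Algebra k A] [Ring B]
    [Algebra k B] where
  P : AugSuperalgebra k A
  PB : AugSuperalgebra k B
  p₁ : A →ₐ[k] B
  p₂ : A →ₐ[k] B
  μ : A →ₐ[k] B
  hp₁ : P.IsHom PB p₁
  hp₂ : P.IsHom PB p₂
  hμ : P.IsHom PB μ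
  exists_pair : ∀ (M : Type u) [AddCommGroup M] [Module k M] [Module.Finite k M]
    (ρ₁ ρ₂ : A →ₐ[k] ExteriorAlgebra k M), P.IsHom (grassmann k M) ρ₁ →
      P.IsHom (grassmann k M) ρ₂ → ∃ c : B →ₐ[k] ExteriorAlgebra k M,
        PB.IsHom (grassmann k M) c ∧ c.comp p₁ = ρ₁ ∧ c.comp p₂ = ρ₂
  pair_unique : ∀ (M : Type u) [AddCommGroup M] [Module k M] [Module.Finite k M]
    (c c' : B →ₐ[k] ExteriorAlgebra k M), PB.IsHom (grassmann k M) c →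
      PB.IsHom (grassmann k M) c' → c.comp p₁ = c'.comp p₁ → c.comp p₂ = c'.comp p₂ → c = c'
  assoc : ∀ (M : Type u) [AddCommGroup M] [Module k M] [Module.Finite k M]
    (c₁₂ c₂₃ c c' : B →ₐ[k] ExteriorAlgebra k M), PB.IsHom (grassmann k M) c₁₂ →
      PB.IsHom (grassmann k M) c₂₃ → PB.IsHom (grassmann k M) c → PB.IsHom (grassmann k M) c' →
      c₁₂.comp p₂ = c₂₃.comp p₁ → c.comp p₁ = c₁₂.comp μ → c.comp p₂ = c₂₃.comp p₂ →
      c'.comp p₁ = c₁₂.comp p₁ → c'.comp p₂ = c₂₃.comp μ → c.comp μ = c'.comp μ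
  one_mul : ∀ (M : Type u) [AddCommGroup M] [Module k M] [Module.Finite k M]
    (c : B →ₐ[k] ExteriorAlgebra k M), PB.IsHom (grassmann k M) c →
      c.comp p₁ = P.unitHom (grassmann k M) → c.comp μ = c.comp p₂
  mul_one : ∀ (M : Type u) [AddCommGroup M] [Module k M] [Module.Finite k M]
    (c : B →ₐ[k] ExteriorAlgebra k M), PB.IsHom (grassmann k M) c →
      c.comp p₂ = P.unitHom (grassmann k M) → c.comp μ = c.comp p₁

namespace FormalSupergroup

variable {k A B : Type u} [Field k] [Ring A] [Algebra k A] [Ring B] [Algebra k B]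
  (F : FormalSupergroup k A B)

/-! ### Density of the products `p₁ f * p₂ g` -/

theorem p₂_mul_p₁ (g : A) {i : ZMod 2} {f : A} (hf : f ∈ F.P.gr i) :
    F.p₂ g * F.p₁ f = F.p₁ f * F.p₂ (F.P.twist i g) := by
  rw [F.PB.mul_comm_of_mem (F.hp₁.map_gr hf), F.hp₂.twist]

/-- The span of the products `p₁ f * p₂ g` of total order `n`. -/
def products (n : ℕ) : Submodule k B :=
  Submodule.span k {x | ∃ a b f g, a + b = n ∧ f ∈ F.P.filt a ∧ g ∈ F.P.filt b ∧
    x = F.p₁ f * F.p₂ g}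

theorem mul_mem_products {a b : ℕ} {f g : A} (hf : f ∈ F.P.filt a) (hg : g ∈ F.P.filt b) :
    F.p₁ f * F.p₂ g ∈ F.products (a + b) :=
  Submodule.subset_span ⟨a, b, f, g, rfl, hf, hg, rfl⟩

theorem products_le_filt (n : ℕ) : F.products n ≤ F.PB.filt n := by
  refine Submodule.span_le.2 ?_
  rintro _ ⟨a, b, f, g, rfl, hf, hg, rfl⟩
  exact F.PB.mul_mem_filt (F.hp₁.map_filt hf) (F.hp₂.map_filt hg)

theorem products_succ_le (n : ℕ) : F.products (n + 1) ≤ F.products n := by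
  refine Submodule.span_le.2 ?_
  rintro _ ⟨a, b, f, g, h, hf, hg, rfl⟩
  cases a with
  | zero =>
    obtain rfl : b = n + 1 := by omega
    have := F.mul_mem_products hf (F.P.filt_succ_le n hg)
    rwa [zero_add] at this
  | succ a =>
    obtain rfl : n = a + b := by omega
    exact F.mul_mem_products (F.P.filt_succ_le a hf) hg

variable [CharZero k]

/-- Moving `p₂ g` past `p₁ f'`, with `f'` homogeneous, only twists `g`. Twists and parity components
respect the filtration, so the orders add up. -/
theorem products_mul_le (m n : ℕ) : F.products m * F.products n ≤ F.products (m + n) := by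
  rw [products, products, Submodule.span_mul_span]
  refine Submodule.span_le.2 ?_
  rintro _ ⟨_, ⟨a, b, f, g, rfl, hf, hg, rfl⟩, _, ⟨a', b', f', g', rfl, hf', hg', rfl⟩, rfl⟩
  change F.p₁ f * F.p₂ g * (F.p₁ f' * F.p₂ g') ∈ _
  have key : ∀ i, F.p₁ f * F.p₂ g * (F.p₁ (component F.P.isSuper.isCompl i f') * F.p₂ g') ∈
      F.products (a + b + (a' + b')) := by
    intro i
    rw [mul_assoc, ← mul_assoc (F.p₂ g), F.p₂_mul_p₁ g (component_mem _ i f'), mul_assoc,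
      ← map_mul, ← mul_assoc, ← map_mul, add_add_add_comm]
    exact F.mul_mem_products (F.P.mul_mem_filt hf (F.P.component_mem_filt i hf'))
      (F.P.mul_mem_filt ((F.P.isHom_twist i).map_filt hg) hg')
  have := add_mem (key 0) (key 1)
  rwa [← mul_add, ← add_mul, ← map_add, component_add] at this

/-- This says that tangent vectors of `G × G` are determined by their two projections. If `u` lay
outside `N`, some homogeneous tangent vector `Z` would kill `N` but not `u`, and `ε + Z c` and `ε`
would be distinct points with equal projections. -/
theorem exists_sub_mem {u : B} (hu : u ∈ F.PB.m) :
    ∃ a ∈ F.P.m, ∃ b ∈ F.P.m, u - F.p₁ a - F.p₂ b ∈ F.PB.filt 2 := by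
  set N := F.P.m.map F.p₁.toLinearMap ⊔ F.P.m.map F.p₂.toLinearMap ⊔ F.PB.filt 2 with hN
  have hmem : ∀ x, x ∈ N ↔ ∃ a ∈ F.P.m, ∃ b ∈ F.P.m, x - F.p₁ a - F.p₂ b ∈ F.PB.filt 2 := by
    intro x
    constructor
    · intro h
      obtain ⟨y, hy, z, hz, rfl⟩ := Submodule.mem_sup.1 h
      obtain ⟨_, ⟨a, ha, rfl⟩, _, ⟨b, hb, rfl⟩, rfl⟩ := Submodule.mem_sup.1 hy
      refine ⟨a, ha, b, hb, ?_⟩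
      have : F.p₁.toLinearMap a + F.p₂.toLinearMap b + z - F.p₁ a - F.p₂ b = z := by
        simp only [AlgHom.toLinearMap_apply]
        abel
      rwa [this]
    · rintro ⟨a, ha, b, hb, h⟩
      have : x = F.p₁ a + F.p₂ b + (x - F.p₁ a - F.p₂ b) := by abel
      rw [this]
      exact add_mem (Submodule.mem_sup_left (add_mem (Submodule.mem_sup_left ⟨a, ha, rfl⟩)
        (Submodule.mem_sup_right ⟨b, hb, rfl⟩))) (Submodule.mem_sup_right h)
  rw [← hmem]
  by_contra huN
  obtain ⟨i, Z, hZ, hZN, hZu⟩ := exists_tangent (P := F.PB) (N := N) le_sup_right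
    (sup_le (sup_le
      (by rintro _ ⟨a, ha, rfl⟩; exact F.hp₁.map_m ha)
      (by rintro _ ⟨a, ha, rfl⟩; exact F.hp₂.map_m ha))
      (by rw [← F.PB.filt_one]; exact F.PB.filt_succ_le 1))
    (fun x hx => by
      rw [hmem] at hx ⊢
      obtain ⟨a, ha, b, hb, h⟩ := hx
      refine ⟨_, (F.P.isHom_twist 1).map_m ha, _, (F.P.isHom_twist 1).map_m hb, ?_⟩
      rw [F.hp₁.twist, F.hp₂.twist, ← map_sub, ← map_sub]
      exact (F.PB.isHom_twist 1).map_filt h) hu huN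
  obtain ⟨c, l, hci, hc, hε, hl1, hlc⟩ := exists_grassmann_parameter (k := k) i
  -- `Z` vanishes on `p m` and on constants, so on the image of `p` the point `ε + Z c` is the
  -- trivial one.
  have key : ∀ (p : A →ₐ[k] B), F.P.IsHom F.PB p → (∀ a ∈ F.P.m, p a ∈ N) →
      (expHom hZ hc).comp p = (F.PB.unitHom (grassmann k (Fin 2 → k))).comp p := by
    intro p hp hpN
    refine AlgHom.ext fun a => ?_
    have h : Z (p a) = 0 := by
      have := hZN _ (hpN _ (F.P.sub_ε_mem a))
      rw [map_sub, map_sub, AlgHom.commutes, Algebra.algebraMap_eq_smul_one, map_smul,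
        hZ.map_one, smul_zero, sub_zero] at this
      exact this
    rw [AlgHom.comp_apply, expHom_apply, h, zero_smul, add_zero]
    rfl
  have h := F.pair_unique _ _ _ (isHom_expHom hZ hc hci hε) (isHom_unitHom F.PB _)
    (key F.p₁ F.hp₁ fun a ha => (hmem _).2 ⟨a, ha, 0, zero_mem _, by simp⟩)
    (key F.p₂ F.hp₂ fun a ha => (hmem _).2 ⟨0, zero_mem _, a, ha, by simp⟩)
  have h' := DFunLike.congr_fun h u
  rw [expHom_apply, unitHom_apply, add_eq_left] at h'
  have h'' := congrArg l h'
  rw [map_smul, hlc, map_zero, smul_eq_mul, _root_.mul_one] at h''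
  exact hZu h''

theorem m_le : F.PB.m ≤ F.products 1 ⊔ F.PB.filt 2 := by
  intro u hu
  obtain ⟨a, ha, b, hb, h⟩ := F.exists_sub_mem hu
  have e : u = F.p₁ a * F.p₂ 1 + F.p₁ 1 * F.p₂ b + (u - F.p₁ a - F.p₂ b) := by
    rw [map_one, map_one, _root_.mul_one, _root_.one_mul]
    abel
  rw [← F.P.filt_one] at ha hb
  have h₁ : F.p₁ a * F.p₂ 1 ∈ F.products (1 + 0) :=
    F.mul_mem_products ha (by rw [F.P.filt_zero]; trivial)
  have h₂ : F.p₁ 1 * F.p₂ b ∈ F.products (0 + 1) :=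
    F.mul_mem_products (by rw [F.P.filt_zero]; trivial) hb
  rw [add_zero] at h₁
  rw [zero_add] at h₂
  rw [e]
  exact add_mem (Submodule.mem_sup_left (add_mem h₁ h₂)) (Submodule.mem_sup_right h)

/-- Induction along `m ^ (n + 1) = m * m ^ n`, with `m_le` for the new factor: every term containing
a remainder has order at least `n + 2`. -/
theorem filt_le_products_sup_succ (n : ℕ) :
    F.PB.filt n ≤ F.products n ⊔ F.PB.filt (n + 1) := by
  induction n with
  | zero =>
    intro b _
    rw [← sub_add_cancel b (algebraMap k B (F.PB.ε b))]
    refine add_mem (Submodule.mem_sup_right (F.PB.filt_one.symm ▸ F.PB.sub_ε_mem b))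
      (Submodule.mem_sup_left ?_)
    rw [Algebra.algebraMap_eq_smul_one]
    refine Submodule.smul_mem _ _ ?_
    have := F.mul_mem_products (a := 0) (b := 0) (f := 1) (g := 1) trivial trivial
    rwa [map_one, map_one, _root_.mul_one] at this
  | succ n ih =>
    rw [← F.PB.m_mul_filt n]
    refine Submodule.mul_le.2 fun x hx y hy => ?_
    obtain ⟨x₁, hx₁, x₂, hx₂, rfl⟩ := Submodule.mem_sup.1 (F.m_le hx)
    obtain ⟨y₁, hy₁, y₂, hy₂, rfl⟩ := Submodule.mem_sup.1 (ih hy)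
    rw [mul_add, add_mul, add_mul, add_assoc (x₁ * y₁)]
    refine add_mem (Submodule.mem_sup_left ?_) (Submodule.mem_sup_right (add_mem ?_ (add_mem ?_ ?_)))
    · rw [add_comm n]
      exact F.products_mul_le 1 n (Submodule.mul_mem_mul hx₁ hy₁)
    · have := F.PB.mul_mem_filt hx₂ (F.products_le_filt n hy₁)
      rwa [add_comm 2 n] at this
    · have := F.PB.mul_mem_filt (F.products_le_filt 1 hx₁) hy₂
      rwa [add_comm 1] at this
    · have := F.PB.mul_mem_filt (F.PB.filt_succ_le 1 hx₂) hy₂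
      rwa [add_comm 1] at this

theorem filt_le_products_sup (n N : ℕ) : F.PB.filt n ≤ F.products n ⊔ F.PB.filt (n + N) := by
  induction N with
  | zero => exact le_sup_right
  | succ N ih =>
    refine ih.trans (sup_le le_sup_left ((F.filt_le_products_sup_succ _).trans
      (sup_le_sup_right ?_ _)))
    exact antitone_nat_of_succ_le F.products_succ_le (Nat.le_add_right n N)

/-- Some power `N` of the maximal ideal is killed by `T`, and modulo order `n + N` the elements of
order `n` are sums of products. -/
theorem eq_zero_on_filt {T : Module.Dual k B} (hT : T ∈ F.PB.dist) {n : ℕ}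
    (h : ∀ x ∈ F.products n, T x = 0) {b : B} (hb : b ∈ F.PB.filt n) : T b = 0 := by
  obtain ⟨N, hN⟩ := F.PB.mem_dist.1 hT
  obtain ⟨x, hx, y, hy, rfl⟩ := Submodule.mem_sup.1 (F.filt_le_products_sup n N hb)
  rw [map_add, h x hx, hN y (F.PB.filt_antitone (Nat.le_add_left N n) hy), add_zero]

theorem dist_ext {T T' : Module.Dual k B} (hT : T ∈ F.PB.dist) (hT' : T' ∈ F.PB.dist)
    (h : ∀ i j f g, f ∈ F.P.gr i → g ∈ F.P.gr j → T (F.p₁ f * F.p₂ g) = T' (F.p₁ f * F.p₂ g)) :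
    T = T' := by
  refine LinearMap.ext fun b => sub_eq_zero.1 ?_
  refine F.eq_zero_on_filt (sub_mem hT hT') (n := 0) (b := b) (fun x hx => ?_) trivial
  refine (Submodule.span_le (p := LinearMap.ker (T - T'))).2 ?_ hx
  rintro _ ⟨_, _, f, g, _, _, _, rfl⟩
  change T (F.p₁ f * F.p₂ g) - T' (F.p₁ f * F.p₂ g) = 0
  rw [sub_eq_zero]
  refine homogeneous_induction F.P.isSuper.isCompl
    (p := fun f => T (F.p₁ f * F.p₂ g) = T' (F.p₁ f * F.p₂ g)) (fun i f hf => ?_)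
    (fun x y hx hy => by rw [map_add, add_mul, map_add, map_add, hx, hy]) f
  exact homogeneous_induction F.P.isSuper.isCompl
    (p := fun g => T (F.p₁ f * F.p₂ g) = T' (F.p₁ f * F.p₂ g)) (fun j g hg => h i j f g hf hg)
    (fun x y hx hy => by rw [map_add, mul_add, map_add, map_add, hx, hy]) g

end FormalSupergroup

end Super

namespace Super
open AugSuperalgebra
namespace FormalSupergroup

variable {k A B : Type u} [Field k] [Ring A] [Algebra k A] [Ring B] [Algebra k B]
  (F : FormalSupergroup k A B)

/-! ### Tensor products of distributions -/

/-- `T` is the tensor product of the linear forms `φ` and `ψ`. -/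
structure IsTens (φ ψ : Module.Dual k A) (T : Module.Dual k B) : Prop where
  mem_dist : T ∈ F.PB.dist
  apply : ∀ i j f g, f ∈ F.P.gr i → g ∈ F.P.gr j →
    T (F.p₁ f * F.p₂ g) = koszul k i j * (φ f * ψ g)

variable {F}

theorem IsTens.add_left {φ φ' ψ : Module.Dual k A} {T T' : Module.Dual k B} (h : F.IsTens φ ψ T)
    (h' : F.IsTens φ' ψ T') : F.IsTens (φ + φ') ψ (T + T') where
  mem_dist := add_mem h.mem_dist h'.mem_dist
  apply i j f g hf hg := by
    rw [LinearMap.add_apply, h.apply i j f g hf hg, h'.apply i j f g hf hg, LinearMap.add_apply]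
    ring

theorem IsTens.add_right {φ ψ ψ' : Module.Dual k A} {T T' : Module.Dual k B} (h : F.IsTens φ ψ T)
    (h' : F.IsTens φ ψ' T') : F.IsTens φ (ψ + ψ') (T + T') where
  mem_dist := add_mem h.mem_dist h'.mem_dist
  apply i j f g hf hg := by
    rw [LinearMap.add_apply, h.apply i j f g hf hg, h'.apply i j f g hf hg, LinearMap.add_apply]
    ring

theorem IsTens.smul_left {φ ψ : Module.Dual k A} {T : Module.Dual k B} (h : F.IsTens φ ψ T)
    (c : k) : F.IsTens (c • φ) ψ (c • T) where
  mem_dist := Submodule.smul_mem _ _ h.mem_dist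
  apply i j f g hf hg := by
    rw [LinearMap.smul_apply, h.apply i j f g hf hg, LinearMap.smul_apply, smul_eq_mul,
      smul_eq_mul]
    ring

theorem IsTens.smul_right {φ ψ : Module.Dual k A} {T : Module.Dual k B} (h : F.IsTens φ ψ T)
    (c : k) : F.IsTens φ (c • ψ) (c • T) where
  mem_dist := Submodule.smul_mem _ _ h.mem_dist
  apply i j f g hf hg := by
    rw [LinearMap.smul_apply, h.apply i j f g hf hg, LinearMap.smul_apply, smul_eq_mul,
      smul_eq_mul]
    ring

variable [CharZero k]

theorem IsTens.unique {φ ψ : Module.Dual k A} {T T' : Module.Dual k B} (h : F.IsTens φ ψ T)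
    (h' : F.IsTens φ ψ T') : T = T' :=
  F.dist_ext h.mem_dist h'.mem_dist fun i j f g hf hg => by
    rw [h.apply i j f g hf hg, h'.apply i j f g hf hg]

/-- In a product of total order `c + d = n` with `a + b ≤ n + 1`, either `c ≥ a` or `d ≥ b`. The
gain of one makes orders add: forms that kill orders `i + 1` and `j + 1` have a tensor product that
kills order `i + j + 1`. -/
theorem IsTens.eq_zero_on_filt {φ ψ : Module.Dual k A} {T : Module.Dual k B} (h : F.IsTens φ ψ T)
    {a b n : ℕ} (hφ : ∀ f ∈ F.P.filt a, φ f = 0) (hψ : ∀ f ∈ F.P.filt b, ψ f = 0)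
    (hn : a + b ≤ n + 1) {x : B} (hx : x ∈ F.PB.filt n) : T x = 0 := by
  refine F.eq_zero_on_filt h.mem_dist (fun x hx => ?_) hx
  refine (Submodule.span_le (p := LinearMap.ker T)).2 ?_ hx
  rintro _ ⟨c, d, f, g, rfl, hf, hg, rfl⟩
  change T (F.p₁ f * F.p₂ g) = 0
  rw [← component_add F.P.isSuper.isCompl f, ← component_add F.P.isSuper.isCompl g]
  have key : ∀ i j, T (F.p₁ (component F.P.isSuper.isCompl i f) *
      F.p₂ (component F.P.isSuper.isCompl j g)) = 0 := by
    intro i j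
    rw [h.apply i j _ _ (component_mem _ i f) (component_mem _ j g)]
    by_cases hc : a ≤ c
    · rw [hφ _ (F.P.filt_antitone hc (F.P.component_mem_filt i hf)), zero_mul, mul_zero]
    · rw [hψ _ (F.P.filt_antitone (by omega) (F.P.component_mem_filt j hg)), mul_zero, mul_zero]
  simp only [map_add, mul_add, add_mul, key, add_zero]

/-- The tensor product has the sum of the parities. -/
theorem IsTens.parity {φ ψ : Module.Dual k A} {T : Module.Dual k B} (h : F.IsTens φ ψ T)
    {i j : ZMod 2} (hφ : ∀ l, l ≠ i → ∀ f ∈ F.P.gr l, φ f = 0)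
    (hψ : ∀ l, l ≠ j → ∀ f ∈ F.P.gr l, ψ f = 0) (l : ZMod 2) (hl : l ≠ i + j) (b : B)
    (hb : b ∈ F.PB.gr l) : T b = 0 := by
  have hT : T ∘ₗ component F.PB.isSuper.isCompl l ∈ F.PB.dist := by
    obtain ⟨n, hn⟩ := F.PB.mem_dist.1 h.mem_dist
    exact F.PB.mem_dist.2 ⟨n, fun b hb => hn _ (F.PB.component_mem_filt l hb)⟩
  -- The part of `T` of the wrong parity kills every product of homogeneous functions, hence
  -- vanishes by density.
  have h0 : T ∘ₗ component F.PB.isSuper.isCompl l = 0 := by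
    refine F.dist_ext hT (zero_mem _) fun a c f g hf hg => ?_
    have hfg := F.PB.isSuper.mul_mem (F.hp₁.map_gr hf) (F.hp₂.map_gr hg)
    rw [LinearMap.comp_apply, LinearMap.zero_apply]
    by_cases hac : a + c = l
    · rw [component_of_mem _ (hac ▸ hfg), h.apply a c f g hf hg]
      by_cases ha : a = i
      · rw [hψ c (by rintro rfl; exact hl (by rw [← hac, ha])) g hg, mul_zero, mul_zero]
      · rw [hφ a ha f hf, zero_mul, mul_zero]
    · rw [component_of_mem_ne _ hac hfg, map_zero]
  rw [← component_of_mem F.PB.isSuper.isCompl hb]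
  exact DFunLike.congr_fun h0 b

omit [CharZero k] in
theorem IsTens.comp_μ_mem_dist {φ ψ : Module.Dual k A} {T : Module.Dual k B}
    (h : F.IsTens φ ψ T) : T ∘ₗ F.μ.toLinearMap ∈ F.P.dist := by
  obtain ⟨n, hn⟩ := F.PB.mem_dist.1 h.mem_dist
  exact F.P.mem_dist.2 ⟨n, fun a ha => hn _ (F.hμ.map_filt ha)⟩

-- Both points are moved into `Λ(M₂ × M₁)` and paired there to a point `c` of `G × G`; then `T` is
-- `c` followed by the product form. The composite of `c` with `μ` is again a Grassmann point, so
-- convolution preserves `Rep`.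
omit [CharZero k] in
theorem exists_isTens {φ ψ : Module.Dual k A} (hφ : F.P.Rep φ) (hψ : F.P.Rep ψ) :
    ∃ T, F.IsTens φ ψ T ∧ F.P.Rep (T ∘ₗ F.μ.toLinearMap) := by
  obtain ⟨M₁, _, _, _, ρ₁, l₁, hρ₁, hl₁⟩ := hφ
  obtain ⟨M₂, _, _, _, ρ₂, l₂, hρ₂, hl₂⟩ := hψ
  obtain ⟨L, hL⟩ := exists_product_form l₁ l₂
  have h₁ := (isHom_map (.inr k M₂ M₁)).comp hρ₁
  have h₂ := (isHom_map (.inl k M₂ M₁)).comp hρ₂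
  obtain ⟨c, hc, hc₁, hc₂⟩ := F.exists_pair _ _ _ h₁ h₂
  refine ⟨L ∘ₗ c.toLinearMap, ⟨mem_dist_of_isHom hc L, fun i j f g hf hg => ?_⟩,
    ⟨_, _, _, inferInstance, c.comp F.μ, L, hc.comp F.hμ, fun _ => rfl⟩⟩
  have e₁ := DFunLike.congr_fun hc₁ f
  have e₂ := DFunLike.congr_fun hc₂ g
  rw [LinearMap.comp_apply, AlgHom.toLinearMap_apply, map_mul]
  simp only [AlgHom.comp_apply] at e₁ e₂
  -- The product form expects the second factor on the left; the exchange produces the Koszul sign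
  -- of the tensor product.
  rw [e₁, e₂, (grassmann k (M₂ × M₁)).comm ((isHom_map (.inr k M₂ M₁)).map_gr (hρ₁.map_gr hf))
    ((isHom_map (.inl k M₂ M₁)).map_gr (hρ₂.map_gr hg)), map_smul, hL, hl₁, hl₂, smul_eq_mul]

/-- Pair the point of `φ` with the trivial point: the unit law says that multiplication returns the
point of `φ`. The sign disappears because `ε` kills odd elements. -/
theorem isTens_ε_right {φ : Module.Dual k A} (hφ : F.P.Rep φ) :
    ∃ T, F.IsTens φ F.P.ε.toLinearMap T ∧ T ∘ₗ F.μ.toLinearMap = φ := by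
  obtain ⟨M, _, _, _, ρ, l, hρ, hl⟩ := hφ
  obtain ⟨c, hc, hc₁, hc₂⟩ := F.exists_pair _ _ _ hρ (isHom_unitHom _ _)
  refine ⟨l ∘ₗ c.toLinearMap, ⟨mem_dist_of_isHom hc l, fun i j f g hf hg => ?_⟩, ?_⟩
  · have e₁ := DFunLike.congr_fun hc₁ f
    have e₂ := DFunLike.congr_fun hc₂ g
    simp only [AlgHom.comp_apply] at e₁ e₂
    rw [LinearMap.comp_apply, AlgHom.toLinearMap_apply, map_mul, e₁, e₂, unitHom_apply,
      ← Algebra.commutes, ← Algebra.smul_def, map_smul, ← hl, AlgHom.toLinearMap_apply,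
      mul_left_comm, F.P.koszul_mul_ε i hg, smul_eq_mul, mul_comm]
  · refine LinearMap.ext fun a => ?_
    have := DFunLike.congr_fun ((F.mul_one _ c hc hc₂).trans hc₁) a
    exact (congrArg l this).trans (hl a).symm

theorem isTens_ε_left {φ : Module.Dual k A} (hφ : F.P.Rep φ) :
    ∃ T, F.IsTens F.P.ε.toLinearMap φ T ∧ T ∘ₗ F.μ.toLinearMap = φ := by
  obtain ⟨M, _, _, _, ρ, l, hρ, hl⟩ := hφ
  obtain ⟨c, hc, hc₁, hc₂⟩ := F.exists_pair _ _ _ (isHom_unitHom _ _) hρ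
  refine ⟨l ∘ₗ c.toLinearMap, ⟨mem_dist_of_isHom hc l, fun i j f g hf hg => ?_⟩, ?_⟩
  · have e₁ := DFunLike.congr_fun hc₁ f
    have e₂ := DFunLike.congr_fun hc₂ g
    simp only [AlgHom.comp_apply] at e₁ e₂
    rw [LinearMap.comp_apply, AlgHom.toLinearMap_apply, map_mul, e₁, e₂, unitHom_apply,
      ← Algebra.smul_def, map_smul, ← hl, AlgHom.toLinearMap_apply, ← mul_assoc, koszul_comm,
      F.P.koszul_mul_ε j hf, smul_eq_mul]
  · refine LinearMap.ext fun a => ?_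
    have := DFunLike.congr_fun ((F.one_mul _ c hc hc₁).trans hc₂) a
    exact (congrArg l this).trans (hl a).symm

/-- The three points are placed in `Λ(M₃ × (M₂ × M₁))`, where one form `L` is the product of the
three given forms. Both bracketings turn out to be `L` applied to a product of the same three
points, so they agree by associativity of the group of points. -/
theorem isTens_assoc {φ ψ χ : Module.Dual k A} (hφ : F.P.Rep φ) (hψ : F.P.Rep ψ)
    (hχ : F.P.Rep χ) {T₁₂ T₂₃ T T' : Module.Dual k B} (h₁₂ : F.IsTens φ ψ T₁₂)
    (h₂₃ : F.IsTens ψ χ T₂₃) (hT : F.IsTens (T₁₂ ∘ₗ F.μ.toLinearMap) χ T)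
    (hT' : F.IsTens φ (T₂₃ ∘ₗ F.μ.toLinearMap) T') :
    T ∘ₗ F.μ.toLinearMap = T' ∘ₗ F.μ.toLinearMap := by
  obtain ⟨M₁, _, _, _, ρ₁, l₁, hρ₁, hl₁⟩ := hφ
  obtain ⟨M₂, _, _, _, ρ₂, l₂, hρ₂, hl₂⟩ := hψ
  obtain ⟨M₃, _, _, _, ρ₃, l₃, hρ₃, hl₃⟩ := hχ
  obtain ⟨L₁₂, hL₁₂⟩ := exists_product_form l₁ l₂
  obtain ⟨L, hL⟩ := exists_product_form L₁₂ l₃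
  set R := grassmann k (M₃ × (M₂ × M₁))
  have hr₁ := (isHom_map (.inr k M₃ (M₂ × M₁))).comp ((isHom_map (.inr k M₂ M₁)).comp hρ₁)
  have hr₂ := (isHom_map (.inr k M₃ (M₂ × M₁))).comp ((isHom_map (.inl k M₂ M₁)).comp hρ₂)
  have hr₃ := (isHom_map (.inl k M₃ (M₂ × M₁))).comp hρ₃
  set r₁ := (ExteriorAlgebra.map (.inr k M₃ (M₂ × M₁))).comp
    ((ExteriorAlgebra.map (.inr k M₂ M₁)).comp ρ₁)
  set r₂ := (ExteriorAlgebra.map (.inr k M₃ (M₂ × M₁))).comp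
    ((ExteriorAlgebra.map (.inl k M₂ M₁)).comp ρ₂)
  set r₃ := (ExteriorAlgebra.map (.inl k M₃ (M₂ × M₁))).comp ρ₃
  have hLr : ∀ f g h, L (r₃ h * (r₂ g * r₁ f)) = φ f * ψ g * χ h := by
    intro f g h
    simp only [r₁, r₂, r₃, AlgHom.comp_apply]
    rw [← map_mul, hL, hL₁₂, hl₁, hl₂, hl₃]
  obtain ⟨c₁₂, hc₁₂, e₁, e₂⟩ := F.exists_pair _ _ _ hr₁ hr₂
  obtain ⟨c₂₃, hc₂₃, e₃, e₄⟩ := F.exists_pair _ _ _ hr₂ hr₃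
  obtain ⟨c, hc, e₅, e₆⟩ := F.exists_pair _ _ _ (hc₁₂.comp F.hμ) hr₃
  obtain ⟨c', hc', e₇, e₈⟩ := F.exists_pair _ _ _ hr₁ (hc₂₃.comp F.hμ)
  have happ : ∀ {c : B →ₐ[k] _} {p : A →ₐ[k] B} {r : A →ₐ[k] ExteriorAlgebra k (M₃ × (M₂ × M₁))}
      (_ : c.comp p = r) (a : A), c (p a) = r a := fun h a => DFunLike.congr_fun h a
  -- On products of functions this is the defining property of `L` up to the sign of one exchange;
  -- density extends it to all `b`. The second claim is symmetric.
  have claim₁ : ∀ (h : A) (b : B), L (r₃ h * c₁₂ b) = T₁₂ b * χ h := by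
    intro h b
    have : (L ∘ₗ LinearMap.mulLeft k (r₃ h)) ∘ₗ c₁₂.toLinearMap = χ h • T₁₂ := by
      refine F.dist_ext (mem_dist_of_isHom hc₁₂ _) (Submodule.smul_mem _ _ h₁₂.mem_dist)
        fun i j f g hf hg => ?_
      simp only [LinearMap.comp_apply, LinearMap.mulLeft_apply, AlgHom.toLinearMap_apply, map_mul,
        happ e₁, happ e₂, LinearMap.smul_apply, smul_eq_mul]
      rw [R.comm (hr₁.map_gr hf) (hr₂.map_gr hg), mul_smul_comm, map_smul, hLr,
        h₁₂.apply i j f g hf hg, smul_eq_mul]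
      ring
    exact (DFunLike.congr_fun this b).trans (mul_comm _ _)
  have claim₂ : ∀ (f : A) (b : B), L (c₂₃ b * r₁ f) = φ f * T₂₃ b := by
    intro f b
    have : (L ∘ₗ LinearMap.mulRight k (r₁ f)) ∘ₗ c₂₃.toLinearMap = φ f • T₂₃ := by
      refine F.dist_ext (mem_dist_of_isHom hc₂₃ _) (Submodule.smul_mem _ _ h₂₃.mem_dist)
        fun i j g h hg hh => ?_
      simp only [LinearMap.comp_apply, LinearMap.mulRight_apply, AlgHom.toLinearMap_apply, map_mul,
        happ e₃, happ e₄, LinearMap.smul_apply, smul_eq_mul]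
      rw [R.comm (hr₂.map_gr hg) (hr₃.map_gr hh), smul_mul_assoc, map_smul, mul_assoc, hLr,
        h₂₃.apply i j g h hg hh, smul_eq_mul]
      ring
    exact DFunLike.congr_fun this b
  have hcT : T = L ∘ₗ c.toLinearMap := by
    refine F.dist_ext hT.mem_dist (mem_dist_of_isHom hc _) fun i j f h hf hh => ?_
    simp only [hT.apply i j f h hf hh, LinearMap.comp_apply, AlgHom.toLinearMap_apply, map_mul,
      happ e₅, happ e₆, AlgHom.comp_apply]
    rw [R.comm (hc₁₂.map_gr (F.hμ.map_gr hf)) (hr₃.map_gr hh), map_smul, claim₁,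
      smul_eq_mul]
  have hcT' : T' = L ∘ₗ c'.toLinearMap := by
    refine F.dist_ext hT'.mem_dist (mem_dist_of_isHom hc' _) fun i j f h hf hh => ?_
    simp only [hT'.apply i j f h hf hh, LinearMap.comp_apply, AlgHom.toLinearMap_apply, map_mul,
      happ e₇, happ e₈, AlgHom.comp_apply]
    rw [R.comm (hr₁.map_gr hf) (hc₂₃.map_gr (F.hμ.map_gr hh)), map_smul, claim₂,
      smul_eq_mul]
  have h := F.assoc _ c₁₂ c₂₃ c c' hc₁₂ hc₂₃ hc hc' (e₂.trans e₃.symm) e₅ (e₆.trans e₄.symm)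
    (e₇.trans e₁.symm) e₈
  rw [hcT, hcT']
  exact LinearMap.ext fun a => congrArg L (DFunLike.congr_fun h a)

/-! ### The convolution with a tangent vector -/

/-- Only second factors of parity `p` contribute, so the extra sign caused by `f` is the constant
`koszul k i p`. -/
theorem IsTens.apply_p₁_mul {φ X : Module.Dual k A} {T T₁ : Module.Dual k B} {i p : ZMod 2}
    (hX : ∀ j, j ≠ p → ∀ a ∈ F.P.gr j, X a = 0) {f : A} (hf : f ∈ F.P.gr i)
    (h : F.IsTens φ X T) (h₁ : F.IsTens (φ ∘ₗ LinearMap.mulLeft k f) X T₁) (b : B) :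
    T (F.p₁ f * b) = koszul k i p * T₁ b := by
  have : T ∘ₗ LinearMap.mulLeft k (F.p₁ f) = koszul k i p • T₁ := by
    refine F.dist_ext ?_ (Submodule.smul_mem _ _ h₁.mem_dist) fun j l g g' hg hg' => ?_
    · obtain ⟨n, hn⟩ := F.PB.mem_dist.1 h.mem_dist
      exact F.PB.mem_dist.2 ⟨n, fun b hb => hn _ (F.PB.mul_mem_filt_left _ hb)⟩
    · rw [LinearMap.comp_apply, LinearMap.mulLeft_apply, ← mul_assoc, ← map_mul,
        h.apply _ _ _ _ (F.P.isSuper.mul_mem hf hg) hg', LinearMap.smul_apply,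
        h₁.apply _ _ _ _ hg hg', LinearMap.comp_apply, LinearMap.mulLeft_apply, smul_eq_mul,
        koszul_add_left]
      by_cases hl : l = p
      · rw [hl]
        ring
      · rw [hX l hl g' hg']
        ring
  exact DFunLike.congr_fun this b

/-- Because `ε f = 0`, the derivation property leaves only `X f * ε g'`, which replaces `X` by `ε`
in the second factor. The sign from moving `p₂ f` past `p₁ g` cancels against that of the tensor
product. -/
theorem IsTens.apply_p₂_mul {φ X : Module.Dual k A} {T T₀ : Module.Dual k B} {i p : ZMod 2}
    (hX : F.P.IsTangent p X) {f : A} (hf : f ∈ F.P.gr i) (hfm : f ∈ F.P.m)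
    (h : F.IsTens φ X T) (h₀ : F.IsTens φ F.P.ε.toLinearMap T₀) (b : B) :
    T (F.p₂ f * b) = X f * T₀ b := by
  have : T ∘ₗ LinearMap.mulLeft k (F.p₂ f) = X f • T₀ := by
    refine F.dist_ext ?_ (Submodule.smul_mem _ _ h₀.mem_dist) fun j l g g' hg hg' => ?_
    · obtain ⟨n, hn⟩ := F.PB.mem_dist.1 h.mem_dist
      exact F.PB.mem_dist.2 ⟨n, fun b hb => hn _ (F.PB.mul_mem_filt_left _ hb)⟩
    · rw [LinearMap.comp_apply, LinearMap.mulLeft_apply, ← mul_assoc,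
        F.PB.comm (F.hp₂.map_gr hf) (F.hp₁.map_gr hg), smul_mul_assoc, mul_assoc, ← map_mul,
        map_smul, h.apply _ _ _ _ hg (F.P.isSuper.mul_mem hf hg'), hX.map_mul,
        (F.P.mem_m f).1 hfm, zero_mul, zero_add, LinearMap.smul_apply, h₀.apply _ _ _ _ hg hg',
        AlgHom.toLinearMap_apply, koszul_add_right, koszul_comm k i j, smul_eq_mul, smul_eq_mul]
      linear_combination (koszul k j l * φ g * X f * F.P.ε g') * koszul_mul_self k j i
  exact DFunLike.congr_fun this b

-- This is the infinitesimal form of the unit laws. Write `μ f ≡ p₁ a + p₂ b`; pairing with `Z ⊗ ε`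
-- and `ε ⊗ Z`, whose composites with `μ` are `Z`, gives `Z f = Z a` and `Z f = Z b` for every
-- tangent vector, so `a` and `b` agree with `f` modulo `m²`.
variable (F) in
theorem μ_sub_mem {f : A} (hf : f ∈ F.P.m) : F.μ f - F.p₁ f - F.p₂ f ∈ F.PB.filt 2 := by
  have hε1 : ∀ a ∈ F.P.filt 1, F.P.ε.toLinearMap a = 0 := fun a ha =>
    (F.P.mem_m a).1 (F.P.filt_one ▸ ha)
  obtain ⟨a, ha, b, hb, h⟩ := F.exists_sub_mem (F.hμ.map_m hf)
  -- Tangent vectors separate the points of `m/m²`.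
  have key : ∀ x ∈ F.P.m, (∀ i Z, F.P.IsTangent i Z → Z x = 0) → x ∈ F.P.filt 2 := by
    intro x hx hZ
    by_contra hx2
    obtain ⟨i, Z, hZt, -, hZx⟩ := exists_tangent (P := F.P) le_rfl
      (by rw [← F.P.filt_one]; exact F.P.filt_succ_le 1)
      (fun a ha => (F.P.isHom_twist 1).map_filt ha) hx hx2
    exact hZx (hZ i Z hZt)
  have e : F.μ f = F.p₁ a * F.p₂ 1 + F.p₁ 1 * F.p₂ b + (F.μ f - F.p₁ a - F.p₂ b) := by
    rw [map_one, map_one, _root_.mul_one, _root_.one_mul]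
    abel
  have hbil : ∀ {φ ψ T} (_ : F.IsTens φ ψ T) (f : A), T (F.p₁ f * F.p₂ 1) = φ f * ψ 1 := by
    intro φ ψ T hT f
    refine homogeneous_induction F.P.isSuper.isCompl
      (p := fun f => T (F.p₁ f * F.p₂ 1) = φ f * ψ 1) (fun i f hf => ?_)
      (fun x y hx hy => by rw [map_add, add_mul, map_add, hx, hy, map_add, add_mul]) f
    rw [hT.apply i 0 f 1 hf F.P.isSuper.one_mem, koszul_zero_right, _root_.one_mul]
  have hbil' : ∀ {φ ψ T} (_ : F.IsTens φ ψ T) (f : A), T (F.p₁ 1 * F.p₂ f) = φ 1 * ψ f := by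
    intro φ ψ T hT f
    refine homogeneous_induction F.P.isSuper.isCompl
      (p := fun f => T (F.p₁ 1 * F.p₂ f) = φ 1 * ψ f) (fun i f hf => ?_)
      (fun x y hx hy => by rw [map_add, mul_add, map_add, hx, hy, map_add, mul_add]) f
    rw [hT.apply 0 i 1 f F.P.isSuper.one_mem hf, koszul_zero_left, _root_.one_mul]
  have h₁ : f - a ∈ F.P.filt 2 := key _ (sub_mem hf ha) fun i Z hZ => by
    obtain ⟨T, hT, hTμ⟩ := isTens_ε_right (F := F) hZ.rep
    have h1 : Z f = T (F.μ f) := (DFunLike.congr_fun hTμ f).symm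
    rw [e, map_add, map_add, hbil hT, hbil' hT,
      hT.eq_zero_on_filt hZ.map_sq hε1 (n := 2) le_rfl h, hZ.map_one] at h1
    rw [map_sub, h1]
    simp
  have h₂ : f - b ∈ F.P.filt 2 := key _ (sub_mem hf hb) fun i Z hZ => by
    obtain ⟨T, hT, hTμ⟩ := isTens_ε_left (F := F) hZ.rep
    have h1 : Z f = T (F.μ f) := (DFunLike.congr_fun hTμ f).symm
    rw [e, map_add, map_add, hbil hT, hbil' hT,
      hT.eq_zero_on_filt hε1 hZ.map_sq (n := 2) le_rfl h, hZ.map_one] at h1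
    rw [map_sub, h1]
    simp
  have : F.μ f - F.p₁ f - F.p₂ f =
      F.μ f - F.p₁ a - F.p₂ b - F.p₁ (f - a) - F.p₂ (f - b) := by
    rw [map_sub, map_sub]
    abel
  rw [this]
  exact sub_mem (sub_mem h (F.hp₁.map_filt h₁)) (F.hp₂.map_filt h₂)

/-- The Leibniz rule for the convolution with a tangent vector, in leading order. -/
theorem IsTens.leibniz {φ X : Module.Dual k A} {T T₁ : Module.Dual k B} {i p : ZMod 2} {n : ℕ}
    (hφ : F.P.Rep φ) (hφn : ∀ a ∈ F.P.filt (n + 1), φ a = 0) (hX : F.P.IsTangent p X) {f u : A}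
    (hf : f ∈ F.P.gr i) (hfm : f ∈ F.P.m) (hu : u ∈ F.P.filt n)
    (h : F.IsTens φ X T) (h₁ : F.IsTens (φ ∘ₗ LinearMap.mulLeft k f) X T₁) :
    T (F.μ (f * u)) = koszul k i p * T₁ (F.μ u) + X f * φ u := by
  obtain ⟨T₀, h₀, hμ₀⟩ := isTens_ε_right (F := F) hφ
  -- The remainder has order `n + 2`, and `T` kills it because `(n + 1) + 2 ≤ (n + 2) + 1`.
  have hr := F.PB.mul_mem_filt (F.μ_sub_mem hfm) (F.hμ.map_filt hu)
  have e : F.μ (f * u) = F.p₁ f * F.μ u + F.p₂ f * F.μ u +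
      (F.μ f - F.p₁ f - F.p₂ f) * F.μ u := by
    rw [map_mul, sub_mul, sub_mul]
    abel
  rw [e, map_add, map_add, h.apply_p₁_mul hX.map_ne hf h₁, h.apply_p₂_mul hX hf hfm h₀,
    h.eq_zero_on_filt hφn hX.map_sq (by omega) hr, add_zero, ← DFunLike.congr_fun hμ₀ u]
  rfl

end FormalSupergroup

end Super

namespace Super
open AugSuperalgebra

/-! ### Words -/

section Words

variable {ι : Type*} [LinearOrder ι] (p : ι → ZMod 2)

/-- Non-decreasing words in which no odd letter is repeated. -/
def IsCanonical (w : List ι) : Prop := w.Pairwise fun i j => i ≤ j ∧ (p i = 1 → i ≠ j)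

variable {p}

theorem IsCanonical.sublist {v w : List ι} (hw : IsCanonical p w) (h : v.Sublist w) :
    IsCanonical p v := List.Pairwise.sublist h hw

theorem IsCanonical.eq_of_perm {v w : List ι} (hv : IsCanonical p v) (hw : IsCanonical p w)
    (h : v.Perm w) : v = w :=
  List.Perm.eq_of_pairwise (le := (· ≤ ·)) (fun _ _ _ _ h h' => le_antisymm h h')
    (hv.imp fun h => h.1) (hw.imp fun h => h.1) h

theorem eq_cons_of_le_of_mem {s : ι} {v : List ι} (hv : v.Pairwise (· ≤ ·))
    (h : ∀ x ∈ v, s ≤ x) (hs : s ∈ v) : ∃ w, v = s :: w := by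
  cases v with
  | nil => simp at hs
  | cons t v =>
    rcases List.mem_cons.1 hs with rfl | hs
    · exact ⟨v, rfl⟩
    · have := (List.pairwise_cons.1 hv).1 s hs
      rw [le_antisymm this (h t List.mem_cons_self)]
      exact ⟨v, rfl⟩

/-- Equal letters of a sorted word are adjacent, so a failure to be canonical shows up as two
neighbouring equal odd letters. -/
theorem isCanonical_or_exists {v : List ι} (hv : v.Pairwise (· ≤ ·)) :
    IsCanonical p v ∨ ∃ a s b, v = a ++ s :: s :: b ∧ p s = 1 := by
  induction v with
  | nil => exact Or.inl List.Pairwise.nil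
  | cons t v ih =>
    obtain ⟨h1, h2⟩ := List.pairwise_cons.1 hv
    rcases ih h2 with h | ⟨a, s, b, rfl, hs⟩
    · by_cases ht : p t = 1 ∧ t ∈ v
      · obtain ⟨w, rfl⟩ := eq_cons_of_le_of_mem h2 h1 ht.2
        exact Or.inr ⟨[], t, w, rfl, ht.1⟩
      · refine Or.inl (List.pairwise_cons.2 ⟨fun x hx => ⟨h1 x hx, ?_⟩, h⟩)
        rintro hp rfl
        exact ht ⟨hp, hx⟩
    · exact Or.inr ⟨t :: a, s, b, rfl, hs⟩

theorem exists_perm_isCanonical_or (v : List ι) :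
    (∃ w, IsCanonical p w ∧ v.Perm w) ∨ ∃ a s b, v.Perm (a ++ s :: s :: b) ∧ p s = 1 := by
  have hp := List.perm_insertionSort (· ≤ ·) v
  rcases isCanonical_or_exists (p := p) (List.pairwise_insertionSort (· ≤ ·) v) with
    h | ⟨a, s, b, e, hs⟩
  · exact Or.inl ⟨_, h, hp.symm⟩
  · exact Or.inr ⟨a, s, b, e ▸ hp.symm, hs⟩

end Words

namespace FormalSupergroup

variable {k A B : Type u} [Field k] [Ring A] [Algebra k A] [Ring B] [Algebra k B]
  (F : FormalSupergroup k A B)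

/-! ### The convolution product -/

open Classical in
/-- The tensor product of two linear forms, if it exists. -/
noncomputable def tens (φ ψ : Module.Dual k A) : Module.Dual k B :=
  if h : ∃ T, F.IsTens φ ψ T then h.choose else 0

/-- The convolution product. -/
noncomputable def star (φ ψ : Module.Dual k A) : Module.Dual k A :=
  F.tens φ ψ ∘ₗ F.μ.toLinearMap

variable {F} [CharZero k]

theorem IsTens.star_eq {φ ψ : Module.Dual k A} {T : Module.Dual k B} (h : F.IsTens φ ψ T) :
    F.star φ ψ = T ∘ₗ F.μ.toLinearMap := by
  have h' : ∃ T, F.IsTens φ ψ T := ⟨T, h⟩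
  rw [star, tens, dif_pos h', h'.choose_spec.unique h]

theorem rep_star {φ ψ : Module.Dual k A} (hφ : F.P.Rep φ) (hψ : F.P.Rep ψ) :
    F.P.Rep (F.star φ ψ) := by
  obtain ⟨T, hT, h⟩ := exists_isTens hφ hψ
  rwa [hT.star_eq]

theorem star_mem_dist {φ ψ : Module.Dual k A} (h : ∃ T, F.IsTens φ ψ T) :
    F.star φ ψ ∈ F.P.dist := by
  obtain ⟨T, h⟩ := h
  rw [h.star_eq]
  exact h.comp_μ_mem_dist

variable (F) in
/-- A homogeneous basis `X` of the tangent space, with dual elements `f` in `m`. -/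
structure IsTangentBasis {ι : Type*} (p : ι → ZMod 2) (X : ι → Module.Dual k A) (f : ι → A) :
    Prop where
  tangent : ∀ i, F.P.IsTangent (p i) (X i)
  mem_gr : ∀ i, f i ∈ F.P.gr (p i)
  mem_m : ∀ i, f i ∈ F.P.m
  apply_self : ∀ i, X i (f i) = 1
  apply_ne : ∀ i j, i ≠ j → X i (f j) = 0
  le_span : F.P.m ≤ Submodule.span k (Set.range f) ⊔ F.P.filt 2

/-! ### Pairing of monomials in tangent vectors with monomials in dual functions -/

section Monomials

variable {ι : Type*} {p : ι → ZMod 2} {X : ι → Module.Dual k A} {f : ι → A}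

variable (F X) in
/-- The convolution product of the `X i`, in reversed order. -/
noncomputable def mono : List ι → Module.Dual k A
  | [] => F.P.ε.toLinearMap
  | s :: w => F.star (mono w) (X s)

theorem rep_mono (h : F.IsTangentBasis p X f) (w : List ι) : F.P.Rep (F.mono X w) := by
  induction w with
  | nil => exact rep_ε
  | cons s w ih => exact rep_star ih (h.tangent s).rep

/-- Orders of vanishing add under convolution, and a tangent vector contributes one. -/
theorem mono_filt (h : F.IsTangentBasis p X f) (w : List ι) :
    ∀ a ∈ F.P.filt (w.length + 1), F.mono X w a = 0 := by
  induction w with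
  | nil => exact fun a ha => (F.P.mem_m a).1 (F.P.filt_one ▸ ha)
  | cons s w ih =>
    intro a ha
    obtain ⟨T, hT, -⟩ := exists_isTens (rep_mono h w) (h.tangent s).rep
    rw [mono, hT.star_eq]
    exact hT.eq_zero_on_filt ih (h.tangent s).map_sq le_rfl (F.hμ.map_filt ha)

omit [CharZero k] in
theorem prod_mem_filt (h : F.IsTangentBasis p X f) (v : List ι) :
    (v.map f).prod ∈ F.P.filt v.length := by
  induction v with
  | nil => trivial
  | cons s v ih =>
    rw [List.map_cons, List.prod_cons, List.length_cons, add_comm]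
    exact F.P.mul_mem_filt (F.P.filt_one.symm ▸ h.mem_m s) ih

/-- In leading order, convolution with `X s` differentiates the word `v` by the letter `s`. The sign
`σ` is independent of `φ`, so the induction hypothesis can be applied to `φ` composed with
multiplication by a letter. For even `s` the sign must be `1`: repeated letters are even, and their
contributions have to add up to the multiplicity rather than cancel. -/
theorem star_apply_prod [LinearOrder ι] (h : F.IsTangentBasis p X f) (s : ι) {v : List ι}
    (hv : IsCanonical p v) : ∃ σ : k, σ * σ = 1 ∧ (p s = 0 → σ = 1) ∧
      ∀ φ, F.P.Rep φ → (∀ a ∈ F.P.filt v.length, φ a = 0) →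
        F.star φ (X s) (v.map f).prod = σ * (v.count s : k) * φ ((v.erase s).map f).prod := by
  induction v with
  | nil =>
    refine ⟨1, _root_.one_mul 1, fun _ => rfl, fun φ hφ _ => ?_⟩
    obtain ⟨T, hT, -⟩ := exists_isTens hφ (h.tangent s).rep
    have := hT.apply 0 0 1 1 F.P.isSuper.one_mem F.P.isSuper.one_mem
    rw [map_one, map_one, _root_.one_mul, (h.tangent s).map_one, mul_zero, mul_zero] at this
    rw [hT.star_eq, List.map_nil, List.prod_nil, LinearMap.comp_apply, AlgHom.toLinearMap_apply,
      map_one, this, List.count_nil, Nat.cast_zero, mul_zero, zero_mul]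
  | cons t v ih =>
    obtain ⟨h1, h2⟩ := List.pairwise_cons.1 hv
    obtain ⟨σ, hσ, hσ0, ih⟩ := ih h2
    -- The Leibniz rule splits off the first letter; the induction hypothesis is used for the form
    -- `φ (f t * ·)`.
    have key : ∀ φ, F.P.Rep φ → (∀ a ∈ F.P.filt (t :: v).length, φ a = 0) →
        F.star φ (X s) ((t :: v).map f).prod = koszul k (p t) (p s) * (σ * (v.count s : k) *
          φ (f t * ((v.erase s).map f).prod)) + X s (f t) * φ (v.map f).prod := by
      intro φ hφ hφn
      obtain ⟨T, hT, -⟩ := exists_isTens hφ (h.tangent s).rep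
      obtain ⟨T₁, hT₁, -⟩ := exists_isTens (hφ.mulLeft (f t)) (h.tangent s).rep
      have e := ih _ (hφ.mulLeft (f t)) fun a ha => by
        rw [LinearMap.comp_apply, LinearMap.mulLeft_apply]
        refine hφn _ ?_
        rw [List.length_cons, add_comm]
        exact F.P.mul_mem_filt (F.P.filt_one.symm ▸ h.mem_m t) ha
      rw [hT₁.star_eq] at e
      rw [hT.star_eq, List.map_cons, List.prod_cons]
      refine (hT.leibniz hφ hφn (h.tangent s) (h.mem_gr t) (h.mem_m t) (prod_mem_filt h v)
        hT₁).trans ?_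
      congr 2
    by_cases hts : t = s
    · subst hts
      by_cases hv' : t ∈ v
      -- A letter repeated in a canonical word is even, and its second occurrence heads `v`, so both
      -- terms of the Leibniz rule involve the same product.
      · have hp : p t = 0 := by
          rcases parity_cases (p t) with h0 | h0
          · exact h0
          · exact absurd rfl ((h1 t hv').2 h0)
        obtain ⟨w, rfl⟩ := eq_cons_of_le_of_mem (h2.imp fun h => h.1) (fun x hx => (h1 x hx).1) hv'
        refine ⟨1, _root_.one_mul 1, fun _ => rfl, fun φ hφ hφn => ?_⟩
        rw [key φ hφ hφn, hσ0 hp, hp, koszul_zero_left, List.erase_cons_head, List.erase_cons_head,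
          h.apply_self, List.count_cons_self (a := t) (l := t :: w), List.map_cons, List.prod_cons]
        push_cast
        ring
      · refine ⟨1, _root_.one_mul 1, fun _ => rfl, fun φ hφ hφn => ?_⟩
        rw [key φ hφ hφn, h.apply_self, List.erase_cons_head, List.count_cons_self,
          List.count_eq_zero_of_not_mem hv']
        simp
    · refine ⟨koszul k (p t) (p s) * σ, ?_, fun h0 => ?_, fun φ hφ hφn => ?_⟩
      · rw [mul_mul_mul_comm, koszul_mul_self, hσ, _root_.one_mul]
      · rw [h0, koszul_zero_right, hσ0 h0, _root_.one_mul]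
      · rw [key φ hφ hφn, h.apply_ne s t (Ne.symm hts), List.erase_cons_tail (by simpa using hts),
          List.count_cons_of_ne hts, List.map_cons, List.prod_cons]
        ring

/-- Removing the letters of `w` one by one multiplies the value by a sign and by the current
multiplicity, which is nonzero in characteristic zero; a letter missing from `v` gives zero. So the
pairing on canonical words of one length is diagonal and invertible. -/
theorem mono_apply_prod [LinearOrder ι] (h : F.IsTangentBasis p X f) (w : List ι) :
    ∀ {v : List ι}, IsCanonical p v → w.length = v.length →
      (F.mono X w (v.map f).prod ≠ 0 ↔ w.Perm v) := by
  induction w with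
  | nil =>
    intro v _ hl
    obtain rfl := List.length_eq_zero_iff.1 hl.symm
    simp [mono]
  | cons s w ih =>
    intro v hv hl
    obtain ⟨σ, hσ, -, e⟩ := star_apply_prod h s hv
    have hσ0 : σ ≠ 0 := fun h0 => zero_ne_one (α := k) (by rw [← hσ, h0, mul_zero])
    rw [mono, e _ (rep_mono h w) (hl ▸ mono_filt h w)]
    by_cases hs : s ∈ v
    · rw [List.cons_perm_iff_perm_erase, ← ih (hv.sublist List.erase_sublist)
        (by rw [List.length_erase_of_mem hs, ← hl, List.length_cons, Nat.add_sub_cancel])]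
      have hc : (v.count s : k) ≠ 0 := Nat.cast_ne_zero.2 (List.count_pos_iff.2 hs).ne'
      simp [hσ0, hc, hs]
    · rw [List.count_eq_zero_of_not_mem hs]
      simp only [Nat.cast_zero, mul_zero, zero_mul, ne_eq, not_true_eq_false, false_iff]
      exact fun hp => hs (hp.subset List.mem_cons_self)

omit [CharZero k] in
theorem prod_eq_smul_of_perm (h : F.IsTangentBasis p X f) {v w : List ι} (hvw : v.Perm w) :
    ∃ σ : k, (v.map f).prod = σ • (w.map f).prod := by
  induction hvw with
  | nil => exact ⟨1, (one_smul _ _).symm⟩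
  | cons s _ ih =>
    obtain ⟨σ, e⟩ := ih
    refine ⟨σ, ?_⟩
    rw [List.map_cons, List.prod_cons, e, mul_smul_comm, List.map_cons, List.prod_cons]
  | swap s t w =>
    refine ⟨koszul k (p t) (p s), ?_⟩
    simp only [List.map_cons, List.prod_cons]
    rw [← mul_assoc, F.P.comm (h.mem_gr t) (h.mem_gr s), smul_mul_assoc, mul_assoc]
  | trans _ _ ih ih' =>
    obtain ⟨σ, e⟩ := ih
    obtain ⟨τ, e'⟩ := ih'
    exact ⟨σ * τ, by rw [e, e', smul_smul]⟩

/-- Sorting costs only signs, and a product with a repeated odd letter is zero. -/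
theorem prod_mem_span [LinearOrder ι] (h : F.IsTangentBasis p X f) (v : List ι) :
    (v.map f).prod ∈ Submodule.span k
      {x | ∃ w : List ι, IsCanonical p w ∧ w.length = v.length ∧ x = (w.map f).prod} := by
  rcases exists_perm_isCanonical_or (p := p) v with ⟨w, hw, hp⟩ | ⟨a, s, b, hp, hs⟩
  · obtain ⟨σ, e⟩ := prod_eq_smul_of_perm h hp
    rw [e]
    exact Submodule.smul_mem _ _ (Submodule.subset_span ⟨w, hw, hp.length_eq.symm, rfl⟩)
  · obtain ⟨σ, e⟩ := prod_eq_smul_of_perm h hp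
    rw [e, List.map_append, List.prod_append, List.map_cons, List.map_cons, List.prod_cons,
      List.prod_cons, ← mul_assoc (f s), F.P.mul_self_of_odd (hs ▸ h.mem_gr s), zero_mul, mul_zero,
      smul_zero]
    exact zero_mem _

theorem filt_le_span_prod [LinearOrder ι] (h : F.IsTangentBasis p X f) (n : ℕ) :
    F.P.filt n ≤ Submodule.span k
      {x | ∃ w : List ι, IsCanonical p w ∧ w.length = n ∧ x = (w.map f).prod} ⊔
        F.P.filt (n + 1) := by
  have key : F.P.filt n ≤ Submodule.span k
      {x | ∃ w : List ι, w.length = n ∧ x = (w.map f).prod} ⊔ F.P.filt (n + 1) := by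
    induction n with
    | zero =>
      intro b _
      rw [← sub_add_cancel b (algebraMap k A (F.P.ε b))]
      refine add_mem (Submodule.mem_sup_right (F.P.filt_one.symm ▸ F.P.sub_ε_mem b))
        (Submodule.mem_sup_left ?_)
      rw [Algebra.algebraMap_eq_smul_one]
      exact Submodule.smul_mem _ _ (Submodule.subset_span ⟨[], rfl, rfl⟩)
    | succ n ih =>
      rw [← F.P.m_mul_filt n]
      refine Submodule.mul_le.2 fun x hx y hy => ?_
      obtain ⟨x₁, hx₁, x₂, hx₂, rfl⟩ := Submodule.mem_sup.1 (h.le_span hx)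
      obtain ⟨y₁, hy₁, y₂, hy₂, rfl⟩ := Submodule.mem_sup.1 (ih hy)
      have hy₁' : y₁ ∈ F.P.filt n := by
        refine Submodule.span_le.2 ?_ hy₁
        rintro _ ⟨w, rfl, rfl⟩
        exact prod_mem_filt h w
      have hx₁' : x₁ ∈ F.P.filt 1 := by
        refine Submodule.span_le.2 ?_ hx₁
        rintro _ ⟨i, rfl⟩
        exact F.P.filt_one.symm ▸ h.mem_m i
      rw [mul_add, add_mul, add_mul, add_assoc (x₁ * y₁)]
      refine add_mem (Submodule.mem_sup_left ?_)
        (Submodule.mem_sup_right (add_mem ?_ (add_mem ?_ ?_)))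
      · have := Submodule.mul_mem_mul hx₁ hy₁
        rw [Submodule.span_mul_span] at this
        refine Submodule.span_mono ?_ this
        rintro _ ⟨_, ⟨i, rfl⟩, _, ⟨w, rfl, rfl⟩, rfl⟩
        exact ⟨i :: w, rfl, by simp⟩
      · have := F.P.mul_mem_filt hx₂ hy₁'
        rwa [add_comm 2 n] at this
      · have := F.P.mul_mem_filt hx₁' hy₂
        rwa [add_comm 1] at this
      · have := F.P.mul_mem_filt (F.P.filt_succ_le 1 hx₂) hy₂
        rwa [add_comm 1] at this
  refine key.trans (sup_le_sup_right (Submodule.span_le.2 ?_) _)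
  rintro _ ⟨w, rfl, rfl⟩
  exact prod_mem_span h w

/-- Induction on the order of vanishing. The diagonal pairing yields a combination `χ` of monomials
of length `n` with the values of `φ` on all canonical products of that length; these span `m ^ n`
modulo `m ^ (n + 1)`, so `φ - χ` already vanishes on `m ^ n`. -/
theorem dist_le_span_mono [LinearOrder ι] [Finite ι] (h : F.IsTangentBasis p X f) :
    F.P.dist ≤ Submodule.span k {φ | ∃ w : List ι, IsCanonical p w ∧ φ = F.mono X w} := by
  classical
  intro φ hφ
  obtain ⟨n, hn⟩ := F.P.mem_dist.1 hφ
  clear hφ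
  induction n generalizing φ with
  | zero =>
    have : φ = 0 := LinearMap.ext fun a => hn a trivial
    rw [this]
    exact zero_mem _
  | succ n ih =>
    set W := (List.finite_length_eq ι n).toFinset.filter (IsCanonical p) with hW
    have hWmem : ∀ w, w ∈ W ↔ w.length = n ∧ IsCanonical p w := by
      intro w
      rw [hW, Finset.mem_filter, Set.Finite.mem_toFinset]
      rfl
    set χ := ∑ w ∈ W, (φ (w.map f).prod / F.mono X w (w.map f).prod) • F.mono X w with hχ
    have hχn : ∀ a ∈ F.P.filt (n + 1), χ a = 0 := by
      intro a ha
      rw [hχ, LinearMap.sum_apply]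
      refine Finset.sum_eq_zero fun w hw => ?_
      rw [LinearMap.smul_apply, mono_filt h w a (((hWmem w).1 hw).1.symm ▸ ha), smul_zero]
    have hχv : ∀ v, IsCanonical p v → v.length = n → χ (v.map f).prod = φ (v.map f).prod := by
      intro v hv hvn
      have hvW : v ∈ W := (hWmem v).2 ⟨hvn, hv⟩
      rw [hχ, LinearMap.sum_apply, Finset.sum_eq_single_of_mem v hvW]
      · rw [LinearMap.smul_apply, smul_eq_mul,
          div_mul_cancel₀ _ ((mono_apply_prod h v hv rfl).2 (List.Perm.refl v))]
      · intro w hw hwv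
        obtain ⟨hwn, hwc⟩ := (hWmem w).1 hw
        rw [LinearMap.smul_apply]
        by_contra hne
        have := (mono_apply_prod h w hv (hwn.trans hvn.symm)).1 fun h0 => hne (by
          rw [h0, smul_zero])
        exact hwv (hwc.eq_of_perm hv this)
    rw [← sub_add_cancel φ χ]
    refine add_mem (ih (φ := φ - χ) fun a ha => ?_) (Submodule.sum_mem _ fun w hw =>
      Submodule.smul_mem _ _ (Submodule.subset_span ⟨w, ((hWmem w).1 hw).2, rfl⟩))
    obtain ⟨x, hx, y, hy, rfl⟩ := Submodule.mem_sup.1 (filt_le_span_prod h n ha)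
    rw [LinearMap.sub_apply, map_add, map_add, hn y hy, hχn y hy, add_zero, add_zero]
    refine (Submodule.span_le (p := LinearMap.ker (φ - χ))).2 ?_ hx
    rintro _ ⟨v, hv, hvn, rfl⟩
    exact sub_eq_zero.2 (hχv v hv hvn).symm

/-- Evaluate a relation on the product of a longest word `v` in it: shorter monomials vanish there
by order, and other words of the same length by the diagonal pairing. -/
theorem mono_independent [LinearOrder ι] (h : F.IsTangentBasis p X f) (c : List ι →₀ k)
    (hc : ∀ w ∈ c.support, IsCanonical p w) (h0 : c.sum (fun w r => r • F.mono X w) = 0) :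
    c = 0 := by
  by_contra hne
  obtain ⟨v, hv, hmax⟩ := Finset.exists_max_image c.support List.length
    (Finsupp.support_nonempty_iff.2 hne)
  have e := DFunLike.congr_fun h0 (v.map f).prod
  rw [Finsupp.sum, LinearMap.sum_apply, Finset.sum_eq_single_of_mem v hv, LinearMap.smul_apply,
    LinearMap.zero_apply, smul_eq_mul, mul_eq_zero] at e
  · exact e.elim (Finsupp.mem_support_iff.1 hv)
      ((mono_apply_prod h v (hc v hv) rfl).2 (List.Perm.refl v))
  · intro w hw hwv
    rw [LinearMap.smul_apply]
    rcases (hmax w hw).lt_or_eq with hlt | heq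
    · rw [mono_filt h w _ (F.P.filt_antitone hlt (prod_mem_filt h v)), smul_zero]
    · by_contra h1
      have := (mono_apply_prod h w (hc v hv) heq).1 fun h0 => h1 (by rw [h0, smul_zero])
      exact hwv ((hc w hw).eq_of_perm (hc v hv) this)

end Monomials

end FormalSupergroup

end Super

namespace Super
open AugSuperalgebra

/-! ### Homogeneous bases -/

theorem injective_of_ker {k V W : Type*} [Field k] [AddCommGroup V] [Module k V] [AddCommGroup W]
    [Module k W] (f : V →ₗ[k] W) (h : ∀ x, f x = 0 → x = 0) : Function.Injective f :=
  (injective_iff_map_eq_zero f).2 h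

/-- A finite-dimensional graded vector space has a homogeneous basis. -/
theorem exists_homogeneous_basis {k V : Type*} [Field k] [AddCommGroup V] [Module k V]
    [Module.Finite k V] {gr : ZMod 2 → Submodule k V} (h : IsCompl (gr 0) (gr 1)) :
    ∃ (n : ℕ) (p : Fin n → ZMod 2) (b : Module.Basis (Fin n) k V), ∀ i, b i ∈ gr (p i) := by
  let b₀ := Module.finBasis k (gr 0)
  let b₁ := Module.finBasis k (gr 1)
  let b' := (b₀.prod b₁).map (Submodule.prodEquivOfIsCompl _ _ h)
  let p' : Fin _ ⊕ Fin _ → ZMod 2 := Sum.elim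
    (fun _ : Fin (Module.finrank k (gr 0)) => 0) (fun _ : Fin (Module.finrank k (gr 1)) => 1)
  have hb' : ∀ i, b' i ∈ gr (p' i) := by
    rintro (i | i)
    · simp [b', p']
    · simp [b', p']
  refine ⟨_, p' ∘ finSumFinEquiv.symm, b'.reindex finSumFinEquiv, fun i => ?_⟩
  rw [Module.Basis.reindex_apply]
  exact hb' _

namespace AugSuperalgebra

variable {k A : Type u} [Field k] [Ring A] [Algebra k A] (P : AugSuperalgebra k A)

/-- The tangent space. -/
def tangent : Submodule k (Module.Dual k A) where
  carrier := {φ | φ 1 = 0 ∧ ∀ a ∈ P.m ^ 2, φ a = 0}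
  zero_mem' := ⟨rfl, fun _ _ => rfl⟩
  add_mem' := fun {φ ψ} hφ hψ =>
    ⟨by simp [hφ.1, hψ.1], fun a ha => by simp [hφ.2 a ha, hψ.2 a ha]⟩
  smul_mem' := fun c φ hφ => ⟨by simp [hφ.1], fun a ha => by simp [hφ.2 a ha]⟩

/-- The grading of a space of linear forms. -/
def dualGr (E : Submodule k (Module.Dual k A)) (i : ZMod 2) : Submodule k E where
  carrier := {φ | ∀ j, j ≠ i → ∀ a ∈ P.gr j, φ.1 a = 0}
  zero_mem' := fun _ _ _ _ => rfl
  add_mem' := fun {φ ψ} hφ hψ j hj a ha => by simp [hφ j hj a ha, hψ j hj a ha]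
  smul_mem' := fun c φ hφ j hj a ha => by simp [hφ j hj a ha]

variable {P}

/-- The components of a form are its composites with the two parity projections of `A`. -/
theorem isCompl_dualGr {E : Submodule k (Module.Dual k A)}
    (hE : ∀ φ ∈ E, ∀ i, φ ∘ₗ component P.isSuper.isCompl i ∈ E) :
    IsCompl (P.dualGr E 0) (P.dualGr E 1) := by
  have hmem : ∀ (φ : E) (i : ZMod 2),
      (⟨φ.1 ∘ₗ component P.isSuper.isCompl i, hE _ φ.2 i⟩ : E) ∈ P.dualGr E i :=
    fun φ i j hj a ha => by
      change φ.1 (component P.isSuper.isCompl i a) = 0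
      rw [component_of_mem_ne _ hj ha, map_zero]
  refine IsCompl.of_eq ?_ ?_
  · refine (Submodule.eq_bot_iff _).2 fun φ hφ => ?_
    obtain ⟨h0, h1⟩ := Submodule.mem_inf.1 hφ
    refine Subtype.ext (linearMap_ext_homogeneous P.isSuper.isCompl fun i a ha => ?_)
    rcases parity_cases i with rfl | rfl
    · exact h1 0 (by decide) a ha
    · exact h0 1 (by decide) a ha
  · refine Submodule.eq_top_iff'.2 fun φ => Submodule.mem_sup.2
      ⟨_, hmem φ 0, _, hmem φ 1, Subtype.ext (LinearMap.ext fun a => ?_)⟩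
    change φ.1 (component P.isSuper.isCompl 0 a) + φ.1 (component P.isSuper.isCompl 1 a) = φ.1 a
    rw [← map_add, component_add]

variable [CharZero k]

theorem isCompl_dist : IsCompl (P.dualGr P.dist 0) (P.dualGr P.dist 1) :=
  isCompl_dualGr fun φ hφ i => by
    obtain ⟨n, hn⟩ := P.mem_dist.1 hφ
    exact P.mem_dist.2 ⟨n, fun a ha => hn _ (P.component_mem_filt i ha)⟩

theorem isCompl_tangent : IsCompl (P.dualGr P.tangent 0) (P.dualGr P.tangent 1) :=
  isCompl_dualGr fun φ hφ i => by
    refine ⟨?_, fun a ha => hφ.2 _ (P.component_mem_filt (n := 2) i ha)⟩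
    rcases parity_cases i with rfl | rfl
    · rw [LinearMap.comp_apply, component_of_mem _ P.isSuper.one_mem, hφ.1]
    · rw [LinearMap.comp_apply, component_of_mem_ne _ (by decide) P.isSuper.one_mem, map_zero]

omit [CharZero k] in
theorem isTangent_of_mem {i : ZMod 2} {φ : P.tangent} (h : φ ∈ P.dualGr P.tangent i) :
    P.IsTangent i φ.1 := ⟨φ.2.1, φ.2.2, h⟩

-- A tangent vector kills `1` and `m²`, so it is determined by its values on `s`.
omit [CharZero k] in
theorem finite_tangent {s : Finset A} (hs : P.m ≤ Submodule.span k s ⊔ P.filt 2) :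
    Module.Finite k P.tangent := by
  let r : P.tangent →ₗ[k] (s → k) :=
    LinearMap.pi fun a => (LinearMap.applyₗ a.1) ∘ₗ P.tangent.subtype
  refine Module.Finite.of_injective r (injective_of_ker (V := P.tangent) r fun φ hφ => ?_)
  refine Subtype.ext (LinearMap.ext fun a => ?_)
  have h0 : ∀ x ∈ P.m, φ.1 x = 0 := by
    intro x hx
    obtain ⟨y, hy, z, hz, rfl⟩ := Submodule.mem_sup.1 (hs hx)
    rw [map_add, φ.2.2 z hz, add_zero]
    refine (Submodule.span_le (p := LinearMap.ker φ.1)).2 (fun x hx => ?_) hy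
    exact congrFun hφ ⟨x, hx⟩
  rw [← sub_add_cancel a (algebraMap k A (P.ε a)), map_add, h0 _ (P.sub_ε_mem a),
    Algebra.algebraMap_eq_smul_one, map_smul, φ.2.1, smul_zero, add_zero]
  rfl

omit [CharZero k] in
/-- Linearly independent linear forms have a dual family. -/
theorem exists_dual_family {n : ℕ} {X : Fin n → Module.Dual k A} (hX : LinearIndependent k X) :
    ∃ f : Fin n → A, ∀ i j, X i (f j) = if i = j then 1 else 0 := by
  let r : A →ₗ[k] (Fin n → k) := LinearMap.pi X
  have hr : LinearMap.range r = ⊤ := by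
    by_contra h
    obtain ⟨v, -, hv⟩ := SetLike.exists_of_lt (lt_top_iff_ne_top.2 h)
    -- A linear form on `k ^ n` that kills the image of `r` is a linear relation between the `X i`.
    obtain ⟨l, hlv, hl⟩ := Submodule.exists_le_ker_of_notMem hv
    have h0 : ∀ i, l (Pi.single i 1) = 0 := by
      refine Fintype.linearIndependent_iff.1 hX _ (LinearMap.ext fun a => ?_)
      have : l (r a) = 0 := hl ⟨a, rfl⟩
      rw [← (Pi.basisFun k (Fin n)).sum_repr (r a), map_sum] at this
      rw [LinearMap.sum_apply, LinearMap.zero_apply, ← this]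
      refine Finset.sum_congr rfl fun i _ => ?_
      simp [r, mul_comm]
    apply hlv
    rw [← (Pi.basisFun k (Fin n)).sum_repr v, map_sum]
    exact Finset.sum_eq_zero fun i _ => by simp [h0]
  choose f hf using fun j => LinearMap.range_eq_top.1 hr (Pi.single j 1)
  refine ⟨f, fun i j => ?_⟩
  have := congrFun (hf j) i
  rw [Pi.single_apply] at this
  exact this

end AugSuperalgebra

namespace FormalSupergroup

variable {k A B : Type u} [Field k] [Ring A] [Algebra k A] [Ring B] [Algebra k B]
  {F : FormalSupergroup k A B} [CharZero k]

/-- Passing from a dual family to its components of parity `p j` and subtracting constants leaves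
the pairing unchanged, since the `X i` are homogeneous and kill `1`. The dual functions span modulo
`m²` because `u - ∑ X j (u) f j` is killed by every tangent vector. -/
theorem exists_isTangentBasis {s : Finset A} (hs : F.P.m ≤ Submodule.span k s ⊔ F.P.filt 2) :
    ∃ (n : ℕ) (p : Fin n → ZMod 2) (b : Module.Basis (Fin n) k F.P.tangent) (f : Fin n → A),
      F.IsTangentBasis p (fun i => (b i).1) f := by
  have := finite_tangent hs
  have h := F.P.isCompl_tangent
  obtain ⟨n, p, b, hb⟩ := exists_homogeneous_basis (V := F.P.tangent) h
  replace hb : ∀ i, F.P.IsTangent (p i) (b i).1 := fun i => isTangent_of_mem (hb i)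
  have hli : LinearIndependent k fun i => (b i).1 :=
    b.linearIndependent.map' F.P.tangent.subtype (Submodule.ker_subtype _)
  obtain ⟨f', hf'⟩ := exists_dual_family hli
  have hmem : ∀ j, component F.P.isSuper.isCompl (p j) (f' j) -
      algebraMap k A (F.P.ε (component F.P.isSuper.isCompl (p j) (f' j))) ∈ F.P.gr (p j) := by
    intro j
    refine sub_mem (component_mem _ _ _) ?_
    by_cases hj : p j = 0
    · rw [hj]
      exact F.P.algebraMap_mem _
    · rw [F.P.ε_of_ne hj (component_mem _ _ _), map_zero]
      exact zero_mem _
  have happ : ∀ i j, (b i).1 (component F.P.isSuper.isCompl (p j) (f' j) -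
      algebraMap k A (F.P.ε (component F.P.isSuper.isCompl (p j) (f' j)))) =
        if i = j then 1 else 0 := by
    intro i j
    rw [map_sub, Algebra.algebraMap_eq_smul_one, map_smul, (hb i).map_one, smul_zero, sub_zero,
      ← hf' i j]
    by_cases hij : p i = p j
    · conv_rhs => rw [← component_add F.P.isSuper.isCompl (f' j), map_add]
      rcases parity_cases (p j) with h0 | h0
      · rw [h0, (hb i).map_ne 1 (by rw [hij, h0]; decide) _ (component_mem _ _ _), add_zero]
      · rw [h0, (hb i).map_ne 0 (by rw [hij, h0]; decide) _ (component_mem _ _ _), zero_add]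
    · rw [(hb i).map_ne _ (Ne.symm hij) _ (component_mem _ _ _), hf',
        if_neg fun h => hij (congrArg p h)]
  refine ⟨_, p, b, _, ⟨hb, hmem, fun j => F.P.sub_ε_mem _, fun i => by rw [happ, if_pos rfl],
    fun i j hij => by rw [happ, if_neg hij], ?_⟩⟩
  intro u hu
  set f := fun j => component F.P.isSuper.isCompl (p j) (f' j) -
      algebraMap k A (F.P.ε (component F.P.isSuper.isCompl (p j) (f' j)))
  have hfm : ∀ j, f j ∈ F.P.m := fun j => F.P.sub_ε_mem _
  set y := ∑ j, (b j).1 u • f j with hy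
  have hym : y ∈ F.P.m := Submodule.sum_mem _ fun j _ => Submodule.smul_mem _ _ (hfm j)
  rw [← add_sub_cancel y u]
  refine add_mem (Submodule.mem_sup_left (Submodule.sum_mem _ fun j _ => Submodule.smul_mem _ _
    (Submodule.subset_span ⟨j, rfl⟩))) (Submodule.mem_sup_right ?_)
  by_contra hne
  obtain ⟨i, Z, hZ, -, hZu⟩ := exists_tangent (P := F.P) le_rfl
    (by rw [← F.P.filt_one]; exact F.P.filt_succ_le 1)
    (fun a ha => (F.P.isHom_twist 1).map_filt ha) (sub_mem hu hym) hne
  apply hZu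
  have hZ' : Z = ((⟨Z, hZ.map_one, hZ.map_sq⟩ : F.P.tangent) : Module.Dual k A) := rfl
  rw [hZ', ← b.sum_repr ⟨Z, hZ.map_one, hZ.map_sq⟩]
  simp only [Submodule.coe_sum, Submodule.coe_smul, LinearMap.sum_apply, LinearMap.smul_apply]
  refine Finset.sum_eq_zero fun i _ => ?_
  have : (b i).1 y = (b i).1 u := by
    rw [hy, map_sum, Finset.sum_eq_single_of_mem i (Finset.mem_univ i)]
    · rw [map_smul, happ, if_pos rfl, smul_eq_mul, _root_.mul_one]
    · intro j _ hj
      rw [map_smul, happ, if_neg (Ne.symm hj), smul_zero]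
  rw [map_sub, this, sub_self, smul_zero]

end FormalSupergroup

end Super

namespace Super

/-! ### The Lie superalgebra of a superalgebra -/

section Supercommutator

variable {k V g : Type u} [Field k] [AddCommGroup V] [Module k V] [AddCommGroup g] [Module k g]
  {gr : ZMod 2 → Submodule k V} {mul : V →ₗ[k] V →ₗ[k] V} {one : V}

theorem exists_supercommutator (h : IsSuperalgebraProduct gr mul one) :
    ∃ B : V →ₗ[k] V →ₗ[k] V, ∀ {i j x y}, x ∈ gr i → y ∈ gr j →
      B x y = mul x y - koszul k i j • mul y x := by
  -- The sign differs from that of the ordinary commutator only on odd pairs: the bilinear form is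
  -- `x y - y x + 2 y₁ x₁`, with odd components `x₁` and `y₁`.
  refine ⟨mul - mul.flip + (2 : k) • (mul.flip.compl₁₂ (component h.isCompl 1)
    (component h.isCompl 1)), fun {i j x y} hx hy => ?_⟩
  simp only [LinearMap.add_apply, LinearMap.sub_apply, LinearMap.smul_apply, LinearMap.flip_apply,
    LinearMap.compl₁₂_apply]
  rcases parity_cases i with rfl | rfl
  · rw [component_of_mem_ne h.isCompl (by decide) hx, map_zero, koszul_zero_left]
    module
  · rcases parity_cases j with rfl | rfl
    · rw [component_of_mem_ne h.isCompl (by decide) hy, map_zero, LinearMap.zero_apply,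
        koszul_zero_right]
      module
    · rw [component_of_mem h.isCompl hx, component_of_mem h.isCompl hy, koszul_one_one]
      module

/-- Injectivity of `incl` makes the chosen brackets bilinear and moves skewness and the Jacobi
identity into the associative algebra, where they are computations with homogeneous elements. -/
theorem exists_lieSuperalgebra (h : IsSuperalgebraProduct gr mul one) (incl : g →ₗ[k] V)
    (hincl : Function.Injective incl) {grg : ZMod 2 → Submodule k g}
    (hc : IsCompl (grg 0) (grg 1)) (hgr : ∀ i x, x ∈ grg i ↔ incl x ∈ gr i)
    (hmem : ∀ {i j x y}, x ∈ grg i → y ∈ grg j →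
      ∃ z, incl z = mul (incl x) (incl y) - koszul k i j • mul (incl y) (incl x)) :
    ∃ L : LieSuperalgebra k g, L.gr = grg ∧ ∀ {i j x y}, x ∈ grg i → y ∈ grg j →
      incl (L.bracket x y) = mul (incl x) (incl y) - koszul k i j • mul (incl y) (incl x) := by
  obtain ⟨B, hB⟩ := exists_supercommutator h
  have hex : ∀ x y : g, ∃ z, incl z = B (incl x) (incl y) := by
    intro x y
    refine homogeneous_induction hc (p := fun x => ∃ z, incl z = B (incl x) (incl y))
      (fun i x hx => ?_) ?_ x
    · refine homogeneous_induction hc (p := fun y => ∃ z, incl z = B (incl x) (incl y))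
        (fun j y hy => ?_) ?_ y
      · rw [hB ((hgr i x).1 hx) ((hgr j y).1 hy)]
        exact hmem hx hy
      · rintro y y' ⟨z, hz⟩ ⟨z', hz'⟩
        exact ⟨z + z', by rw [map_add, map_add, map_add, hz, hz']⟩
    · rintro x x' ⟨z, hz⟩ ⟨z', hz'⟩
      exact ⟨z + z', by rw [map_add, map_add, map_add, LinearMap.add_apply, hz, hz']⟩
  choose c hc' using hex
  let br : g →ₗ[k] g →ₗ[k] g := LinearMap.mk₂ k c
    (fun x x' y => hincl (by rw [map_add, hc', hc', hc', map_add, map_add, LinearMap.add_apply]))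
    (fun r x y => hincl (by rw [map_smul, hc', hc', map_smul, map_smul, LinearMap.smul_apply]))
    (fun x y y' => hincl (by rw [map_add, hc', hc', hc', map_add, map_add]))
    (fun r x y => hincl (by rw [map_smul, hc', hc', map_smul, map_smul]))
  have hbr : ∀ {i j x y}, x ∈ grg i → y ∈ grg j →
      incl (br x y) = mul (incl x) (incl y) - koszul k i j • mul (incl y) (incl x) :=
    fun {i j x y} hx hy => (hc' x y).trans (hB ((hgr i x).1 hx) ((hgr j y).1 hy))
  have hbm : ∀ {i j : ZMod 2} {x y : g}, x ∈ grg i → y ∈ grg j → br x y ∈ grg (i + j) := by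
    intro i j x y hx hy
    rw [hgr, hbr hx hy]
    exact sub_mem (h.mul_mem ((hgr i x).1 hx) ((hgr j y).1 hy)) (Submodule.smul_mem _ _
      (add_comm j i ▸ h.mul_mem ((hgr j y).1 hy) ((hgr i x).1 hx)))
  refine ⟨⟨grg, hc, br, hbm, fun {i j x y} hx hy => hincl ?_, fun {i j x y} z hx hy => ?_⟩, rfl,
    hbr⟩
  · rw [map_neg, map_smul, hbr hx hy, hbr hy hx, koszul_comm k j i, smul_sub, smul_smul,
      koszul_mul_self]
    module
  · refine homogeneous_induction hc (p := fun z => br x (br y z) =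
      br (br x y) z + koszul k i j • br y (br x z)) (fun l z hz => hincl ?_) ?_ z
    · rw [map_add, map_smul, hbr hx (hbm hy hz), hbr (hbm hx hy) hz, hbr hy (hbm hx hz),
        hbr hx hy, hbr hy hz, hbr hx hz]
      simp only [map_sub, map_smul, LinearMap.sub_apply, LinearMap.smul_apply, h.mul_assoc,
        koszul_add_left, koszul_add_right]
      rcases parity_cases i with rfl | rfl <;> rcases parity_cases j with rfl | rfl <;>
        rcases parity_cases l with rfl | rfl <;> simp <;> abel
    · intro z z' hz hz'
      simp only [map_add, hz, hz']
      module

end Supercommutator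

/-- For odd `x` the defining relation reads `x² = -x² + [x, x]`; this solves it for `x²`. -/
theorem eq_inv_smul_of_eq_neg {k V : Type*} [Field k] [CharZero k] [AddCommGroup V] [Module k V]
    {x y : V} (h : x = (-1 : k) • x + y) : x = (2⁻¹ : k) • y := by
  rw [eq_inv_smul_iff₀ two_ne_zero, two_smul]
  nth_rewrite 1 [h]
  module

/-! ### Words in the enveloping superalgebra -/

namespace LieSuperalgebra

variable {k g : Type u} [Field k] [AddCommGroup g] [Module k g] (L : LieSuperalgebra k g)

theorem ι_mul_ι {i j : ZMod 2} {x y : g} (hx : x ∈ L.gr i) (hy : y ∈ L.gr j) :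
    L.ι x * L.ι y = koszul k i j • (L.ι y * L.ι x) + L.ι (L.bracket x y) := by
  have h := RingQuot.mkAlgHom_rel k (Rel.of (L := L) hx hy)
  rw [map_sub, map_smul, map_mul, map_mul] at h
  rw [← sub_eq_iff_eq_add']
  exact h

theorem enveloping_induction {p : L.Enveloping → Prop} (algebraMap : ∀ c, p (algebraMap k _ c))
    (ι : ∀ x, p (L.ι x)) (add : ∀ u v, p u → p v → p (u + v)) (mul : ∀ u v, p u → p v → p (u * v))
    (u : L.Enveloping) : p u := by
  obtain ⟨t, rfl⟩ := RingQuot.mkAlgHom_surjective k L.Rel u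
  induction t using TensorAlgebra.induction with
  | algebraMap r => rw [AlgHom.commutes]; exact algebraMap r
  | ι x => exact ι x
  | mul a b ha hb => rw [map_mul]; exact mul _ _ ha hb
  | add a b ha hb => rw [map_add]; exact add _ _ ha hb

variable {ι' : Type*} (X : ι' → g)

/-- The product of the `X i`, in reversed order. -/
noncomputable def word : List ι' → L.Enveloping
  | [] => 1
  | s :: w => word w * L.ι (X s)

/-- The span of the words of length less than `n`. -/
noncomputable def wordFilt (n : ℕ) : Submodule k L.Enveloping :=
  Submodule.span k {u | ∃ w : List ι', w.length < n ∧ u = L.word X w}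

variable {L X}

theorem wordFilt_mul {n : ℕ} {u : L.Enveloping} (hu : u ∈ L.wordFilt X n) (s : ι') :
    u * L.ι (X s) ∈ L.wordFilt X (n + 1) := by
  refine (Submodule.span_le (p := (L.wordFilt X (n + 1)).comap
    (LinearMap.mulRight k (L.ι (X s))))).2 ?_ hu
  rintro _ ⟨w, hw, rfl⟩
  exact Submodule.subset_span ⟨s :: w, by simpa using hw, rfl⟩

theorem word_mul_ι_mem (hX : Submodule.span k (Set.range X) = ⊤) (w : List ι') (x : g) :
    L.word X w * L.ι x ∈ L.wordFilt X (w.length + 2) := by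
  have hx : x ∈ Submodule.span k (Set.range X) := hX ▸ trivial
  refine (Submodule.span_le (p := (L.wordFilt X (w.length + 2)).comap
    (LinearMap.mulLeft k (L.word X w) ∘ₗ L.ι))).2 ?_ hx
  rintro _ ⟨s, rfl⟩
  exact Submodule.subset_span ⟨s :: w, by simp, rfl⟩

/-- Words are multiplied in reversed order, so putting `a` in front means multiplying on the right
by its letters. -/
theorem word_append_mem {n : ℕ} {b : List ι'} (hb : L.word X b ∈ L.wordFilt X n) (a : List ι') :
    L.word X (a ++ b) ∈ L.wordFilt X (a.length + n) := by
  induction a with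
  | nil => rwa [List.nil_append, List.length_nil, zero_add]
  | cons s a ih =>
    have := wordFilt_mul ih s
    rwa [add_right_comm] at this

variable {p : ι' → ZMod 2}

/-- Exchanging two neighbouring letters costs a sign and a term with their bracket, which is a
combination of words shorter by one. -/
theorem exists_smul_word_of_perm (hX : Submodule.span k (Set.range X) = ⊤)
    (hp : ∀ s, X s ∈ L.gr (p s)) {v w : List ι'} (h : v.Perm w) :
    ∃ σ : k, L.word X v - σ • L.word X w ∈ L.wordFilt X v.length := by
  induction h with
  | nil => exact ⟨1, by simp⟩
  | @cons s v w h ih =>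
    obtain ⟨σ, hσ⟩ := ih
    refine ⟨σ, ?_⟩
    have := wordFilt_mul hσ s
    rwa [sub_mul, smul_mul_assoc] at this
  | @swap s t w =>
    refine ⟨koszul k (p s) (p t), ?_⟩
    have e : L.word X (t :: s :: w) - koszul k (p s) (p t) • L.word X (s :: t :: w) =
        L.word X w * L.ι (L.bracket (X s) (X t)) := by
      simp only [word]
      rw [mul_assoc, mul_assoc, ι_mul_ι L (hp s) (hp t), mul_add, mul_smul_comm]
      abel
    rw [e]
    exact word_mul_ι_mem hX w _
  | @trans v w x h h' ih ih' =>
    obtain ⟨σ, hσ⟩ := ih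
    obtain ⟨τ, hτ⟩ := ih'
    refine ⟨σ * τ, ?_⟩
    rw [← h.length_eq] at hτ
    have := add_mem hσ (Submodule.smul_mem _ σ hτ)
    rwa [smul_sub, smul_smul, sub_add_sub_cancel] at this

variable [LinearOrder ι'] [CharZero k]

/-- The spanning half of Poincaré–Birkhoff–Witt, by induction on length: sort the word modulo
shorter ones, and replace the square of an odd letter by half of its bracket with itself. -/
theorem wordFilt_le (hX : Submodule.span k (Set.range X) = ⊤)
    (hp : ∀ s, X s ∈ L.gr (p s)) (n : ℕ) : L.wordFilt X n ≤
      Submodule.span k (Set.range fun w : {w : List ι' // IsCanonical p w} => L.word X w.1) := by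
  induction n with
  | zero =>
    refine Submodule.span_le.2 ?_
    rintro _ ⟨w, hw, rfl⟩
    simp at hw
  | succ n ih =>
    refine Submodule.span_le.2 ?_
    rintro _ ⟨v, hv, rfl⟩
    have hle : L.wordFilt X v.length ≤ L.wordFilt X n := Submodule.span_mono (by
      rintro _ ⟨w, hw, rfl⟩
      exact ⟨w, by omega, rfl⟩)
    rcases exists_perm_isCanonical_or (p := p) v with ⟨w, hw, h⟩ | ⟨a, s, b, h, hs⟩
    · obtain ⟨σ, hσ⟩ := exists_smul_word_of_perm hX hp h
      rw [← sub_add_cancel (L.word X v) (σ • L.word X w)]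
      exact add_mem (ih (hle hσ)) (Submodule.smul_mem _ _ (Submodule.subset_span ⟨⟨w, hw⟩, rfl⟩))
    · obtain ⟨σ, hσ⟩ := exists_smul_word_of_perm hX hp h
      rw [← sub_add_cancel (L.word X v) (σ • L.word X _)]
      refine add_mem (ih (hle hσ)) (Submodule.smul_mem _ _ (ih (hle ?_)))
      have e : L.word X (s :: s :: b) = (2⁻¹ : k) • (L.word X b * L.ι (L.bracket (X s) (X s))) := by
        have := ι_mul_ι L (hp s) (hp s)
        rw [hs, koszul_one_one] at this
        have e : L.ι (X s) * L.ι (X s) = (2⁻¹ : k) • L.ι (L.bracket (X s) (X s)) :=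
          eq_inv_smul_of_eq_neg (V := L.Enveloping) this
        simp only [word]
        rw [mul_assoc, e, mul_smul_comm]
      have hb : L.word X (s :: s :: b) ∈ L.wordFilt X (b.length + 2) := by
        rw [e]
        exact Submodule.smul_mem _ _ (word_mul_ι_mem hX b _)
      have := word_append_mem hb a
      have hl := h.length_eq
      rw [List.length_append, List.length_cons, List.length_cons] at hl
      rw [hl]
      exact this

omit [CharZero k] [LinearOrder ι'] in
theorem span_word_eq_top (hX : Submodule.span k (Set.range X) = ⊤) :
    Submodule.span k (Set.range (L.word X)) = ⊤ := by
  refine Submodule.eq_top_iff'.2 fun u => ?_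
  have key : ∀ u v, v ∈ Submodule.span k (Set.range (L.word X)) →
      v * u ∈ Submodule.span k (Set.range (L.word X)) := by
    intro u
    refine L.enveloping_induction (p := fun u => ∀ v, v ∈ Submodule.span k (Set.range (L.word X)) →
      v * u ∈ Submodule.span k (Set.range (L.word X))) ?_ ?_ ?_ ?_ u
    · intro c v hv
      rw [← Algebra.commutes, ← Algebra.smul_def]
      exact Submodule.smul_mem _ _ hv
    · intro x v hv
      refine (Submodule.span_le (p := (Submodule.span k (Set.range (L.word X))).comap
        (LinearMap.mulRight k (L.ι x)))).2 ?_ hv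
      rintro _ ⟨w, rfl⟩
      refine Submodule.span_mono ?_ (word_mul_ι_mem hX w x)
      rintro _ ⟨w, _, rfl⟩
      exact ⟨w, rfl⟩
    · intro a b ha hb v hv
      rw [mul_add]
      exact add_mem (ha v hv) (hb v hv)
    · intro a b ha hb v hv
      rw [← mul_assoc]
      exact hb _ (ha v hv)
  rw [← one_mul u]
  exact key u 1 (Submodule.subset_span ⟨[], rfl⟩)

theorem span_canonical_eq_top (hX : Submodule.span k (Set.range X) = ⊤)
    (hp : ∀ s, X s ∈ L.gr (p s)) :
    Submodule.span k (Set.range fun w : {w : List ι' // IsCanonical p w} => L.word X w.1) = ⊤ := by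
  rw [eq_top_iff, ← span_word_eq_top hX, Submodule.span_le]
  rintro _ ⟨w, rfl⟩
  exact wordFilt_le hX hp (w.length + 1) (Submodule.subset_span ⟨w, Nat.lt_succ_self _, rfl⟩)

omit [CharZero k] [LinearOrder ι'] in
theorem exists_word_mem_envelopingGr (hp : ∀ s, X s ∈ L.gr (p s)) (w : List ι') :
    ∃ i, L.word X w ∈ L.envelopingGr i := by
  have key : ∃ l : List (Σ j : ZMod 2, L.gr j), L.word X w = (l.map fun a => L.ι a.2.1).prod := by
    induction w with
    | nil => exact ⟨[], rfl⟩
    | cons s w ih =>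
      obtain ⟨l, hl⟩ := ih
      refine ⟨l ++ [⟨p s, X s, hp s⟩], ?_⟩
      rw [List.map_append, List.prod_append, ← hl]
      simp [word]
  obtain ⟨l, hl⟩ := key
  exact ⟨_, Submodule.subset_span ⟨l, rfl, hl⟩⟩

omit [CharZero k] [LinearOrder ι'] in
theorem envelopingGr_sup_eq_top (hX : Submodule.span k (Set.range X) = ⊤)
    (hp : ∀ s, X s ∈ L.gr (p s)) : L.envelopingGr 0 ⊔ L.envelopingGr 1 = ⊤ := by
  rw [eq_top_iff, ← span_word_eq_top hX, Submodule.span_le]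
  rintro _ ⟨w, rfl⟩
  obtain ⟨i, hi⟩ := exists_word_mem_envelopingGr hp w
  rcases parity_cases i with rfl | rfl
  · exact Submodule.mem_sup_left hi
  · exact Submodule.mem_sup_right hi

end LieSuperalgebra

/-! ### Comparison with the enveloping superalgebra -/

section Comparison

variable {k V g : Type u} [Field k] [AddCommGroup V] [Module k V] [AddCommGroup g] [Module k g]
  {gr : ZMod 2 → Submodule k V} {mul : V →ₗ[k] V →ₗ[k] V} {one : V}

/-- The product of the `x i`, in reversed order. -/
def prodWord (mul : V →ₗ[k] V →ₗ[k] V) (one : V) {ι' : Type*} (x : ι' → V) : List ι' → V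
  | [] => one
  | s :: w => mul (prodWord mul one x w) (x s)

/-- Left multiplications embed the product `mul` in the ring `Module.End k V`, so the universal
property of the enveloping algebra yields a representation `Φ` on `V`; the desired map is its orbit
map `u ↦ Φ u one`. -/
theorem exists_extension (h : IsSuperalgebraProduct gr mul one) (L : LieSuperalgebra k g)
    (incl : g →ₗ[k] V) (hbr : ∀ {i j x y}, x ∈ L.gr i → y ∈ L.gr j →
      incl (L.bracket x y) = mul (incl x) (incl y) - koszul k i j • mul (incl y) (incl x)) :
    ∃ a : L.Enveloping →ₗ[k] V, a 1 = one ∧ (∀ u v, a (u * v) = mul (a u) (a v)) ∧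
      ∀ x, a (L.ι x) = incl x := by
  let Φ : L.Enveloping →ₐ[k] Module.End k V := RingQuot.liftAlgHom k
    ⟨TensorAlgebra.lift k (mul ∘ₗ incl), by
      rintro _ _ ⟨hx, hy⟩
      ext v
      simp [hbr hx hy, h.mul_assoc]⟩
  have hι : ∀ x, Φ (L.ι x) = mul (incl x) := fun x => by simp [Φ, LieSuperalgebra.ι]
  -- Each `Φ u` is left multiplication by `Φ u one`, which makes the orbit map multiplicative.
  have hΦ : ∀ u w, Φ u w = mul (Φ u one) w := by
    intro u
    refine L.enveloping_induction (p := fun u => ∀ w, Φ u w = mul (Φ u one) w) ?_ ?_ ?_ ?_ u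
    · intro c w
      rw [AlgHom.commutes, Module.algebraMap_end_apply, Module.algebraMap_end_apply, map_smul,
        LinearMap.smul_apply, h.one_mul]
    · intro x w
      rw [hι, h.mul_one]
    · intro u v hu hv w
      rw [map_add, LinearMap.add_apply, LinearMap.add_apply, hu, hv, map_add, LinearMap.add_apply]
    · intro u v hu hv w
      rw [map_mul, Module.End.mul_apply, Module.End.mul_apply, hu, hv, hu (Φ v one), h.mul_assoc]
  refine ⟨LinearMap.applyₗ one ∘ₗ Φ.toLinearMap, ?_, fun u v => ?_, fun x => ?_⟩
  · simp
  · change Φ (u * v) one = mul (Φ u one) (Φ v one)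
    rw [map_mul, Module.End.mul_apply, hΦ]
  · change Φ (L.ι x) one = incl x
    rw [hι, h.mul_one]

theorem extension_unique {L : LieSuperalgebra k g} {incl : g →ₗ[k] V}
    {a b : L.Enveloping →ₗ[k] V} (ha : a 1 = one) (ha' : ∀ u v, a (u * v) = mul (a u) (a v))
    (ha'' : ∀ x, a (L.ι x) = incl x) (hb : b 1 = one) (hb' : ∀ u v, b (u * v) = mul (b u) (b v))
    (hb'' : ∀ x, b (L.ι x) = incl x) : b = a := by
  ext u
  refine L.enveloping_induction (p := fun u => b u = a u) ?_ ?_ ?_ ?_ u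
  · intro c
    rw [Algebra.algebraMap_eq_smul_one, map_smul, map_smul, ha, hb]
  · intro x
    rw [ha'', hb'']
  · intro u v hu hv
    rw [map_add, map_add, hu, hv]
  · intro u v hu hv
    rw [ha', hb', hu, hv]

variable [CharZero k]

/-- The canonical words span the source and go to a basis of the target. -/
theorem extension_bijective {L : LieSuperalgebra k g} {incl : g →ₗ[k] V}
    {a : L.Enveloping →ₗ[k] V} (ha : a 1 = one) (ha' : ∀ u v, a (u * v) = mul (a u) (a v))
    (ha'' : ∀ x, a (L.ι x) = incl x) {ι' : Type*} [LinearOrder ι'] {X : ι' → g} {p : ι' → ZMod 2}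
    (hX : Submodule.span k (Set.range X) = ⊤) (hp : ∀ s, X s ∈ L.gr (p s))
    (hspan : Submodule.span k (Set.range fun w : {w : List ι' // IsCanonical p w} =>
      prodWord mul one (fun s => incl (X s)) w.1) = ⊤)
    (hind : LinearIndependent k fun w : {w : List ι' // IsCanonical p w} =>
      prodWord mul one (fun s => incl (X s)) w.1) : Function.Bijective a := by
  have hw : ∀ w, a (L.word X w) = prodWord mul one (fun s => incl (X s)) w := by
    intro w
    induction w with
    | nil => exact ha
    | cons s w ih => rw [LieSuperalgebra.word, ha', ih, ha'']; rfl
  constructor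
  · refine (injective_iff_map_eq_zero a).2 fun u hu => ?_
    have hu' : u ∈ Submodule.span k (Set.range
        fun w : {w : List ι' // IsCanonical p w} => L.word X w.1) := by
      rw [LieSuperalgebra.span_canonical_eq_top hX hp]
      trivial
    obtain ⟨c, rfl⟩ := (Finsupp.mem_span_range_iff_exists_finsupp).1 hu'
    have : c = 0 := by
      refine linearIndependent_iff.1 hind c ?_
      rw [Finsupp.linearCombination_apply, ← hu, map_finsuppSum]
      refine Finsupp.sum_congr fun w _ => ?_
      rw [map_smul, hw]
    rw [this, Finsupp.sum_zero_index]
  · rw [← LinearMap.range_eq_top, eq_top_iff, ← hspan, Submodule.span_le]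
    rintro _ ⟨w, rfl⟩
    exact ⟨_, hw w.1⟩

-- The map preserves parity. Conversely, a homogeneous `v = a (u₀ + u₁)` equals the image of the
-- component of its own parity, since the target is a direct sum.
omit [CharZero k] in
theorem map_envelopingGr (h : IsSuperalgebraProduct gr mul one) {L : LieSuperalgebra k g}
    {incl : g →ₗ[k] V} {a : L.Enveloping →ₗ[k] V} (ha : a 1 = one)
    (ha' : ∀ u v, a (u * v) = mul (a u) (a v)) (ha'' : ∀ x, a (L.ι x) = incl x)
    (hgr : ∀ i x, x ∈ L.gr i ↔ incl x ∈ gr i) (htop : L.envelopingGr 0 ⊔ L.envelopingGr 1 = ⊤)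
    (hs : Function.Surjective a) (i : ZMod 2) : (L.envelopingGr i).map a = gr i := by
  have hle : ∀ i u, u ∈ L.envelopingGr i → a u ∈ gr i := by
    intro i u hu
    refine (Submodule.span_le (p := (gr i).comap a)).2 ?_ hu
    rintro _ ⟨l, rfl, rfl⟩
    rw [SetLike.mem_coe, Submodule.mem_comap]
    clear hu
    induction l with
    | nil => simpa [ha] using h.one_mem
    | cons x l ih =>
      rw [List.map_cons, List.map_cons, List.prod_cons, List.sum_cons, ha', ha'']
      exact h.mul_mem ((hgr _ _).1 x.2.2) ih
  have hdis : ∀ {i : ZMod 2} {u : L.Enveloping} {v : V}, v ∈ gr i → v = a u → v ∈ (L.envelopingGr i).map a := by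
    intro i u v hv e
    obtain ⟨u₀, h₀, u₁, h₁, rfl⟩ := Submodule.mem_sup.1 (htop ▸ trivial :
      u ∈ L.envelopingGr 0 ⊔ L.envelopingGr 1)
    rw [map_add] at e
    rcases parity_cases i with rfl | rfl
    · refine ⟨u₀, h₀, ?_⟩
      rw [← component_of_mem h.isCompl hv, e, map_add, component_of_mem h.isCompl (hle _ _ h₀),
        component_of_mem_ne h.isCompl (by decide) (hle _ _ h₁), add_zero]
    · refine ⟨u₁, h₁, ?_⟩
      rw [← component_of_mem h.isCompl hv, e, map_add, component_of_mem h.isCompl (hle _ _ h₁),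
        component_of_mem_ne h.isCompl (by decide) (hle _ _ h₀), zero_add]
  refine le_antisymm ?_ fun v hv => ?_
  · rintro _ ⟨u, hu, rfl⟩
    exact hle i u hu
  · obtain ⟨u, rfl⟩ := hs v
    exact hdis hv rfl

end Comparison

end Super

/-! ### The convolution superalgebra of a formal supergroup and its comparison with the enveloping
algebra -/

namespace Super
open AugSuperalgebra

theorem span_range_eq_top_of_le {k W ι : Type*} [Field k] [AddCommGroup W] [Module k W]
    {E : Submodule k W} (x : ι → E) (h : E ≤ Submodule.span k (Set.range fun i => (x i).1)) :
    Submodule.span k (Set.range x) = ⊤ := by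
  refine Submodule.map_injective_of_injective E.injective_subtype ?_
  rw [Submodule.map_span, ← Set.range_comp, Submodule.map_subtype_top]
  refine le_antisymm (Submodule.span_le.2 ?_) h
  rintro _ ⟨i, rfl⟩
  exact (x i).2

theorem linearIndependent_subtype_of_forall {k W ι : Type*} [Field k] [AddCommGroup W]
    [Module k W] {E : Submodule k W} {q : ι → Prop} (x : {i // q i} → E) (y : ι → W)
    (hxy : ∀ i, (x i).1 = y i.1) (h : ∀ c : ι →₀ k, (∀ i ∈ c.support, q i) →
      c.sum (fun i r => r • y i) = 0 → c = 0) : LinearIndependent k x := by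
  refine linearIndependent_iff.2 fun c hc => ?_
  refine Finsupp.embDomain_eq_zero (f := Function.Embedding.subtype q).1 (h _ (fun i hi => ?_) ?_)
  · rw [Finsupp.support_embDomain, Finset.mem_map] at hi
    obtain ⟨j, -, rfl⟩ := hi
    exact j.2
  · rw [Finsupp.sum_embDomain]
    have := congrArg E.subtype hc
    rw [Finsupp.linearCombination_apply, map_finsuppSum, map_zero] at this
    rw [← this]
    exact Finsupp.sum_congr fun i _ => by simp [hxy]

namespace AugSuperalgebra

variable {k A : Type u} [Field k] [Ring A] [Algebra k A] (P : AugSuperalgebra k A)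

theorem tangent_le_dist : P.tangent ≤ P.dist := fun _ hφ => ⟨1, hφ.2⟩

theorem ε_mem_dist : P.ε.toLinearMap ∈ P.dist :=
  ⟨0, fun a ha => (P.mem_m a).1 (by rwa [zero_add, pow_one] at ha)⟩

end AugSuperalgebra

namespace FormalSupergroup

variable {k A B : Type u} [Field k] [Ring A] [Algebra k A] [Ring B] [Algebra k B]
  {F : FormalSupergroup k A B} [CharZero k]

/-- Monomials in tangent vectors are of type `Rep` and span the distributions, so a statement that
is linear in `φ` need only be checked on `Rep`, where Grassmann points are available. -/
theorem dist_induction {s : Finset A} (hs : F.P.m ≤ Submodule.span k s ⊔ F.P.filt 2)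
    {q : Module.Dual k A → Prop} (rep : ∀ φ, F.P.Rep φ → q φ)
    (add : ∀ φ ψ, φ ∈ F.P.dist → ψ ∈ F.P.dist → q φ → q ψ → q (φ + ψ))
    (smul : ∀ (c : k) φ, φ ∈ F.P.dist → q φ → q (c • φ)) {φ : Module.Dual k A}
    (hφ : φ ∈ F.P.dist) : q φ := by
  obtain ⟨n, p, b, f, h⟩ := exists_isTangentBasis hs
  have key : φ ∈ F.P.dist ∧ q φ := by
    refine Submodule.span_induction (p := fun φ _ => φ ∈ F.P.dist ∧ q φ) ?_ ?_ ?_ ?_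
      (dist_le_span_mono h hφ)
    · rintro _ ⟨w, -, rfl⟩
      exact ⟨(rep_mono h w).mem_dist, rep _ (rep_mono h w)⟩
    · refine ⟨zero_mem _, ?_⟩
      rw [← zero_smul k F.P.ε.toLinearMap]
      exact smul 0 _ F.P.ε_mem_dist (rep _ rep_ε)
    · exact fun φ ψ _ _ hφ hψ => ⟨add_mem hφ.1 hψ.1, add _ _ hφ.1 hψ.1 hφ.2 hψ.2⟩
    · exact fun c φ _ hφ => ⟨Submodule.smul_mem _ _ hφ.1, smul _ _ hφ.1 hφ.2⟩
  exact key.2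

theorem exists_isTens_of_mem_dist {s : Finset A} (hs : F.P.m ≤ Submodule.span k s ⊔ F.P.filt 2)
    {φ ψ : Module.Dual k A} (hφ : φ ∈ F.P.dist) (hψ : ψ ∈ F.P.dist) : ∃ T, F.IsTens φ ψ T := by
  refine dist_induction hs (q := fun φ => ∃ T, F.IsTens φ ψ T) (fun φ hφ => ?_) ?_ ?_ hφ
  · refine dist_induction hs (q := fun ψ => ∃ T, F.IsTens φ ψ T) (fun ψ hψ => ?_) ?_ ?_ hψ
    · obtain ⟨T, hT, -⟩ := exists_isTens hφ hψ
      exact ⟨T, hT⟩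
    · rintro ψ ψ' - - ⟨T, hT⟩ ⟨T', hT'⟩
      exact ⟨_, hT.add_right hT'⟩
    · rintro c ψ - ⟨T, hT⟩
      exact ⟨_, hT.smul_right c⟩
  · rintro φ φ' - - ⟨T, hT⟩ ⟨T', hT'⟩
    exact ⟨_, hT.add_left hT'⟩
  · rintro c φ - ⟨T, hT⟩
    exact ⟨_, hT.smul_left c⟩

section Bilinear

variable {φ φ' ψ ψ' : Module.Dual k A}

theorem star_add_left (h : ∃ T, F.IsTens φ ψ T) (h' : ∃ T, F.IsTens φ' ψ T) :
    F.star (φ + φ') ψ = F.star φ ψ + F.star φ' ψ := by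
  obtain ⟨T, h⟩ := h
  obtain ⟨T', h'⟩ := h'
  rw [h.star_eq, h'.star_eq, (h.add_left h').star_eq, LinearMap.add_comp]

theorem star_add_right (h : ∃ T, F.IsTens φ ψ T) (h' : ∃ T, F.IsTens φ ψ' T) :
    F.star φ (ψ + ψ') = F.star φ ψ + F.star φ ψ' := by
  obtain ⟨T, h⟩ := h
  obtain ⟨T', h'⟩ := h'
  rw [h.star_eq, h'.star_eq, (h.add_right h').star_eq, LinearMap.add_comp]

theorem star_smul_left (h : ∃ T, F.IsTens φ ψ T) (c : k) :
    F.star (c • φ) ψ = c • F.star φ ψ := by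
  obtain ⟨T, h⟩ := h
  rw [h.star_eq, (h.smul_left c).star_eq, LinearMap.smul_comp]

theorem star_smul_right (h : ∃ T, F.IsTens φ ψ T) (c : k) :
    F.star φ (c • ψ) = c • F.star φ ψ := by
  obtain ⟨T, h⟩ := h
  rw [h.star_eq, (h.smul_right c).star_eq, LinearMap.smul_comp]

end Bilinear

variable (F) in
theorem exists_mul {s : Finset A} (hs : F.P.m ≤ Submodule.span k s ⊔ F.P.filt 2) :
    ∃ mul : F.P.dist →ₗ[k] F.P.dist →ₗ[k] F.P.dist, ∀ φ ψ, (mul φ ψ).1 = F.star φ.1 ψ.1 := by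
  have hT : ∀ φ ψ : F.P.dist, ∃ T, F.IsTens φ.1 ψ.1 T := fun φ ψ =>
    exists_isTens_of_mem_dist hs φ.2 ψ.2
  exact ⟨LinearMap.mk₂ k (fun φ ψ => ⟨F.star φ.1 ψ.1, star_mem_dist (hT φ ψ)⟩)
    (fun φ φ' ψ => Subtype.ext (star_add_left (hT φ ψ) (hT φ' ψ)))
    (fun c φ ψ => Subtype.ext (star_smul_left (hT φ ψ) c))
    (fun φ ψ ψ' => Subtype.ext (star_add_right (hT φ ψ) (hT φ ψ')))
    (fun c φ ψ => Subtype.ext (star_smul_right (hT φ ψ) c)), fun φ ψ => rfl⟩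

section Assoc

variable {s : Finset A} (hs : F.P.m ≤ Submodule.span k s ⊔ F.P.filt 2)
include hs

/-- Both sides are trilinear, so three applications of `dist_induction` reduce the claim to forms
given by Grassmann points. -/
theorem star_assoc {φ ψ χ : Module.Dual k A} (hφ : φ ∈ F.P.dist) (hψ : ψ ∈ F.P.dist)
    (hχ : χ ∈ F.P.dist) : F.star (F.star φ ψ) χ = F.star φ (F.star ψ χ) := by
  have hT : ∀ {φ ψ}, φ ∈ F.P.dist → ψ ∈ F.P.dist → ∃ T, F.IsTens φ ψ T :=
    exists_isTens_of_mem_dist hs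
  have hS : ∀ {φ ψ}, φ ∈ F.P.dist → ψ ∈ F.P.dist → F.star φ ψ ∈ F.P.dist := fun hφ hψ =>
    star_mem_dist (hT hφ hψ)
  refine dist_induction hs (q := fun φ => F.star (F.star φ ψ) χ = F.star φ (F.star ψ χ))
    (fun φ hφr => ?_) ?_ ?_ hφ
  · have hφ := hφr.mem_dist
    refine dist_induction hs (q := fun ψ => F.star (F.star φ ψ) χ = F.star φ (F.star ψ χ))
      (fun ψ hψr => ?_) ?_ ?_ hψ
    · have hψ := hψr.mem_dist
      refine dist_induction hs (q := fun χ => F.star (F.star φ ψ) χ = F.star φ (F.star ψ χ))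
        (fun χ hχr => ?_) ?_ ?_ hχ
      · obtain ⟨T₁₂, h₁₂⟩ := hT hφ hψ
        obtain ⟨T₂₃, h₂₃⟩ := hT hψ hχr.mem_dist
        have h := hS hφ hψ
        have h' := hS hψ hχr.mem_dist
        rw [h₁₂.star_eq] at h ⊢
        rw [h₂₃.star_eq] at h' ⊢
        obtain ⟨T, hT₁⟩ := hT h hχr.mem_dist
        obtain ⟨T', hT₂⟩ := hT hφ h'
        rw [hT₁.star_eq, hT₂.star_eq]
        exact isTens_assoc hφr hψr hχr h₁₂ h₂₃ hT₁ hT₂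
      · intro χ χ' hχ hχ' e e'
        rw [star_add_right (hT (hS hφ hψ) hχ) (hT (hS hφ hψ) hχ'),
          star_add_right (hT hψ hχ) (hT hψ hχ'),
          star_add_right (hT hφ (hS hψ hχ)) (hT hφ (hS hψ hχ')), e, e']
      · intro c χ hχ e
        rw [star_smul_right (hT (hS hφ hψ) hχ), star_smul_right (hT hψ hχ),
          star_smul_right (hT hφ (hS hψ hχ)), e]
    · intro ψ ψ' hψ hψ' e e'
      rw [star_add_right (hT hφ hψ) (hT hφ hψ'), star_add_left (hT (hS hφ hψ) hχ)
        (hT (hS hφ hψ') hχ), star_add_left (hT hψ hχ) (hT hψ' hχ),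
        star_add_right (hT hφ (hS hψ hχ)) (hT hφ (hS hψ' hχ)), e, e']
    · intro c ψ hψ e
      rw [star_smul_right (hT hφ hψ), star_smul_left (hT (hS hφ hψ) hχ),
        star_smul_left (hT hψ hχ), star_smul_right (hT hφ (hS hψ hχ)), e]
  · intro φ φ' hφ hφ' e e'
    rw [star_add_left (hT hφ hψ) (hT hφ' hψ), star_add_left (hT (hS hφ hψ) hχ)
      (hT (hS hφ' hψ) hχ), star_add_left (hT hφ (hS hψ hχ)) (hT hφ' (hS hψ hχ)), e, e']
  · intro c φ hφ e
    rw [star_smul_left (hT hφ hψ), star_smul_left (hT (hS hφ hψ) hχ),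
      star_smul_left (hT hφ (hS hψ hχ)), e]

theorem ε_star {φ : Module.Dual k A} (hφ : φ ∈ F.P.dist) : F.star F.P.ε.toLinearMap φ = φ := by
  have hT : ∀ {φ ψ}, φ ∈ F.P.dist → ψ ∈ F.P.dist → ∃ T, F.IsTens φ ψ T :=
    exists_isTens_of_mem_dist hs
  refine dist_induction hs (q := fun φ => F.star F.P.ε.toLinearMap φ = φ) (fun φ hφ => ?_)
    ?_ ?_ hφ
  · obtain ⟨T, h, e⟩ := isTens_ε_left hφ
    rw [h.star_eq, e]
  · intro φ ψ hφ hψ e e'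
    rw [star_add_right (hT F.P.ε_mem_dist hφ) (hT F.P.ε_mem_dist hψ), e, e']
  · intro c φ hφ e
    rw [star_smul_right (hT F.P.ε_mem_dist hφ), e]

theorem star_ε {φ : Module.Dual k A} (hφ : φ ∈ F.P.dist) : F.star φ F.P.ε.toLinearMap = φ := by
  have hT : ∀ {φ ψ}, φ ∈ F.P.dist → ψ ∈ F.P.dist → ∃ T, F.IsTens φ ψ T :=
    exists_isTens_of_mem_dist hs
  refine dist_induction hs (q := fun φ => F.star φ F.P.ε.toLinearMap = φ) (fun φ hφ => ?_)
    ?_ ?_ hφ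
  · obtain ⟨T, h, e⟩ := isTens_ε_right hφ
    rw [h.star_eq, e]
  · intro φ ψ hφ hψ e e'
    rw [star_add_left (hT hφ F.P.ε_mem_dist) (hT hψ F.P.ε_mem_dist), e, e']
  · intro c φ hφ e
    rw [star_smul_left (hT hφ F.P.ε_mem_dist), e]

theorem isSuperalgebraProduct {mul : F.P.dist →ₗ[k] F.P.dist →ₗ[k] F.P.dist}
    (hmul : ∀ φ ψ, (mul φ ψ).1 = F.star φ.1 ψ.1) :
    IsSuperalgebraProduct (A := F.P.dist) (F.P.dualGr F.P.dist) mul ⟨F.P.ε.toLinearMap, F.P.ε_mem_dist⟩ where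
  isCompl := isCompl_dist
  one_mem := fun j hj a ha => F.P.ε_of_ne hj ha
  mul_mem {i j φ ψ} hφ hψ l hl a ha := by
    obtain ⟨T, hT⟩ := exists_isTens_of_mem_dist hs φ.2 ψ.2
    rw [hmul, hT.star_eq]
    exact hT.parity hφ hψ l hl _ (F.hμ.map_gr ha)
  one_mul φ := Subtype.ext ((hmul _ _).trans (ε_star hs φ.2))
  mul_one φ := Subtype.ext ((hmul _ _).trans (star_ε hs φ.2))
  mul_assoc φ ψ χ := Subtype.ext (by
    rw [hmul, hmul, hmul, hmul]
    exact star_assoc hs φ.2 ψ.2 χ.2)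

end Assoc

/-! ### The bracket of tangent vectors -/

theorem star_apply_one {φ ψ : Module.Dual k A} (h : ∃ T, F.IsTens φ ψ T) :
    F.star φ ψ 1 = φ 1 * ψ 1 := by
  obtain ⟨T, h⟩ := h
  have := h.apply 0 0 1 1 F.P.isSuper.one_mem F.P.isSuper.one_mem
  rw [map_one, map_one, _root_.mul_one, koszul_zero_left, _root_.one_mul] at this
  rw [h.star_eq, LinearMap.comp_apply, AlgHom.toLinearMap_apply, map_one, this]

/-- The Leibniz rule with `n = 1`: for `f` in `m` the form `X (f ·)` is `X f` times the
augmentation, which is neutral for convolution. -/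
theorem star_tangent_apply_mul {i p q : ZMod 2} {X Y : Module.Dual k A} (hX : F.P.IsTangent p X)
    (hY : F.P.IsTangent q Y) {f u : A} (hf : f ∈ F.P.gr i) (hfm : f ∈ F.P.m) (hu : u ∈ F.P.m) :
    F.star X Y (f * u) = koszul k i q * (X f * Y u) + Y f * X u := by
  obtain ⟨T, hT, -⟩ := exists_isTens hX.rep hY.rep
  obtain ⟨T₀, hT₀, e⟩ := isTens_ε_left (F := F) hY.rep
  have hXf : X ∘ₗ LinearMap.mulLeft k f = X f • F.P.ε.toLinearMap := by
    ext a
    simp [hX.map_mul, (F.P.mem_m f).1 hfm]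
  have := IsTens.leibniz hX.rep (n := 1) hX.map_sq hY hf hfm (by rwa [F.P.filt_one]) hT
    (hXf ▸ hT₀.smul_left (X f))
  have e' : T₀ (F.μ u) = Y u := DFunLike.congr_fun e u
  rw [hT.star_eq, LinearMap.comp_apply, AlgHom.toLinearMap_apply, this, LinearMap.smul_apply,
    smul_eq_mul, e']

/-- On a product of two elements of `m`, both convolutions consist of the same two terms up to sign;
the supercommutator cancels them. -/
theorem supercommutator_mem_tangent {p q : ZMod 2} {X Y : Module.Dual k A}
    (hX : F.P.IsTangent p X) (hY : F.P.IsTangent q Y) :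
    F.star X Y - koszul k p q • F.star Y X ∈ F.P.tangent := by
  constructor
  · obtain ⟨T, hT, -⟩ := exists_isTens hX.rep hY.rep
    obtain ⟨T', hT', -⟩ := exists_isTens hY.rep hX.rep
    rw [LinearMap.sub_apply, LinearMap.smul_apply, star_apply_one ⟨T, hT⟩,
      star_apply_one ⟨T', hT'⟩, hX.map_one, hY.map_one]
    simp
  · intro a ha
    rw [pow_two] at ha
    refine (Submodule.mul_le (P := LinearMap.ker (F.star X Y - koszul k p q • F.star Y X))).2
      (fun f hf u hu => ?_) ha
    have key : ∀ i f, f ∈ F.P.gr i → f ∈ F.P.m →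
        (F.star X Y - koszul k p q • F.star Y X) (f * u) = 0 := by
      intro i f hf hfm
      rw [LinearMap.sub_apply, LinearMap.smul_apply, star_tangent_apply_mul hX hY hf hfm hu,
        star_tangent_apply_mul hY hX hf hfm hu, smul_eq_mul]
      have h1 : koszul k i q * X f = koszul k p q * X f := by
        by_cases h : i = p
        · rw [h]
        · rw [hX.map_ne i h f hf, mul_zero, mul_zero]
      have h2 : koszul k p q * (koszul k i p * Y f) = Y f := by
        by_cases h : i = q
        · rw [h, koszul_comm k q p, ← _root_.mul_assoc, koszul_mul_self, _root_.one_mul]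
        · rw [hY.map_ne i h f hf, mul_zero, mul_zero]
      linear_combination Y u * h1 - X u * h2
    rw [LinearMap.mem_ker, ← component_add F.P.isSuper.isCompl f, add_mul, map_add]
    rw [← F.P.filt_one] at hf
    rw [key 0 _ (component_mem _ _ _) (F.P.filt_one ▸ F.P.component_mem_filt 0 hf),
      key 1 _ (component_mem _ _ _) (F.P.filt_one ▸ F.P.component_mem_filt 1 hf), add_zero]

variable (F) in
/-- The inclusion of the tangent space in the space of distributions. -/
noncomputable def incl : F.P.tangent →ₗ[k] F.P.dist := Submodule.inclusion F.P.tangent_le_dist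

theorem exists_enveloping_iso {s : Finset A} (hs : F.P.m ≤ Submodule.span k s ⊔ F.P.filt 2) :
    ∃ (mul : F.P.dist →ₗ[k] F.P.dist →ₗ[k] F.P.dist) (L : LieSuperalgebra k F.P.tangent)
      (a : L.Enveloping →ₗ[k] F.P.dist),
      (∀ φ ψ : F.P.dist, ∃ T, F.IsTens φ.1 ψ.1 T) ∧
      (∀ (φ ψ : F.P.dist) T, F.IsTens φ.1 ψ.1 T → (mul φ ψ).1 = T ∘ₗ F.μ.toLinearMap) ∧
      IsSuperalgebraProduct (A := F.P.dist) (F.P.dualGr F.P.dist) mul ⟨F.P.ε.toLinearMap, F.P.ε_mem_dist⟩ ∧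
      (∀ i x, x ∈ L.gr i ↔ F.incl x ∈ F.P.dualGr F.P.dist i) ∧
      (∀ {i j x y}, x ∈ L.gr i → y ∈ L.gr j → F.incl (L.bracket x y) =
        mul (F.incl x) (F.incl y) - koszul k i j • mul (F.incl y) (F.incl x)) ∧
      (a 1 = ⟨F.P.ε.toLinearMap, F.P.ε_mem_dist⟩ ∧ (∀ u v, a (u * v) = mul (a u) (a v)) ∧
        ∀ x, a (L.ι x) = F.incl x) ∧ Function.Bijective a ∧
      ∀ i, (L.envelopingGr i).map a = F.P.dualGr F.P.dist i := by
  obtain ⟨mul, hmul⟩ := F.exists_mul hs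
  have hP := isSuperalgebraProduct hs hmul
  have hincl : Function.Injective F.incl := Submodule.inclusion_injective _
  have hgr : ∀ i x, x ∈ F.P.dualGr F.P.tangent i ↔ F.incl x ∈ F.P.dualGr F.P.dist i :=
    fun i x => Iff.rfl
  obtain ⟨L, rfl', hbr⟩ := exists_lieSuperalgebra (V := F.P.dist) (g := F.P.tangent) hP F.incl
    hincl isCompl_tangent hgr (fun {i j x y} hx hy => by
      refine ⟨⟨_, supercommutator_mem_tangent (isTangent_of_mem hx) (isTangent_of_mem hy)⟩,
        Subtype.ext ?_⟩
      change _ = (mul (F.incl x) (F.incl y)).1 - koszul k i j • (mul (F.incl y) (F.incl x)).1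
      rw [hmul, hmul]
      rfl)
  rw [← rfl'] at hgr hbr
  obtain ⟨a, ha, ha', ha''⟩ := exists_extension (V := F.P.dist) hP L F.incl hbr
  obtain ⟨n, p, b, f, h⟩ := exists_isTangentBasis hs
  have hX : Submodule.span k (Set.range b) = ⊤ := b.span_eq
  have hp : ∀ i, b i ∈ L.gr (p i) := fun i => by
    rw [rfl']
    exact (h.tangent i).map_ne
  -- Both products use the same reversed order, so canonical words are sent exactly to the monomials
  -- `mono`.
  have hw : ∀ w, (prodWord (V := F.P.dist) mul ⟨F.P.ε.toLinearMap, F.P.ε_mem_dist⟩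
      (fun i => F.incl (b i)) w).1 = F.mono (fun i => (b i).1) w := by
    intro w
    induction w with
    | nil => rfl
    | cons s w ih =>
      refine (hmul _ _).trans ?_
      rw [ih]
      rfl
  have hbij : Function.Bijective a := by
    refine extension_bijective (V := F.P.dist) ha ha' ha'' hX hp ?_ ?_
    · refine span_range_eq_top_of_le (W := Module.Dual k A) _ ((dist_le_span_mono h).trans
        (Submodule.span_mono ?_))
      rintro _ ⟨w, hc, rfl⟩
      exact ⟨⟨w, hc⟩, hw w⟩
    · exact linearIndependent_subtype_of_forall (W := Module.Dual k A) _ _ (fun i => hw i.1)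
        (mono_independent h)
  exact ⟨mul, L, a, fun φ ψ => exists_isTens_of_mem_dist hs φ.2 ψ.2,
    fun φ ψ T hT => (hmul φ ψ).trans hT.star_eq, hP, hgr, hbr, ⟨ha, ha', ha''⟩, hbij,
    fun i => map_envelopingGr (V := F.P.dist) hP ha ha' ha'' hgr
      (LieSuperalgebra.envelopingGr_sup_eq_top hX hp) hbij.2 i⟩

end FormalSupergroup

end Super

namespace Super
open PreSuperSpace

/-! ### Stalks -/

namespace PreSuperSpace

variable {k : Type u} [Field k] (X : PreSuperSpace k)

variable {X} in
theorem germ_mem {x : X.carrier} {U : Opens X.carrier} (hx : x ∈ U) {i : ZMod 2} {s : X.sec U}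
    (hs : s ∈ X.gr U i) : germ hx s ∈ X.stalkGr x i :=
  (le_iSup₂ (f := fun (U : Opens X.carrier) (hx : x ∈ U) => (X.gr U i).map (germ hx).toLinearMap)
    U hx) ⟨s, hs, rfl⟩

/-- The supremum is directed, since two germs live on a common neighbourhood; so it is a union. -/
theorem mem_stalkGr {x : X.carrier} {i : ZMod 2} {a : X.Stalk x} :
    a ∈ X.stalkGr x i ↔
      ∃ (U : Opens X.carrier) (hx : x ∈ U) (s : X.sec U), s ∈ X.gr U i ∧ germ hx s = a := by
  constructor
  · intro h
    let S : Submodule k (X.Stalk x) :=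
      { carrier := {a | ∃ (U : Opens X.carrier) (hx : x ∈ U) (s : X.sec U), s ∈ X.gr U i ∧
          germ hx s = a}
        zero_mem' := ⟨⊤, trivial, 0, zero_mem _, map_zero _⟩
        add_mem' := by
          rintro _ _ ⟨U, hU, s, hs, rfl⟩ ⟨V, hV, t, ht, rfl⟩
          have hW : x ∈ U ⊓ V := ⟨hU, hV⟩
          refine ⟨U ⊓ V, hW, X.res inf_le_left s + X.res inf_le_right t,
            add_mem (X.res_gr _ hs) (X.res_gr _ ht), ?_⟩
          rw [map_add, germ_res, germ_res]
        smul_mem' := by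
          rintro c _ ⟨U, hU, s, hs, rfl⟩
          exact ⟨U, hU, c • s, Submodule.smul_mem _ _ hs, map_smul _ _ _⟩ }
    have : X.stalkGr x i ≤ S := iSup₂_le fun U hx => by
      rintro _ ⟨s, hs, rfl⟩
      exact ⟨U, hx, s, hs, rfl⟩
    exact this h
  · rintro ⟨U, hx, s, hs, rfl⟩
    exact germ_mem hx hs

theorem isSuperalgebra_stalkGr (x : X.carrier) : IsSuperalgebra (X.stalkGr x) where
  isCompl := by
    refine IsCompl.of_eq ?_ ?_
    · refine (Submodule.eq_bot_iff _).2 fun a ha => ?_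
      obtain ⟨h0, h1⟩ := Submodule.mem_inf.1 ha
      obtain ⟨U, hU, s, hs, rfl⟩ := (X.mem_stalkGr).1 h0
      obtain ⟨V, hV, t, ht, e⟩ := (X.mem_stalkGr).1 h1
      obtain ⟨W, hW, h, h', e⟩ := (germ_eq_iff hV hU t s).1 e
      rw [← germ_res h' hW]
      have h0 := X.res_gr h' hs
      rw [eq_zero_of_mem_ne (X.isSuperalgebra W).isCompl (i := 0) (j := 1) (by decide) h0
        (e ▸ X.res_gr h ht), map_zero]
    · refine Submodule.eq_top_iff'.2 fun a => ?_
      obtain ⟨U, hU, s, rfl⟩ := exists_germ a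
      rw [← component_add (X.isSuperalgebra U).isCompl s, map_add]
      exact Submodule.add_mem_sup (germ_mem hU (component_mem _ _ _))
        (germ_mem hU (component_mem _ _ _))
  one_mem := by
    rw [← map_one (germ (Opens.mem_top x))]
    exact germ_mem _ (X.isSuperalgebra _).one_mem
  mul_mem {i j a b} ha hb := by
    obtain ⟨U, hU, s, hs, rfl⟩ := (X.mem_stalkGr).1 ha
    obtain ⟨V, hV, t, ht, rfl⟩ := (X.mem_stalkGr).1 hb
    have hW : x ∈ U ⊓ V := ⟨hU, hV⟩
    rw [← germ_res (inf_le_left : U ⊓ V ≤ U) hW, ← germ_res (inf_le_right : U ⊓ V ≤ V) hW,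
      ← map_mul]
    exact germ_mem hW ((X.isSuperalgebra _).mul_mem (X.res_gr _ hs) (X.res_gr _ ht))

end PreSuperSpace

section

variable {k : Type u} [Field k] {X Y Z : SuperSpace k}

theorem isSupercommutative_stalkGr (x : X.carrier) : IsSupercommutative (X.stalkGr x) := by
  intro i j a b ha hb
  obtain ⟨U, hU, s, hs, rfl⟩ := (X.mem_stalkGr).1 ha
  obtain ⟨V, hV, t, ht, rfl⟩ := (X.mem_stalkGr).1 hb
  have hW : x ∈ U ⊓ V := ⟨hU, hV⟩
  rw [← germ_res (inf_le_left : U ⊓ V ≤ U) hW, ← germ_res (inf_le_right : U ⊓ V ≤ V) hW,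
    ← map_mul, ← map_mul, ← map_smul, X.supercommutative _ (X.res_gr _ hs) (X.res_gr _ ht)]

/-- A section is determined by its germs. -/
theorem SuperSpace.section_ext {U : Opens X.carrier} {s t : X.sec U}
    (h : ∀ (x : X.carrier) (hx : x ∈ U), germ (X := X.toPreSuperSpace) hx s =
      germ (X := X.toPreSuperSpace) hx t) : s = t := by
  have h' : ∀ x : U, ∃ (W : Opens X.carrier) (_ : x.1 ∈ W) (hW : W ≤ U),
      X.res hW s = X.res hW t := fun x => by
    obtain ⟨W, hx, hW, hW', e⟩ := (germ_eq_iff x.2 x.2 s t).1 (h x.1 x.2)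
    exact ⟨W, hx, hW, e⟩
  choose W hx hW e using h'
  have h1 : iSup W ≤ U := iSup_le hW
  have h2 : U ≤ iSup W := fun x hxU => le_iSup W ⟨x, hxU⟩ (hx ⟨x, hxU⟩)
  have key : X.res h1 s = X.res h1 t := by
    obtain ⟨r, -, hr⟩ := X.sheaf W (fun i => X.res (hW i) s) fun i j => by
      rw [X.res_res, X.res_res]
    rw [hr (X.res h1 s) fun i => X.res_res _ _ _, hr (X.res h1 t) fun i => by rw [X.res_res, e]]
  rw [← X.res_id s, ← X.res_id t, ← X.res_res h2 h1 s, ← X.res_res h2 h1 t, key]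

namespace Hom

theorem stalkMap_mem (f : Hom X Y) {x : X.carrier} {y : Y.carrier} (h : f.base x = y)
    {i : ZMod 2} {a : Y.Stalk y} (ha : a ∈ Y.stalkGr y i) :
    f.stalkMap h a ∈ X.stalkGr x i := by
  obtain ⟨U, hU, s, hs, rfl⟩ := (Y.mem_stalkGr).1 ha
  rw [stalkMap_germ]
  exact germ_mem _ (f.pull_gr hs)

theorem isUnit_of_stalkMap (f : Hom X Y) {x : X.carrier} {y : Y.carrier} (h : f.base x = y)
    {a : Y.Stalk y} (ha : IsUnit (f.stalkMap h a)) : IsUnit a := by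
  subst h
  obtain ⟨U, hU, s, rfl⟩ := exists_germ a
  rw [stalkMap_germ] at ha
  exact f.isUnit_of_pull s x hU ha

theorem stalkMap_comp (g : Hom Y Z) (f : Hom X Y) {x : X.carrier} {y : Y.carrier} {z : Z.carrier}
    (h : f.base x = y) (h' : g.base y = z) (h'' : (g.comp f).base x = z) :
    (g.comp f).stalkMap h'' = (f.stalkMap h).comp (g.stalkMap h') := by
  ext a
  obtain ⟨U, hU, s, rfl⟩ := exists_germ a
  rfl

theorem ext_stalk {f g : Hom X Y} (hb : ∀ x, f.base x = g.base x)
    (hs : ∀ x, f.stalkMap (hb x) = g.stalkMap (x := x) rfl) : f = g := by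
  have hbase : f.base = g.base := ContinuousMap.ext hb
  obtain ⟨fb, fp, fr, fg, fu⟩ := f
  obtain ⟨gb, gp, gr, gg, gu⟩ := g
  obtain rfl : fb = gb := hbase
  congr
  funext U
  ext s
  refine SuperSpace.section_ext fun x hx => ?_
  exact DFunLike.congr_fun (hs x) (germ (X := Y.toPreSuperSpace) (U := U) hx s)

end Hom

/-! ### Stalks at rational points -/

theorem point_algebraMap_bijective :
    Function.Bijective (algebraMap k ((point k).Stalk (pt k))) := by
  have := (point k).isLocalRing (pt k)
  refine ⟨(algebraMap k _).injective, fun a => ?_⟩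
  obtain ⟨U, hU, s, rfl⟩ := exists_germ a
  refine ⟨(s : U → k) ⟨pt k, hU⟩, ?_⟩
  rw [← AlgHom.commutes (germ (X := (point k).toPreSuperSpace) hU)]
  exact (pointPre_germ_eq_iff hU hU _ _).2 rfl

/-- The value at a rational point. -/
noncomputable def evalPoint (e : Hom (point k) X) : X.Stalk (e.base (pt k)) →ₐ[k] k :=
  (AlgEquiv.ofBijective (Algebra.ofId k _) point_algebraMap_bijective).symm.toAlgHom.comp
    (e.stalkMap rfl)

theorem algebraMap_evalPoint (e : Hom (point k) X) (a : X.Stalk (e.base (pt k))) :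
    algebraMap k _ (evalPoint e a) = e.stalkMap rfl a :=
  (AlgEquiv.ofBijective (Algebra.ofId k _) point_algebraMap_bijective).apply_symm_apply _

theorem evalPoint_ne_zero_iff (e : Hom (point k) X) (a : X.Stalk (e.base (pt k))) :
    evalPoint e a ≠ 0 ↔ IsUnit a := by
  constructor
  · intro h
    refine e.isUnit_of_stalkMap rfl ?_
    rw [← algebraMap_evalPoint]
    exact (isUnit_iff_ne_zero.2 h).map _
  · intro h
    exact (h.map (evalPoint e)).ne_zero

/-- The stalk at a rational point. -/
noncomputable def stalkAug (e : Hom (point k) X) :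
    AugSuperalgebra k (X.Stalk (e.base (pt k))) where
  gr := X.stalkGr _
  isSuper := X.isSuperalgebra_stalkGr _
  comm := isSupercommutative_stalkGr _
  ε := evalPoint e
  m := maximalIdeal X _
  mem_m a := by
    rw [← not_iff_not]
    exact not_not.trans (evalPoint_ne_zero_iff e a).symm

theorem isUnit_iff_stalkAug (e : Hom (point k) X) (a : X.Stalk (e.base (pt k))) :
    IsUnit a ↔ (stalkAug e).ε a ≠ 0 := (evalPoint_ne_zero_iff e a).symm

namespace AugSuperalgebra

variable {A A' : Type u} [Ring A] [Algebra k A] [Ring A'] [Algebra k A']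

/-- A local homomorphism respects augmentations automatically: `a - ε a` is not a unit, so neither
is its image, which therefore has augmentation zero. -/
theorem isHom_of_isUnit {P : AugSuperalgebra k A} {P' : AugSuperalgebra k A'} {ρ : A →ₐ[k] A'}
    (hgr : ∀ {i a}, a ∈ P.gr i → ρ a ∈ P'.gr i) (hP : ∀ a, IsUnit a → P.ε a ≠ 0)
    (hP' : ∀ a, P'.ε a ≠ 0 → IsUnit a) (hρ : ∀ a, IsUnit (ρ a) → IsUnit a) : P.IsHom P' ρ where
  map_gr := hgr
  map_ε a := by
    have h : P'.ε (ρ (a - algebraMap k A (P.ε a))) = 0 := by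
      by_contra h
      refine hP _ (hρ _ (hP' _ h)) ?_
      rw [map_sub, AlgHom.commutes]
      exact sub_self _
    rw [map_sub, map_sub, AlgHom.commutes, AlgHom.commutes, sub_eq_zero] at h
    exact h

end AugSuperalgebra

theorem isHom_stalkMap (f : Hom X Y) (e : Hom (point k) X) (e' : Hom (point k) Y)
    (h : f.base (e.base (pt k)) = e'.base (pt k)) :
    (stalkAug e').IsHom (stalkAug e) (f.stalkMap h) :=
  AugSuperalgebra.isHom_of_isUnit (fun ha => f.stalkMap_mem h ha)
    (fun a => (isUnit_iff_stalkAug e' a).1) (fun a => (isUnit_iff_stalkAug e a).2)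
    fun _ => f.isUnit_of_stalkMap h

/-- By locality, `e` sends the non-unit `a - e' a` to a non-unit of the stalk of the point, which is
the field `k`; hence to zero. -/
theorem point_hom_ext {e e' : Hom (point k) X} (h : e.base (pt k) = e'.base (pt k)) : e = e' := by
  refine Hom.ext_stalk (fun _ => h) fun x => ?_
  obtain rfl : x = pt k := Subsingleton.elim (α := PUnit.{u + 1}) _ _
  ext a
  rw [← algebraMap_evalPoint]
  have hu : ¬ IsUnit (a - algebraMap k _ (evalPoint e' a)) := by
    rw [← evalPoint_ne_zero_iff, not_not, map_sub, AlgHom.commutes]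
    exact sub_self _
  obtain ⟨c, hc⟩ := point_algebraMap_bijective.2 (e.stalkMap (x := pt k) h
    (a - algebraMap k _ (evalPoint e' a)))
  have hc0 : c = 0 := by
    by_contra hne
    exact hu (e.isUnit_of_stalkMap (x := pt k) h (hc ▸ (isUnit_iff_ne_zero.2 hne).map _))
  rw [hc0, map_zero, map_sub, AlgHom.commutes] at hc
  exact sub_eq_zero.1 hc.symm

end

/-! ### Superpoints -/

namespace AugSuperalgebra

variable {k Λ : Type u} [Field k] [Ring Λ] [Algebra k Λ] (P : AugSuperalgebra k Λ)

variable {P} in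
theorem pow_mem_filt {a : Λ} (ha : a ∈ P.m) (n : ℕ) : a ^ n ∈ P.filt n := by
  induction n with
  | zero => trivial
  | succ n ih =>
    rw [pow_succ, ← P.filt_mul_m]
    exact Submodule.mul_mem_mul ih ha

variable {P} in
theorem isNilpotent_of_mem_m (hP : ∃ n, P.filt n = ⊥) {a : Λ} (ha : a ∈ P.m) : IsNilpotent a := by
  obtain ⟨n, hn⟩ := hP
  exact ⟨n, by simpa [hn] using pow_mem_filt ha n⟩

/-- Such an element is a nonzero constant plus a nilpotent. -/
theorem isUnit_of_ε_ne_zero (hP : ∃ n, P.filt n = ⊥) {a : Λ} (ha : P.ε a ≠ 0) : IsUnit a := by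
  have hnil := isNilpotent_of_mem_m hP (P.sub_ε_mem a)
  have h := hnil.isUnit_add_left_of_commute ((isUnit_iff_ne_zero.2 ha).map (algebraMap k Λ))
    (Algebra.commutes _ _).symm
  rwa [add_sub_cancel] at h

theorem isUnit_iff_ε_ne_zero (hP : ∃ n, P.filt n = ⊥) {a : Λ} : IsUnit a ↔ P.ε a ≠ 0 :=
  ⟨fun h => (h.map P.ε).ne_zero, P.isUnit_of_ε_ne_zero hP⟩

/-- The presheaf of the superspace with one point and functions `Λ`. -/
noncomputable def superPointPre : PreSuperSpace k where
  carrier := PUnit.{u + 1}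
  sec U := U → Λ
  gr U i := Submodule.pi Set.univ fun _ => P.gr i
  isSuperalgebra U :=
    { isCompl := by
        refine IsCompl.of_eq ?_ ?_
        · refine (Submodule.eq_bot_iff _).2 fun s hs => funext fun x => ?_
          exact eq_zero_of_mem_ne P.isSuper.isCompl (i := 0) (j := 1) (by decide)
            (hs.1 x trivial) (hs.2 x trivial)
        · refine Submodule.eq_top_iff'.2 fun s => Submodule.mem_sup.2
            ⟨fun x => component P.isSuper.isCompl 0 (s x), fun x _ => component_mem _ _ _,
              fun x => component P.isSuper.isCompl 1 (s x), fun x _ => component_mem _ _ _,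
              funext fun x => component_add _ _⟩
      one_mem := fun _ _ => P.isSuper.one_mem
      mul_mem := fun ha hb x _ => P.isSuper.mul_mem (ha x trivial) (hb x trivial) }
  res h :=
    { toFun := fun s x => s ⟨x.1, h x.2⟩
      map_one' := rfl
      map_mul' := fun _ _ => rfl
      map_zero' := rfl
      map_add' := fun _ _ => rfl
      commutes' := fun _ => rfl }
  res_id _ := rfl
  res_res _ _ _ := rfl
  res_gr h _ _ hs x _ := hs ⟨x.1, h x.2⟩ trivial

variable {P}

theorem superPointPre_germ_eq_iff {x : P.superPointPre.carrier}
    {U V : Opens P.superPointPre.carrier} (hU : x ∈ U) (hV : x ∈ V) (s : U → Λ) (t : V → Λ) :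
    germ (X := P.superPointPre) hU s = germ (X := P.superPointPre) hV t ↔
      s ⟨x, hU⟩ = t ⟨x, hV⟩ := by
  refine (germ_eq_iff (X := P.superPointPre) hU hV s t).trans ?_
  constructor
  · rintro ⟨W, hW, h, h', e⟩
    exact congrFun e ⟨x, hW⟩
  · intro e
    refine ⟨U ⊓ V, ⟨hU, hV⟩, inf_le_left, inf_le_right, funext fun y => ?_⟩
    have : y = ⟨x, hU, hV⟩ := Subtype.ext (Subsingleton.elim (α := PUnit.{u + 1}) _ _)
    rw [this]
    exact e

variable (P) in
/-- The homomorphism of `Λ` to the stalk of the superpoint. -/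
noncomputable def toStalk (x : P.superPointPre.carrier) : Λ →ₐ[k] P.superPointPre.Stalk x :=
  (germ (X := P.superPointPre) (Opens.mem_top x)).comp
    ({ toFun := fun a _ => a
       map_one' := rfl
       map_mul' := fun _ _ => rfl
       map_zero' := rfl
       map_add' := fun _ _ => rfl
       commutes' := fun _ => rfl } : Λ →ₐ[k] P.superPointPre.sec ⊤)

theorem germ_eq_toStalk {x : P.superPointPre.carrier} {U : Opens P.superPointPre.carrier}
    (hU : x ∈ U) (s : U → Λ) : germ (X := P.superPointPre) hU s = P.toStalk x (s ⟨x, hU⟩) :=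
  (superPointPre_germ_eq_iff hU (Opens.mem_top x) _ _).2 rfl

theorem toStalk_bijective (x : P.superPointPre.carrier) : Function.Bijective (P.toStalk x) := by
  constructor
  · intro a b h
    exact (superPointPre_germ_eq_iff (Opens.mem_top x) (Opens.mem_top x) _ _).1 h
  · intro a
    obtain ⟨U, hU, s, rfl⟩ := exists_germ a
    exact ⟨_, (germ_eq_toStalk hU s).symm⟩

variable (P) in
/-- The stalk of the superpoint. -/
noncomputable def stalkEquiv (x : P.superPointPre.carrier) : Λ ≃ₐ[k] P.superPointPre.Stalk x :=
  AlgEquiv.ofBijective (P.toStalk x) (toStalk_bijective x)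

theorem stalkEquiv_symm_germ {x : P.superPointPre.carrier} {U : Opens P.superPointPre.carrier}
    (hU : x ∈ U) (s : U → Λ) :
    (P.stalkEquiv x).symm (germ (X := P.superPointPre) hU s) = s ⟨x, hU⟩ := by
  rw [AlgEquiv.symm_apply_eq]
  exact germ_eq_toStalk hU s

theorem isUnit_germ_iff {x : P.superPointPre.carrier} {U : Opens P.superPointPre.carrier}
    (hU : x ∈ U) (s : U → Λ) :
    IsUnit (germ (X := P.superPointPre) hU s) ↔ IsUnit (s ⟨x, hU⟩) := by
  rw [germ_eq_toStalk hU s]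
  exact MulEquiv.isUnit_map (P.stalkEquiv x)

theorem isUnit_germ_point_iff {x : (pointPre k).carrier} {U : Opens (pointPre k).carrier}
    (hU : x ∈ U) (s : U → k) : IsUnit (germ (X := pointPre k) hU s) ↔ s ⟨x, hU⟩ ≠ 0 := by
  have := pointPre_isLocalRing x
  refine ⟨fun h h0 => not_isUnit_zero (M₀ := (pointPre k).Stalk x) ?_, fun h =>
    (pointPre_isUnit hU s h).map (germ (X := pointPre k) hU)⟩
  rw [← map_zero (germ (X := pointPre k) hU)]
  rwa [(pointPre_germ_eq_iff hU hU s 0).2 h0] at h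

theorem isLocalRing_superPointPre (hP : ∃ n, P.filt n = ⊥) (x : P.superPointPre.carrier) :
    IsLocalRing (P.superPointPre.Stalk x) := by
  have : Nontrivial Λ := ⟨⟨0, 1, fun h => by simpa using congrArg P.ε h⟩⟩
  have : Nontrivial (P.superPointPre.Stalk x) := (toStalk_bijective x).1.nontrivial
  refine { isUnit_or_isUnit_of_add_one := ?_ }
  intro a b hab
  obtain ⟨a, rfl⟩ := (toStalk_bijective x).2 a
  obtain ⟨b, rfl⟩ := (toStalk_bijective x).2 b
  rw [← map_add, ← map_one (P.toStalk x)] at hab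
  have h := congrArg P.ε ((toStalk_bijective x).1 hab)
  rw [map_add, map_one] at h
  by_cases ha : P.ε a = 0
  · refine Or.inr ((P.isUnit_of_ε_ne_zero hP ?_).map _)
    rw [ha, zero_add] at h
    rw [h]
    exact (one_ne_zero : (1 : k) ≠ 0)
  · exact Or.inl ((P.isUnit_of_ε_ne_zero hP ha).map _)

variable (P) in
/-- The superspace with one point and functions `Λ`. -/
noncomputable abbrev superPoint (hP : ∃ n, P.filt n = ⊥) : SuperSpace k where
  toPreSuperSpace := P.superPointPre
  supercommutative U := by
    intro i j a b ha hb
    exact funext fun x => P.comm (ha x trivial) (hb x trivial)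
  sheaf V s hs := by
    have hx : ∀ x : (iSup V : Opens P.superPointPre.carrier), ∃ i, x.1 ∈ V i := fun x =>
      Opens.mem_iSup.1 x.2
    choose i hi using hx
    refine ⟨fun x => s (i x) ⟨x.1, hi x⟩, fun j => ?_, fun t ht => ?_⟩
    · funext x
      exact congrFun (hs (i ⟨x.1, le_iSup V j x.2⟩) j) ⟨x.1, hi _, x.2⟩
    · funext x
      exact congrFun (ht (i x)) ⟨x.1, hi x⟩
  isLocalRing := isLocalRing_superPointPre hP

variable (P) in
/-- The point of the superpoint. -/
def superPt : P.superPointPre.carrier := PUnit.unit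

variable {hP : ∃ n, P.filt n = ⊥}

/-- The homomorphism to an algebra of functions with given values. -/
def funHom (k A Λ : Type u) [Field k] [Ring A] [Algebra k A] [Ring Λ] [Algebra k Λ] {ι : Type u}
    (ρ : ι → A →ₐ[k] Λ) : A →ₐ[k] (ι → Λ) where
  toFun s y := ρ y s
  map_one' := funext fun y => map_one (ρ y)
  map_mul' s t := funext fun y => map_mul (ρ y) s t
  map_zero' := funext fun y => map_zero (ρ y)
  map_add' s t := funext fun y => map_add (ρ y) s t
  commutes' c := funext fun y => AlgHom.commutes (ρ y) c

/-- The closed point of the superpoint. -/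
noncomputable def ofPoint [CharZero k] (hP : ∃ n, P.filt n = ⊥) :
    Hom (point k) (P.superPoint hP) where
  base := ContinuousMap.const _ P.superPt
  pull U := funHom k (U → Λ) k
    fun y : Opens.comap (ContinuousMap.const (point k).carrier P.superPt) U =>
    P.ε.comp (Pi.evalAlgHom k (fun _ : U => Λ) ⟨_, y.2⟩)
  pull_res _ _ := rfl
  pull_gr {U i s} hs := by
    rcases parity_cases i with rfl | rfl
    · exact Submodule.mem_top (R := k)
        (M := (Opens.comap (ContinuousMap.const (point k).carrier P.superPt) U) → k)
    · exact (Submodule.mem_bot k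
        (M := (Opens.comap (ContinuousMap.const (point k).carrier P.superPt) U) → k)).2
        (funext fun y => P.ε_odd (hs _ trivial))
  isUnit_of_pull {U} s x hx h := (isUnit_germ_iff hx s).2 (P.isUnit_of_ε_ne_zero hP
    ((isUnit_germ_point_iff (x := x)
      (U := Opens.comap (ContinuousMap.const _ P.superPt) U) hx _).1 h))

/-- The morphism of the superpoint to the point. -/
noncomputable def toPoint (hP : ∃ n, P.filt n = ⊥) : Hom (P.superPoint hP) (point k) where
  base := ContinuousMap.const _ (pt k)
  pull U := funHom k (U → k) Λ
    fun y : Opens.comap (ContinuousMap.const (P.superPoint hP).carrier (pt k)) U =>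
    (Algebra.ofId k Λ).comp (Pi.evalAlgHom k (fun _ : U => k) ⟨_, y.2⟩)
  pull_res _ _ := rfl
  pull_gr {U i s} hs := by
    rcases parity_cases i with rfl | rfl
    · exact fun y _ => P.algebraMap_mem _
    · have hs : (s : U → k) = 0 := (Submodule.mem_bot k (M := U → k)).1 hs
      intro y _
      have h : ∀ c : k, c = 0 → algebraMap k Λ c ∈ P.gr 1 := by
        rintro _ rfl
        rw [map_zero]
        exact zero_mem _
      exact h _ (congrFun hs _)
  isUnit_of_pull {U} s x hx h := by
    refine (isUnit_germ_point_iff (x := pt k) hx s).2 fun h0 => ?_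
    have h' := ((isUnit_germ_iff (P := P) (x := x)
      (U := Opens.comap (ContinuousMap.const _ (pt k)) U) hx _).1 h).map P.ε
    refine h'.ne_zero ?_
    exact (AlgHom.commutes P.ε _).trans h0

variable {X Y : SuperSpace k}

/-- The homomorphism of the stalk defined by a morphism of the superpoint. -/
noncomputable def pointMap (f : Hom (P.superPoint hP) X) {x : X.carrier}
    (h : f.base P.superPt = x) : X.Stalk x →ₐ[k] Λ :=
  (P.stalkEquiv P.superPt).symm.toAlgHom.comp (f.stalkMap h)

theorem toStalk_pointMap (f : Hom (P.superPoint hP) X) {x : X.carrier}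
    (h : f.base P.superPt = x) (a : X.Stalk x) :
    P.toStalk P.superPt (pointMap f h a) = f.stalkMap h a :=
  (P.stalkEquiv P.superPt).apply_symm_apply _

theorem pointMap_germ (f : Hom (P.superPoint hP) X) {x : X.carrier}
    (h : f.base P.superPt = x) {U : Opens X.carrier} (hx : x ∈ U) (s : X.sec U) :
    pointMap f h (germ (X := X.toPreSuperSpace) hx s) =
      (f.pull U s : Opens.comap f.base U → Λ) ⟨P.superPt, by subst h; exact hx⟩ :=
  stalkEquiv_symm_germ (P := P) (x := P.superPt) (U := Opens.comap f.base U)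
    (by subst h; exact hx) (f.pull U s)

theorem pointMap_comp (g : Hom X Y) (f : Hom (P.superPoint hP) X) {x : X.carrier} {y : Y.carrier}
    (h : f.base P.superPt = x) (h' : g.base x = y) (h'' : (g.comp f).base P.superPt = y) :
    pointMap (g.comp f) h'' = (pointMap f h).comp (g.stalkMap h') := by
  rw [pointMap, g.stalkMap_comp f h h' h'']
  rfl

theorem pointMap_ext {f g : Hom (P.superPoint hP) X} {x : X.carrier} (hf : f.base P.superPt = x)
    (hg : g.base P.superPt = x) (h : pointMap f hf = pointMap g hg) : f = g := by
  subst hg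
  refine Hom.ext_stalk (fun _ => hf) fun y => ?_
  obtain rfl : y = P.superPt := Subsingleton.elim (α := PUnit.{u + 1}) _ _
  refine AlgHom.ext fun a => ?_
  refine (toStalk_pointMap f hf a).symm.trans (Eq.trans ?_ (toStalk_pointMap g rfl a))
  rw [h]

variable {e : Hom (point k) X}

theorem isHom_pointMap (f : Hom (P.superPoint hP) X)
    (h : f.base P.superPt = e.base (pt k)) : (stalkAug e).IsHom P (pointMap f h) := by
  refine isHom_of_isUnit (fun {i a} ha => ?_) (fun a => (isUnit_iff_stalkAug e a).1)
    (fun a => P.isUnit_of_ε_ne_zero hP) fun a ha => ?_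
  · obtain ⟨U, hU, s, hs, rfl⟩ := (X.mem_stalkGr).1 ha
    rw [pointMap_germ]
    exact f.pull_gr hs _ trivial
  · refine f.isUnit_of_stalkMap h ?_
    rw [← toStalk_pointMap]
    exact IsUnit.map (P.toStalk P.superPt) ha

/-- The morphism of the superpoint defined by a homomorphism of the stalk. -/
noncomputable def ofStalk (hP : ∃ n, P.filt n = ⊥) {ρ : X.Stalk (e.base (pt k)) →ₐ[k] Λ}
    (hρ : (stalkAug e).IsHom P ρ) : Hom (P.superPoint hP) X where
  base := ContinuousMap.const _ (e.base (pt k))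
  pull U := funHom k (X.sec U) Λ
    fun y : Opens.comap (ContinuousMap.const (P.superPoint hP).carrier (e.base (pt k))) U =>
      ρ.comp (germ (X := X.toPreSuperSpace) y.2)
  pull_res h s := funext fun y => congrArg ρ (germ_res h _ s)
  pull_gr hs y _ := hρ.map_gr (germ_mem _ hs)
  isUnit_of_pull {U} s x hx h := by
    refine (isUnit_iff_stalkAug e _).2 ?_
    refine ne_of_eq_of_ne (hρ.map_ε _).symm ?_
    exact (((isUnit_germ_iff (P := P) (x := x)
      (U := Opens.comap (ContinuousMap.const _ (e.base (pt k))) U) hx _).1 h).map P.ε).ne_zero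

theorem pointMap_ofStalk {ρ : X.Stalk (e.base (pt k)) →ₐ[k] Λ}
    (hρ : (stalkAug e).IsHom P ρ) (h : (ofStalk hP hρ).base P.superPt = e.base (pt k)) :
    pointMap (ofStalk hP hρ) h = ρ := by
  ext a
  obtain ⟨U, hU, s, rfl⟩ := exists_germ a
  rw [pointMap_germ]
  rfl

theorem pointMap_congr {f g : Hom (P.superPoint hP) X} (h : f = g) {x : X.carrier}
    (hf : f.base P.superPt = x) (hg : g.base P.superPt = x) : pointMap f hf = pointMap g hg := by
  subst h
  rfl

theorem pointMap_comp_ofStalk (f : Hom X Y) {y : Y.carrier} (h : f.base (e.base (pt k)) = y)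
    {ρ : X.Stalk (e.base (pt k)) →ₐ[k] Λ} (hρ : (stalkAug e).IsHom P ρ)
    (h' : (f.comp (ofStalk hP hρ)).base P.superPt = y) :
    pointMap (f.comp (ofStalk hP hρ)) h' = ρ.comp (f.stalkMap h) :=
  (pointMap_comp f (ofStalk hP hρ) rfl h h').trans
    (congrArg (fun σ : X.Stalk (e.base (pt k)) →ₐ[k] Λ => σ.comp (f.stalkMap h))
      (pointMap_ofStalk hρ rfl))

/-- The dictionary used below: equations between morphisms from a superpoint are equations between
homomorphisms from stalks. -/
theorem comp_ofStalk_eq_iff {X' : SuperSpace k} {e' : Hom (point k) X'} {f : Hom X Y}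
    {f' : Hom X' Y} {y : Y.carrier} (h : f.base (e.base (pt k)) = y)
    (h' : f'.base (e'.base (pt k)) = y) {ρ : X.Stalk (e.base (pt k)) →ₐ[k] Λ}
    (hρ : (stalkAug e).IsHom P ρ) {ρ' : X'.Stalk (e'.base (pt k)) →ₐ[k] Λ}
    (hρ' : (stalkAug e').IsHom P ρ') :
    f.comp (ofStalk hP hρ) = f'.comp (ofStalk hP hρ') ↔
      ρ.comp (f.stalkMap h) = ρ'.comp (f'.stalkMap h') := by
  rw [← pointMap_comp_ofStalk (hP := hP) f h hρ h, ← pointMap_comp_ofStalk (hP := hP) f' h' hρ' h']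
  exact ⟨fun h => pointMap_congr h _ _, fun h => pointMap_ext _ _ h⟩

theorem pointMap_comp_toPoint
    (h : (e.comp (toPoint hP)).base P.superPt = e.base (pt k)) :
    pointMap (e.comp (toPoint hP)) h = (stalkAug e).unitHom P := by
  ext a
  refine (toStalk_bijective P.superPt).1 ?_
  rw [toStalk_pointMap, e.stalkMap_comp (toPoint hP) (x := P.superPt) (y := pt k) rfl rfl h,
    AlgHom.comp_apply, ← algebraMap_evalPoint, AlgHom.commutes, unitHom_apply, AlgHom.commutes]
  rfl

end AugSuperalgebra

/-! ### The points of a supergroup in Grassmann algebras -/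

theorem IsProduct.lift_eq {k : Type u} [Field k] {Q : SuperSpace k → Prop}
    {X Y P : SuperSpace k} {p₁ : Hom P X} {p₂ : Hom P Y} (h : IsProduct Q p₁ p₂)
    {T : SuperSpace k} (hT : Q T) {a : Hom T X} {b : Hom T Y} {c : Hom T P}
    (h₁ : p₁.comp c = a) (h₂ : p₂.comp c = b) : h.lift hT a b = c :=
  (h T hT a b).unique (h.lift_spec hT a b) ⟨h₁, h₂⟩

namespace Supergroup

open AugSuperalgebra

variable {k : Type u} [Field k] {Q : SuperSpace k → Prop} {hQ : Q (point k)} (H : Supergroup Q hQ)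
  {Λ : Type u} [Ring Λ] [Algebra k Λ] {P : AugSuperalgebra k Λ} {hP : ∃ n, P.filt n = ⊥}

/-- The underlying space of `G × G` need not be the product of the spaces. Restricting `c` to the
closed point gives a `k`-point of `G × G` with both projections equal to `e`, which is `(e, e)` by
the universal property. -/
theorem base_eq_idPt₂ [CharZero k] (c : Hom (P.superPoint hP) H.GG)
    (h₁ : (H.p₁.comp c).base P.superPt = H.idPt) (h₂ : (H.p₂.comp c).base P.superPt = H.idPt) :
    c.base P.superPt = H.idPt₂ := by
  have e₁ : H.p₁.comp (c.comp (ofPoint hP)) = H.e := point_hom_ext h₁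
  have e₂ : H.p₂.comp (c.comp (ofPoint hP)) = H.e := point_hom_ext h₂
  have e := H.isProduct.lift_eq hQ e₁ e₂
  exact congrArg (fun f : Hom (point k) H.GG => f.base (pt k)) e.symm

/-- The group law on the points in Grassmann algebras. -/
noncomputable def formal [CharZero k] (hsp : ∀ (M : Type u) [AddCommGroup M] [Module k M]
    [Module.Finite k M], Q ((grassmann k M).superPoint grassmann_filt_eq_bot)) :
    FormalSupergroup k (H.G.Stalk H.idPt) (H.GG.Stalk H.idPt₂) where
  P := stalkAug H.e
  PB := stalkAug H.ee
  p₁ := H.p₁.stalkMap H.p₁_idPt₂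
  p₂ := H.p₂.stalkMap H.p₂_idPt₂
  μ := H.m.stalkMap H.m_idPt₂
  hp₁ := isHom_stalkMap _ _ _ _
  hp₂ := isHom_stalkMap _ _ _ _
  hμ := isHom_stalkMap _ _ _ _
  exists_pair M _ _ _ ρ₁ ρ₂ h₁ h₂ := by
    obtain ⟨e₁, e₂⟩ := H.isProduct.lift_spec (hsp M) (ofStalk grassmann_filt_eq_bot h₁)
      (ofStalk grassmann_filt_eq_bot h₂)
    set c := H.isProduct.lift (hsp M) (ofStalk grassmann_filt_eq_bot h₁)
      (ofStalk grassmann_filt_eq_bot h₂)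
    have hc : c.base (grassmann k M).superPt = H.idPt₂ :=
      H.base_eq_idPt₂ c (by rw [e₁]; rfl) (by rw [e₂]; rfl)
    refine ⟨pointMap c hc, isHom_pointMap c hc, ?_, ?_⟩
    · rw [← pointMap_comp H.p₁ c hc H.p₁_idPt₂ (by rw [e₁]; rfl)]
      simp only [e₁]
      exact pointMap_ofStalk h₁ rfl
    · rw [← pointMap_comp H.p₂ c hc H.p₂_idPt₂ (by rw [e₂]; rfl)]
      simp only [e₂]
      exact pointMap_ofStalk h₂ rfl
  pair_unique M _ _ _ c c' hc hc' e₁ e₂ := by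
    have h := (H.isProduct.lift_eq (hsp M) (c := ofStalk grassmann_filt_eq_bot hc)
      ((comp_ofStalk_eq_iff _ _ hc hc').2 e₁) ((comp_ofStalk_eq_iff _ _ hc hc').2 e₂)).symm.trans
      (H.isProduct.lift_eq (hsp M) (c := ofStalk grassmann_filt_eq_bot hc') rfl rfl)
    rw [← pointMap_ofStalk (hP := grassmann_filt_eq_bot) hc rfl,
      ← pointMap_ofStalk (hP := grassmann_filt_eq_bot) hc' rfl]
    exact pointMap_congr h _ _
  assoc M _ _ _ c₁₂ c₂₃ c c' h₁₂ h₂₃ hc hc' e₁ e₂ e₃ e₄ e₅ := by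
    -- The three points are the components of `c₁₂` and the second component of `c₂₃`. The next
    -- rewrites recognise each lift by its projections.
    have h := H.assoc _ (hsp M) (H.p₁.comp (ofStalk grassmann_filt_eq_bot h₁₂))
      (H.p₂.comp (ofStalk grassmann_filt_eq_bot h₁₂))
      (H.p₂.comp (ofStalk grassmann_filt_eq_bot h₂₃))
    rw [H.isProduct.lift_eq (hsp M) (c := ofStalk grassmann_filt_eq_bot h₁₂) rfl rfl,
      H.isProduct.lift_eq (hsp M) (c := ofStalk grassmann_filt_eq_bot h₂₃)
        ((comp_ofStalk_eq_iff _ _ h₂₃ h₁₂).2 e₁.symm) rfl,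
      H.isProduct.lift_eq (hsp M) (c := ofStalk grassmann_filt_eq_bot hc)
        ((comp_ofStalk_eq_iff _ _ hc h₁₂).2 e₂) ((comp_ofStalk_eq_iff _ _ hc h₂₃).2 e₃),
      H.isProduct.lift_eq (hsp M) (c := ofStalk grassmann_filt_eq_bot hc')
        ((comp_ofStalk_eq_iff _ _ hc' h₁₂).2 e₄) ((comp_ofStalk_eq_iff _ _ hc' h₂₃).2 e₅)] at h
    exact (comp_ofStalk_eq_iff _ _ hc hc').1 h
  one_mul M _ _ _ c hc e := by
    have h := H.one_mul _ (hsp M) (toPoint grassmann_filt_eq_bot)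
      (H.p₂.comp (ofStalk grassmann_filt_eq_bot hc))
    rw [H.isProduct.lift_eq (hsp M) (c := ofStalk grassmann_filt_eq_bot hc) ?_ rfl] at h
    · exact (comp_ofStalk_eq_iff _ _ hc hc).1 h
    · exact pointMap_ext (x := H.idPt) H.p₁_idPt₂ rfl ((pointMap_comp_ofStalk _ H.p₁_idPt₂ hc
        H.p₁_idPt₂).trans (e.trans (pointMap_comp_toPoint rfl).symm))
  mul_one M _ _ _ c hc e := by
    have h := H.mul_one _ (hsp M) (toPoint grassmann_filt_eq_bot)
      (H.p₁.comp (ofStalk grassmann_filt_eq_bot hc))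
    rw [H.isProduct.lift_eq (hsp M) (c := ofStalk grassmann_filt_eq_bot hc) rfl ?_] at h
    · exact (comp_ofStalk_eq_iff _ _ hc hc).1 h
    · exact pointMap_ext (x := H.idPt) H.p₂_idPt₂ rfl ((pointMap_comp_ofStalk _ H.p₂_idPt₂ hc
        H.p₂_idPt₂).trans (e.trans (pointMap_comp_toPoint rfl).symm))

/-- For `stalkAug` the abstract distributions, tangent space and gradings unfold to those of the
supergroup, so the theorem on formal supergroups transfers directly. The set `s` spans the cotangent
space. -/
theorem envelopingIsoDistributions [CharZero k] (hsp : ∀ (M : Type u) [AddCommGroup M] [Module k M]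
    [Module.Finite k M], Q ((grassmann k M).superPoint grassmann_filt_eq_bot))
    {s : Finset (H.G.Stalk H.idPt)} (hs : maximalIdeal H.G H.idPt ≤
      Submodule.span k s ⊔ maximalIdeal H.G H.idPt ^ 2) : H.EnvelopingIsoDistributions := by
  obtain ⟨mul, L, a, hT, hmul, hP, hgr, hbr, ha, hbij, hgr'⟩ :=
    (H.formal hsp).exists_enveloping_iso hs
  refine ⟨mul, _, L, a, ⟨fun φ ψ => ?_, fun φ ψ T h f => ?_⟩, fun f => ?_, hP, ⟨hgr, hbr⟩,
    ⟨ha.1, ha.2.1, ha.2.2⟩, fun b hb => ?_, hbij, hgr'⟩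
  · obtain ⟨T, h⟩ := hT φ ψ
    refine ⟨⟨T, h.mem_dist⟩, h.apply, fun T' h' => Subtype.ext ?_⟩
    exact FormalSupergroup.IsTens.unique (F := H.formal hsp) (φ := φ.1) (ψ := ψ.1) ⟨T'.2, h'⟩ h
  · exact DFunLike.congr_fun (hmul φ ψ T.1 ⟨T.2, h⟩) f
  · exact (algebraMap_evalPoint H.e f).symm
  · exact extension_unique (V := H.D) ha.1 ha.2.1 ha.2.2 hb.map_one hb.map_mul hb.map_ι

end Supergroup

end Super

namespace Super
open PreSuperSpace

/-! ### Superpoints are algebraic and analytic -/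

/-- The kernel of `v` is a nil prime with residue field `k`, hence the only prime of the even part.
Since the only open sets are `⊤` and `⊥`, the localization conditions concern a unit or a nilpotent
`f`. -/
theorem isAlgebraicSuperscheme_of_value {k : Type u} [Field k] {X : SuperSpace k}
    [Subsingleton X.carrier] (x : X.carrier) (hfin : Algebra.FiniteType k (X.sec ⊤))
    (hbot : Subsingleton (X.sec ⊥)) (v : evenPart X ⊤ →+* k)
    (hv : ∀ c, v (algebraMap k _ c) = c) (hnil : ∀ f, v f = 0 → IsNilpotent f)
    (hunit : ∀ (y : (⊤ : Opens X.carrier)) (f : evenPart X ⊤),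
      IsUnit (germ (X := X.toPreSuperSpace) y.2 f.1) ↔ v f ≠ 0) : IsAlgebraicSuperscheme X := by
  have hV : ∀ V : Opens X.carrier, V = ⊤ ∨ V = ⊥ := by
    intro V
    by_cases hx : x ∈ V
    · exact Or.inl (Opens.ext (Set.eq_univ_of_forall fun y => Subsingleton.elim x y ▸ hx))
    · exact Or.inr (Opens.ext (Set.eq_empty_of_forall_notMem fun y hy =>
        hx (Subsingleton.elim y x ▸ hy)))
  have hker : (RingHom.ker v).IsPrime := RingHom.ker_isPrime _
  have hsub : ∀ f, v (f - algebraMap k _ (v f)) = 0 := fun f => by rw [map_sub, hv, sub_self]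
  have : Unique (PrimeSpectrum (evenPart X ⊤)) :=
    { default := ⟨RingHom.ker v, hker⟩
      uniq := fun I => by
        have hle : ∀ f, v f = 0 → f ∈ I.asIdeal := fun f hf => by
          obtain ⟨n, hn⟩ := hnil f hf
          exact I.isPrime.mem_of_pow_mem n (hn ▸ zero_mem _)
        refine PrimeSpectrum.ext (le_antisymm (fun f hf => ?_) hle)
        by_contra hne
        have h1 := sub_mem hf (hle _ (hsub f))
        rw [sub_sub_cancel] at h1
        exact I.isPrime.ne_top (Ideal.eq_top_of_isUnit_mem _ h1
          ((isUnit_iff_ne_zero.2 hne).map (algebraMap k (evenPart X ⊤)))) }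
  have : Unique (⊤ : Opens X.carrier) :=
    { default := ⟨x, trivial⟩, uniq := fun y => Subtype.ext (Subsingleton.elim _ _) }
  refine ⟨inferInstance, fun y => ⟨⊤, trivial, hfin, ⟨Homeomorph.homeomorphOfUnique _ _,
    fun z f => ?_⟩, fun f V hVT h => ?_, fun f V hVT h s => ?_, fun f V hVT h a ha => ?_⟩⟩
  · rw [hunit, not_not, Subsingleton.elim (Homeomorph.homeomorphOfUnique _ _ z)
      ⟨RingHom.ker v, hker⟩]
    exact Iff.rfl
  · rcases hV V with rfl | rfl
    · rw [X.res_id]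
      have hf := (hunit ⟨x, trivial⟩ f).1 ((h ⟨x, trivial⟩).1 trivial)
      have := (hnil _ (hsub f)).isUnit_add_left_of_commute
        ((isUnit_iff_ne_zero.2 hf).map (algebraMap k (evenPart X ⊤))) (Commute.all _ _)
      rw [add_sub_cancel] at this
      exact this.map (evenPart X ⊤).val
    · exact isUnit_of_subsingleton _
  · rcases hV V with rfl | rfl
    · exact ⟨0, s, by rw [X.res_id s, pow_zero, one_mul]⟩
    · exact ⟨0, 0, Subsingleton.elim _ _⟩
  · rcases hV V with rfl | rfl
    · exact ⟨0, by rwa [X.res_id, ← one_mul a, ← pow_zero f.1] at ha⟩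
    · have hf : v f = 0 := by
        by_contra hf
        exact ((h ⟨x, trivial⟩).2 ((hunit ⟨x, trivial⟩ f).2 hf)).elim
      obtain ⟨n, hn⟩ := hnil f hf
      refine ⟨n, ?_⟩
      have := congrArg Subtype.val hn
      rw [SubmonoidClass.coe_pow] at this
      rw [this]
      exact zero_mul a

namespace AugSuperalgebra

variable {k Λ : Type u} [Field k] [Ring Λ] [Algebra k Λ] {P : AugSuperalgebra k Λ}

variable (hP : ∃ n, P.filt n = ⊥)

/-- The value of a global even function on the superpoint. -/
noncomputable def evenValue : evenPart (P.superPoint hP) ⊤ →+* k :=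
  (P.ε.comp ((Pi.evalAlgHom k (fun _ : (⊤ : Opens PUnit.{u + 1}) => Λ) ⟨PUnit.unit, trivial⟩).comp
    (evenPart (P.superPoint hP) ⊤).val)).toRingHom

theorem isNilpotent_of_evenValue {f : evenPart (P.superPoint hP) ⊤} (hf : evenValue hP f = 0) :
    IsNilpotent f := by
  obtain ⟨n, hn⟩ := isNilpotent_of_mem_m hP ((P.mem_m _).2 hf)
  refine ⟨n, Subtype.ext (funext fun y => ?_)⟩
  obtain rfl : y = ⟨PUnit.unit, trivial⟩ :=
    Subtype.ext (Subsingleton.elim (α := PUnit.{u + 1}) _ _)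
  exact hn

theorem isUnit_germ_even_iff (x : (⊤ : Opens (P.superPoint hP).carrier))
    (f : evenPart (P.superPoint hP) ⊤) :
    IsUnit (germ (X := (P.superPoint hP).toPreSuperSpace) x.2 f.1) ↔ evenValue hP f ≠ 0 :=
  (isUnit_germ_iff (P := P) x.2 f.1).trans (P.isUnit_iff_ε_ne_zero hP)

theorem isAlgebraicSuperscheme_superPoint [Module.Finite k Λ] :
    IsAlgebraicSuperscheme (P.superPoint hP) := by
  have : Subsingleton (P.superPoint hP).carrier := inferInstanceAs (Subsingleton PUnit.{u + 1})
  refine isAlgebraicSuperscheme_of_value P.superPt ?_ ?_ (evenValue hP) (AlgHom.commutes P.ε)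
    (fun f => isNilpotent_of_evenValue hP) (isUnit_germ_even_iff hP)
  · exact inferInstanceAs (Algebra.FiniteType k ((⊤ : Opens PUnit.{u + 1}) → Λ))
  · exact ⟨fun a b => funext fun y => y.2.elim⟩

end AugSuperalgebra

open AugSuperalgebra

/-- This superpoint is `k^{0|d}` with `d = dim M`: a basis of `M` identifies the Grassmann algebras,
and on a single point analyticity is no condition. -/
theorem isAnalyticSupermanifold_superPoint {k M : Type u} [NontriviallyNormedField k]
    [AddCommGroup M] [Module k M] [Module.Finite k M]
    (hP : ∃ n, (grassmann k M).filt n = ⊥) :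
    IsAnalyticSupermanifold ((grassmann k M).superPoint hP) := by
  have hu : Unique (⊤ : Opens ((grassmann k M).superPoint hP).carrier) :=
    { default := ⟨(grassmann k M).superPt, trivial⟩
      uniq := fun y => Subtype.ext (Subsingleton.elim (α := PUnit.{u + 1}) _ _) }
  have hu' : Unique (⊤ : Opens (Fin 0 → k)) :=
    { default := ⟨0, trivial⟩, uniq := fun y => Subtype.ext (Subsingleton.elim _ _) }
  let b : M ≃ₗ[k] (Fin (Module.finrank k M) → k) := (Module.finBasis k M).equivFun
  let φ := ExteriorAlgebra.map (b : M →ₗ[k] (Fin (Module.finrank k M) → k))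
  let φ' := ExteriorAlgebra.map (b.symm : (Fin (Module.finrank k M) → k) →ₗ[k] M)
  have h1 : ∀ a, φ (φ' a) = a := fun a => by
    have : φ.comp φ' = AlgHom.id k _ := by
      rw [ExteriorAlgebra.map_comp_map, LinearEquiv.comp_symm, ExteriorAlgebra.map_id]
    exact DFunLike.congr_fun this a
  have h2 : ∀ a, φ' (φ a) = a := fun a => by
    have : φ'.comp φ = AlgHom.id k _ := by
      rw [ExteriorAlgebra.map_comp_map, LinearEquiv.symm_comp, ExteriorAlgebra.map_id]
    exact DFunLike.congr_fun this a
  refine ⟨inferInstanceAs (T2Space PUnit.{u + 1}), fun x => ⟨⊤, trivial, 0,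
    Module.finrank k M, ⟨{
    target := ⊤
    coord := Homeomorph.homeomorphOfUnique _ _
    val := fun {W} _ => funHom k (W → ExteriorAlgebra k M) _ fun y : W =>
      φ.comp (Pi.evalAlgHom k (fun _ : W => ExteriorAlgebra k M) y)
    val_res := fun _ _ _ _ => rfl
    val_gr := fun _ _ _ hs y => (isHom_map _).map_gr (hs y trivial)
    val_injective := fun hW s t h => funext fun y =>
      Function.LeftInverse.injective h2 (congrFun h y)
    mem_range_val := ?_ }⟩⟩⟩
  intro W hW F
  constructor
  · intro _
    by_cases hne : Nonempty W
    · obtain ⟨y⟩ := hne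
      refine ⟨fun _ => F y, fun z => ?_, fun _ _ => analyticAt_const⟩
      have : z = y := Subtype.ext (Subsingleton.elim (α := PUnit.{u + 1}) _ _)
      rw [this]
    · exact ⟨0, fun z => (hne ⟨z⟩).elim, fun _ z => (hne ⟨z⟩).elim⟩
  · intro _
    exact ⟨fun y => φ' (F y), funext fun y => h1 (F y)⟩

end Super

namespace Super
open PreSuperSpace

/-! ### Finiteness of the cotangent space -/

namespace AugSuperalgebra

variable {k A : Type u} [Field k] [Ring A] [Algebra k A] (P : AugSuperalgebra k A)

/-- The elements which are constant modulo `W`. -/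
def constMod {W : Submodule k A} (h2 : P.filt 2 ≤ W) (hW : W ≤ P.m) : Subalgebra k A where
  carrier := {a | a - algebraMap k A (P.ε a) ∈ W}
  mul_mem' {a b} ha hb := by
    have e : a * b - algebraMap k A (P.ε (a * b)) =
        (a - algebraMap k A (P.ε a)) * (b - algebraMap k A (P.ε b)) +
          P.ε a • (b - algebraMap k A (P.ε b)) + P.ε b • (a - algebraMap k A (P.ε a)) := by
      simp only [Algebra.smul_def, map_mul, sub_mul, mul_sub, ← Algebra.commutes (P.ε b)]
      abel
    change a * b - algebraMap k A (P.ε (a * b)) ∈ W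
    rw [e]
    exact add_mem (add_mem (h2 (P.mul_mem_filt (a := 1) (b := 1) (P.filt_one ▸ hW ha)
      (P.filt_one ▸ hW hb))) (Submodule.smul_mem _ _ hb)) (Submodule.smul_mem _ _ ha)
  add_mem' {a b} ha hb := by
    change a + b - algebraMap k A (P.ε (a + b)) ∈ W
    rw [map_add, map_add, add_sub_add_comm]
    exact add_mem ha hb
  algebraMap_mem' c := by
    change algebraMap k A c - algebraMap k A (P.ε (algebraMap k A c)) ∈ W
    rw [AlgHom.commutes]
    exact (sub_self (algebraMap k A c)).symm ▸ zero_mem W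

variable {P} {W : Submodule k A} {h2 : P.filt 2 ≤ W} {hW : W ≤ P.m}

theorem mem_constMod {a : A} : a ∈ P.constMod h2 hW ↔ a - algebraMap k A (P.ε a) ∈ W := Iff.rfl

theorem mem_constMod_of_mem {a : A} (ha : a ∈ W) : a ∈ P.constMod h2 hW := by
  rw [mem_constMod, (P.mem_m a).1 (hW ha), map_zero, sub_zero]
  exact ha

theorem mul_mem_constMod {a : A} (ha : a ∈ W) (b : A) : a * b ∈ P.constMod h2 hW := by
  rw [← sub_add_cancel b (algebraMap k A (P.ε b)), mul_add]
  refine add_mem (mem_constMod_of_mem (h2 ?_)) (mul_mem (mem_constMod_of_mem ha)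
    (Subalgebra.algebraMap_mem _ _))
  exact P.mul_mem_filt (a := 1) (b := 1) (P.filt_one ▸ hW ha) (P.filt_one ▸ P.sub_ε_mem b)

/-- From `a b = 1` one gets `ε a • b = 1 - (a - ε a) b`. Closure under inverses is needed because
stalks are localizations. -/
theorem inv_mem_constMod {a b : A} (ha : a ∈ P.constMod h2 hW) (hab : a * b = 1) :
    b ∈ P.constMod h2 hW := by
  have h := mul_mem_constMod (h2 := h2) (hW := hW) (mem_constMod.1 ha) b
  rw [sub_mul, hab, ← Algebra.smul_def] at h
  have h' : P.ε a • b ∈ P.constMod h2 hW := by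
    rw [← sub_sub_cancel 1 (P.ε a • b)]
    exact sub_mem (one_mem _) h
  have hε : P.ε b * P.ε a = 1 := by rw [mul_comm, ← map_mul, hab, map_one]
  rw [← one_smul k b, ← hε, mul_smul]
  exact Subalgebra.smul_mem _ h' _

theorem m_le_of_constMod_eq_top (h : ∀ a, a ∈ P.constMod h2 hW) : P.m ≤ W := fun a ha => by
  have := mem_constMod.1 (h a)
  rwa [(P.mem_m a).1 ha, map_zero, sub_zero] at this

end AugSuperalgebra

open AugSuperalgebra

variable {k : Type u} [Field k] {X : SuperSpace k}

/-- A basic open set of an affine open set. -/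
theorem IsAffineAlgebraic.exists_basic {U : Opens X.carrier} (hU : IsAffineAlgebraic X U)
    {x : X.carrier} (hx : x ∈ U) {V' : Opens X.carrier} (hx' : x ∈ V') :
    ∃ (f : evenPart X U) (V : Opens X.carrier) (_ : V ≤ U), V ≤ V' ∧ x ∈ V ∧
      ∀ y : U, y.1 ∈ V ↔ IsUnit (germ (X := X.toPreSuperSpace) y.2 f.1) := by
  obtain ⟨h, hh⟩ := hU.spec
  have hopen : IsOpen (h '' {y : U | y.1 ∈ V'}) :=
    h.isOpenMap _ (V'.2.preimage continuous_subtype_val)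
  obtain ⟨_, ⟨f, rfl⟩, hf, hfV⟩ := PrimeSpectrum.isTopologicalBasis_basic_opens.exists_subset_of_mem_open
    (Set.mem_image_of_mem h (show (⟨x, hx⟩ : U) ∈ {y : U | y.1 ∈ V'} from hx')) hopen
  have key : ∀ y : U, h y ∈ PrimeSpectrum.basicOpen f ↔
      IsUnit (germ (X := X.toPreSuperSpace) y.2 f.1) := fun y => by
    rw [PrimeSpectrum.mem_basicOpen, hh, not_not]
  refine ⟨f, ⟨Subtype.val '' (h ⁻¹' (PrimeSpectrum.basicOpen f : Set (PrimeSpectrum _))),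
    U.2.isOpenMap_subtype_val _ ((PrimeSpectrum.basicOpen f).2.preimage h.continuous)⟩,
    ?_, ?_, ?_, fun y => ?_⟩
  · rintro _ ⟨y, -, rfl⟩
    exact y.2
  · rintro _ ⟨y, hy, rfl⟩
    obtain ⟨z, hz, e⟩ := hfV hy
    rw [← h.injective e]
    exact hz
  · exact ⟨⟨x, hx⟩, hf, rfl⟩
  · rw [← key]
    constructor
    · rintro ⟨z, hz, e⟩
      rwa [Subtype.ext e] at hz
    · exact fun hy => ⟨y, hy, rfl⟩

/-- Let `s` consist of the generators of an affine neighbourhood minus their values. The elements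
constant modulo `span s + m²` form a subalgebra closed under inverses that contains the generators;
every germ is a quotient of sections over the affine set, so they are the whole stalk. -/
theorem IsAlgebraicSuperscheme.exists_finset (hX : IsAlgebraicSuperscheme X)
    (e : Hom (point k) X) : ∃ s : Finset (X.Stalk (e.base (pt k))),
      (stalkAug e).m ≤ Submodule.span k s ⊔ (stalkAug e).filt 2 := by
  classical
  obtain ⟨U, hx, hU⟩ := hX.2 (e.base (pt k))
  obtain ⟨t, ht⟩ := hU.finiteType
  let g : X.sec U →ₐ[k] X.Stalk (e.base (pt k)) := germ (X := X.toPreSuperSpace) hx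
  let s := t.image fun a => g a - algebraMap k _ ((stalkAug e).ε (g a))
  refine ⟨s, ?_⟩
  have hW : Submodule.span k s ⊔ (stalkAug e).filt 2 ≤ (stalkAug e).m := by
    refine sup_le (Submodule.span_le.2 fun a ha => ?_) ?_
    · obtain ⟨b, -, rfl⟩ := Finset.mem_image.1 (Finset.mem_coe.1 ha)
      exact (stalkAug e).sub_ε_mem _
    · rw [← (stalkAug e).filt_one]
      exact (stalkAug e).filt_succ_le 1
  refine m_le_of_constMod_eq_top (h2 := le_sup_right) (hW := hW) fun a => ?_
  have hg : ∀ a, g a ∈ (stalkAug e).constMod le_sup_right hW := by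
    intro a
    have ha : a ∈ Algebra.adjoin k (t : Set (X.sec U)) := ht ▸ trivial
    refine (Algebra.adjoin_le (S := ((stalkAug e).constMod le_sup_right hW).comap g)
      fun b hb => ?_) ha
    exact Submodule.mem_sup_left (Submodule.subset_span (Finset.mem_coe.2
      (Finset.mem_image_of_mem _ hb)))
  obtain ⟨V', hx', σ, rfl⟩ := exists_germ a
  obtain ⟨f, V, hVU, hVV', hxV, hV⟩ := hU.exists_basic hx hx'
  obtain ⟨n, b, hb⟩ := hU.exists_pow_mul_eq f V hVU hV (X.res hVV' σ)
  have hb' := congrArg (germ (X := X.toPreSuperSpace) hxV) hb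
  rw [map_mul, map_pow, germ_res, germ_res, germ_res] at hb'
  obtain ⟨v, hv⟩ := ((hV ⟨_, hx⟩).1 hxV).pow n
  have hinv := inv_mem_constMod (pow_mem (hg f.1) n) (b := (↑v⁻¹ : X.Stalk _))
    (show g f.1 ^ n * ↑v⁻¹ = 1 by rw [← hv.symm.symm]; exact v.mul_inv)
  have : germ (X := X.toPreSuperSpace) hx' σ = ↑v⁻¹ * g b := by
    rw [Units.eq_inv_mul_iff_mul_eq, hv]
    exact hb'
  rw [this]
  exact mul_mem hinv (hg b)

end Super

namespace Super
open PreSuperSpace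

/-! ### First order Taylor expansion of analytic functions -/

section Hadamard

variable {k E F : Type*} [NontriviallyNormedField k] [NormedAddCommGroup E]
  [NormedSpace k E] [NormedAddCommGroup F] [NormedSpace k F] [CompleteSpace F]

/-- The function `G` is the sum of the shifted power series, whose terms keep one argument free;
inserting `y - x` there restores all terms but the constant one. -/
theorem exists_eq_add_of_analyticAt {f : E → F} {x : E} (hf : AnalyticAt k f x) :
    ∃ G : E → E →L[k] F, AnalyticAt k G x ∧ ∀ᶠ y in nhds x, f y = f x + G y (y - x) := by
  obtain ⟨p, r, hp⟩ := hf
  have hr : 0 < p.shift.radius := by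
    rw [p.radius_shift]
    exact hp.r_pos.trans_le hp.r_le
  have hs := p.shift.hasFPowerSeriesOnBall hr
  refine ⟨fun y => p.shift.sum (y - x), ?_, ?_⟩
  · have h : AnalyticAt k p.shift.sum (x - x) := by
      rw [sub_self]
      exact hs.analyticAt
    exact h.comp (f := fun y => y - x) (analyticAt_id.sub analyticAt_const)
  · have hball := hp.eventually_hasSum_sub
    have hball' : ∀ᶠ y in nhds x, y - x ∈ Metric.eball (0 : E) p.shift.radius := by
      exact ((continuous_sub_right x).tendsto' x 0 (sub_self x)) (Metric.eball_mem_nhds 0 hr)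
    filter_upwards [hball, hball'] with y hy hy'
    have h1 : HasSum (fun n => p (n + 1) fun _ => y - x) (p.shift.sum (y - x) (y - x)) := by
      have h := (hs.hasSum hy').mapL (ContinuousLinearMap.apply k F (y - x))
      rw [zero_add] at h
      have e : ∀ n, ContinuousLinearMap.apply k F (y - x) (p.shift n fun _ => y - x) =
          p (n + 1) fun _ => y - x := fun n => by
        change p (n + 1) (Fin.snoc (fun _ => y - x) (y - x)) = _
        congr 1
        funext i
        refine Fin.lastCases ?_ (fun i => ?_) i
        · rw [Fin.snoc_last]
        · rw [Fin.snoc_castSucc]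
      simp only [e] at h
      exact h
    have h2 := (hasSum_nat_add_iff' 1).2 hy
    rw [Finset.sum_range_one, hp.coeff_zero] at h2
    rw [← h2.unique h1, add_sub_cancel]

/-- Hadamard's lemma: evaluate the operator-valued remainder on the standard basis vectors. -/
theorem exists_eq_add_sum_of_analyticAt [CompleteSpace k] {p : ℕ} {f : (Fin p → k) → k} {x : Fin p → k}
    (hf : AnalyticAt k f x) : ∃ g : Fin p → (Fin p → k) → k, (∀ i, AnalyticAt k (g i) x) ∧
      ∀ᶠ y in nhds x, f y = f x + ∑ i, (y i - x i) * g i y := by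
  obtain ⟨G, hG, h⟩ := exists_eq_add_of_analyticAt hf
  refine ⟨fun i y => G y (Pi.single i 1), fun i =>
    ((ContinuousLinearMap.apply k k (Pi.single i 1 : Fin p → k)).analyticAt (G x)).comp hG, ?_⟩
  filter_upwards [h] with y hy
  rw [hy]
  congr 1
  conv_lhs => rw [← (Pi.basisFun k (Fin p)).sum_repr (y - x), map_sum]
  refine Finset.sum_congr rfl fun i _ => ?_
  simp

end Hadamard

instance exteriorAlgebra_finite {k M : Type*} [Field k] [AddCommGroup M] [Module k M]
    [Module.Finite k M] : Module.Finite k (ExteriorAlgebra k M) := by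
  classical
  let N := Module.finrank k M + 1
  let f : ExteriorAlgebra k M →ₗ[k] ∀ i : Fin N, ⋀[k]^i.1 M :=
    LinearMap.pi fun i => (DirectSum.component k ℕ (fun i => ⋀[k]^i M) i.1) ∘ₗ
      (DirectSum.decomposeLinearEquiv (fun i : ℕ => ⋀[k]^i M)).toLinearMap
  refine Module.Finite.of_injective f ((injective_iff_map_eq_zero f).2 fun x hx => ?_)
  -- An element is determined by its components of degree at most `dim M`, as all higher exterior
  -- powers vanish.
  refine (DirectSum.decomposeLinearEquiv (fun i : ℕ => ⋀[k]^i M)).map_eq_zero_iff.1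
    (DFinsupp.ext fun i => ?_)
  by_cases hi : i < N
  · exact congrFun hx ⟨i, hi⟩
  · have h : Module.finrank k (⋀[k]^i M) = 0 := by
      rw [exteriorPower.finrank_eq, Nat.choose_eq_zero_of_lt (by omega)]
    have := Module.finrank_zero_iff.1 h
    exact Subsingleton.elim _ _

/-! ### The cotangent space of an analytic supermanifold -/

namespace AnalyticChart

variable {k : Type u} [NontriviallyNormedField k] {X : SuperSpace k} {U : Opens X.carrier}
  {p q : ℕ} (C : AnalyticChart X U p q) {x : X.carrier} (hx : x ∈ U)

/-- The coordinates of a point. -/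
def pos (y : U) : Fin p → k := (C.coord y).1

/-- The pairs of a germ at `x` and a function which represents it. -/
noncomputable def germs :
    Subalgebra k (X.Stalk x × ((Fin p → k) → ExteriorAlgebra k (Fin q → k))) where
  carrier := {a | ∃ (W : Opens X.carrier) (hW : W ≤ U) (hxW : x ∈ W) (s : X.sec W),
    germ (X := X.toPreSuperSpace) hxW s = a.1 ∧ ∀ y : W, C.val hW s y = a.2 (C.pos ⟨y, hW y.2⟩)}
  mul_mem' := by
    rintro ⟨_, E⟩ ⟨_, E'⟩ ⟨W, hW, hxW, s, rfl, h⟩ ⟨W', hW', hxW', s', rfl, h'⟩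
    have hx'' : x ∈ W ⊓ W' := ⟨hxW, hxW'⟩
    refine ⟨W ⊓ W', inf_le_left.trans hW, hx'', X.res inf_le_left s * X.res inf_le_right s', ?_,
      fun y => ?_⟩
    · rw [map_mul, germ_res, germ_res]
      rfl
    · rw [map_mul, Pi.mul_apply, C.val_res inf_le_left hW, C.val_res inf_le_right hW', h, h']
      rfl
  add_mem' := by
    rintro ⟨_, E⟩ ⟨_, E'⟩ ⟨W, hW, hxW, s, rfl, h⟩ ⟨W', hW', hxW', s', rfl, h'⟩
    have hx'' : x ∈ W ⊓ W' := ⟨hxW, hxW'⟩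
    refine ⟨W ⊓ W', inf_le_left.trans hW, hx'', X.res inf_le_left s + X.res inf_le_right s', ?_,
      fun y => ?_⟩
    · rw [map_add, germ_res, germ_res]
      rfl
    · rw [map_add, Pi.add_apply, C.val_res inf_le_left hW, C.val_res inf_le_right hW', h, h']
      rfl
  algebraMap_mem' c := ⟨U, le_rfl, hx, algebraMap k _ c, AlgHom.commutes _ _, fun y => by
    rw [AlgHom.commutes]
    rfl⟩

variable {C hx}

/-- A chart is injective on sections over every open subset, in particular over a neighbourhood
where the two representing functions coincide. -/
theorem eq_of_mem_germs {a b : X.Stalk x} {E E' : (Fin p → k) → ExteriorAlgebra k (Fin q → k)}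
    (h : (a, E) ∈ C.germs hx) (h' : (b, E') ∈ C.germs hx)
    (hE : ∀ᶠ y in nhds (C.pos ⟨x, hx⟩), E y = E' y) : a = b := by
  obtain ⟨W, hW, hxW, s, rfl, h⟩ := h
  obtain ⟨W', hW', hxW', s', rfl, h'⟩ := h'
  obtain ⟨O, hO, hOo, hxO⟩ := eventually_nhds_iff.1 hE
  have hc : Continuous C.pos := continuous_subtype_val.comp C.coord.continuous
  let N : Opens X.carrier := ⟨Subtype.val '' (C.pos ⁻¹' O),
    U.2.isOpenMap_subtype_val _ (hOo.preimage hc)⟩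
  have hN : x ∈ N ⊓ (W ⊓ W') := ⟨⟨⟨x, hx⟩, hxO, rfl⟩, hxW, hxW'⟩
  have h1 : N ⊓ (W ⊓ W') ≤ W := inf_le_right.trans inf_le_left
  have h2 : N ⊓ (W ⊓ W') ≤ W' := inf_le_right.trans inf_le_right
  rw [germ_eq_iff]
  refine ⟨_, hN, h1, h2, C.val_injective (h1.trans hW) (funext fun y => ?_)⟩
  rw [C.val_res h1 hW, C.val_res h2 hW', h, h']
  obtain ⟨z, hz, e⟩ := y.2.1
  refine hO _ ?_
  have : (⟨y.1, hW (h1 y.2)⟩ : U) = z := Subtype.ext e.symm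
  exact this ▸ hz

theorem apply_pos_of_mem_germs {a : X.Stalk x}
    {E E' : (Fin p → k) → ExteriorAlgebra k (Fin q → k)} (h : (a, E) ∈ C.germs hx)
    (h' : (a, E') ∈ C.germs hx) : E (C.pos ⟨x, hx⟩) = E' (C.pos ⟨x, hx⟩) := by
  obtain ⟨W, hW, hxW, s, e, h⟩ := h
  obtain ⟨W', hW', hxW', s', e', h'⟩ := h'
  obtain ⟨V, hxV, hV, hV', e⟩ := (germ_eq_iff _ _ _ _).1 (e.trans e'.symm)
  have h1 := C.val_res hV hW s ⟨x, hxV⟩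
  have h2 := C.val_res hV' hW' s' ⟨x, hxV⟩
  rw [e] at h1
  rw [h] at h1
  rw [h'] at h2
  exact h1.symm.trans h2

theorem exists_mem_germs (a : X.Stalk x) : ∃ E, (a, E) ∈ C.germs hx ∧
    ∀ l : Module.Dual k (ExteriorAlgebra k (Fin q → k)),
      AnalyticAt k (fun y => l (E y)) (C.pos ⟨x, hx⟩) := by
  obtain ⟨V, hxV, s, rfl⟩ := exists_germ a
  have hxW : x ∈ V ⊓ U := ⟨hxV, hx⟩
  obtain ⟨E, hE, hE'⟩ := (C.mem_range_val (W := V ⊓ U) inf_le_right _).1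
    ⟨X.res inf_le_left s, rfl⟩
  exact ⟨E, ⟨V ⊓ U, inf_le_right, hxW, X.res inf_le_left s, germ_res _ _ _, hE⟩,
    fun l => hE' l ⟨x, hxW⟩⟩

theorem exists_mem_germs_const (β : ExteriorAlgebra k (Fin q → k)) :
    ∃ a, (a, fun _ => β) ∈ C.germs hx := by
  obtain ⟨s, hs⟩ := (C.mem_range_val (W := U) le_rfl fun _ => β).2
    ⟨fun _ => β, fun _ => rfl, fun _ _ => analyticAt_const⟩
  exact ⟨_, U, le_rfl, hx, s, rfl, congrFun hs⟩

/-- Over the complete field `k` analyticity at a point is an open condition, so the chart provides a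
section on a whole neighbourhood. -/
theorem exists_mem_germs_algebraMap [CompleteSpace k] {g : (Fin p → k) → k}
    (hg : AnalyticAt k g (C.pos ⟨x, hx⟩)) :
    ∃ a, (a, fun y => algebraMap k _ (g y)) ∈ C.germs hx := by
  have hc : Continuous C.pos := continuous_subtype_val.comp C.coord.continuous
  let W : Opens X.carrier := ⟨Subtype.val '' (C.pos ⁻¹' {y | AnalyticAt k g y}),
    U.2.isOpenMap_subtype_val _ ((isOpen_analyticAt k g).preimage hc)⟩
  have hW : W ≤ U := by
    rintro _ ⟨y, -, rfl⟩
    exact y.2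
  have hxW : x ∈ W := ⟨⟨x, hx⟩, hg, rfl⟩
  obtain ⟨s, hs⟩ := (C.mem_range_val hW fun y => algebraMap k _ (g (C.pos ⟨y, hW y.2⟩))).2
    ⟨fun y => algebraMap k _ (g y), fun _ => rfl, fun l y => by
      obtain ⟨z, hz, e⟩ := y.2
      have : (⟨y.1, hW y.2⟩ : U) = z := Subtype.ext e.symm
      rw [this]
      simp only [Algebra.algebraMap_eq_smul_one, map_smul, smul_eq_mul]
      exact AnalyticAt.mul hz analyticAt_const⟩
  exact ⟨_, W, hW, hxW, s, rfl, congrFun hs⟩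

theorem not_isUnit_of_mem_germs {a : X.Stalk x}
    {E : (Fin p → k) → ExteriorAlgebra k (Fin q → k)} (h : (a, E) ∈ C.germs hx)
    (hE : E (C.pos ⟨x, hx⟩) = 0) : ¬ IsUnit a := by
  rintro ⟨u, rfl⟩
  obtain ⟨E', h', -⟩ := exists_mem_germs (C := C) (hx := hx) (↑u⁻¹ : X.Stalk x)
  have h1 := mul_mem h h'
  rw [Prod.mk_mul_mk, Units.mul_inv] at h1
  have h2 := apply_pos_of_mem_germs h1 (one_mem (C.germs hx))
  rw [Pi.mul_apply, hE, zero_mul] at h2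
  exact zero_ne_one h2

end AnalyticChart

open AugSuperalgebra AnalyticChart

/-- The spanning set consists of the even coordinates minus their values and of the odd coordinates.
A germ is a finite sum of scalar analytic functions times constants of the Grassmann algebra; the
former are constant modulo `span s + m²` by Hadamard's lemma, the latter because the odd coordinates
generate them. -/
theorem IsAnalyticSupermanifold.exists_finset {k : Type u} [NontriviallyNormedField k]
    [CompleteSpace k] {X : SuperSpace k} (hX : IsAnalyticSupermanifold X) (e : Hom (point k) X) :
    ∃ s : Finset (X.Stalk (e.base (pt k))),
      (stalkAug e).m ≤ Submodule.span k s ⊔ (stalkAug e).filt 2 := by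
  classical
  obtain ⟨U, hx, p, q, ⟨C⟩⟩ := hX.2 (e.base (pt k))
  set x₀ := C.pos ⟨_, hx⟩ with hx₀
  have hproj : ∀ i, AnalyticAt k (fun y : Fin p → k => y i - x₀ i) x₀ := fun i =>
    ((ContinuousLinearMap.proj (R := k) (φ := fun _ : Fin p => k) i).analyticAt x₀).sub
      analyticAt_const
  choose ζ hζ using fun i => exists_mem_germs_algebraMap (C := C) (hproj i)
  choose ξ hξ using fun i : Fin q => exists_mem_germs_const (C := C) (hx := hx)
    (ExteriorAlgebra.ι k (Pi.single i (1 : k)))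
  let s := Finset.univ.image ζ ∪ Finset.univ.image ξ
  refine ⟨s, ?_⟩
  have hW : Submodule.span k s ⊔ (stalkAug e).filt 2 ≤ (stalkAug e).m := by
    refine sup_le (Submodule.span_le.2 fun a ha => ?_) ?_
    · rcases Finset.mem_union.1 (Finset.mem_coe.1 ha) with ha | ha
      · obtain ⟨i, -, rfl⟩ := Finset.mem_image.1 ha
        exact not_isUnit_of_mem_germs (hζ i) (by rw [sub_self, map_zero])
      · obtain ⟨i, -, rfl⟩ := Finset.mem_image.1 ha
        -- An odd coordinate need not vanish as a Grassmann value, but it has square zero, so its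
        -- augmentation is zero.
        have h0 : ξ i * ξ i = 0 := by
          refine eq_of_mem_germs (mul_mem (hξ i) (hξ i)) (zero_mem (C.germs hx))
            (Filter.Eventually.of_forall fun y => ?_)
          exact ExteriorAlgebra.ι_sq_zero _
        refine ((stalkAug e).mem_m _).2 ?_
        rw [← mul_self_eq_zero, ← map_mul, h0, map_zero]
    · rw [← (stalkAug e).filt_one]
      exact (stalkAug e).filt_succ_le 1
  refine m_le_of_constMod_eq_top (h2 := le_sup_right) (hW := hW) fun a => ?_
  have hmem : ∀ a ∈ s, a ∈ Submodule.span k s ⊔ (stalkAug e).filt 2 := fun a ha =>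
    Submodule.mem_sup_left (Submodule.subset_span (Finset.mem_coe.2 ha))
  have hscalar : ∀ (g : (Fin p → k) → k) a, AnalyticAt k g x₀ →
      (a, fun y => algebraMap k _ (g y)) ∈ C.germs hx →
        a ∈ (stalkAug e).constMod le_sup_right hW := by
    intro g a hg ha
    obtain ⟨G, hG, h⟩ := exists_eq_add_sum_of_analyticAt hg
    choose γ hγ using fun i => exists_mem_germs_algebraMap (C := C) (hG i)
    have h1 := add_mem (Subalgebra.algebraMap_mem (C.germs hx) (g x₀))
      (sum_mem fun i (_ : i ∈ Finset.univ) => mul_mem (hζ i) (hγ i))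
    have ea : a = _ := eq_of_mem_germs ha h1 (by
      filter_upwards [h] with y hy
      rw [hy, map_add, map_sum]
      simp [Prod.snd_sum])
    rw [ea]
    refine add_mem (Subalgebra.algebraMap_mem _ _) ?_
    rw [Prod.fst_sum]
    exact sum_mem fun i _ => mul_mem_constMod (hmem _ (Finset.mem_union_left _
      -- A coordinate in `s` times an arbitrary germ is constant modulo `span s + m²`: the germ's
      -- constant part leaves a multiple of the coordinate, and the rest lies in `m²`.
      (Finset.mem_image_of_mem _ (Finset.mem_univ i)))) _
  have hconst : ∀ β, ∃ a ∈ (stalkAug e).constMod le_sup_right hW,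
      (a, fun _ => β) ∈ C.germs hx := by
    intro β
    induction β using ExteriorAlgebra.induction with
    | algebraMap c => exact ⟨algebraMap k _ c, Subalgebra.algebraMap_mem _ _,
        Subalgebra.algebraMap_mem (C.germs hx) c⟩
    | ι v =>
      refine ⟨∑ i, v i • ξ i, sum_mem fun i _ => Subalgebra.smul_mem _ (mem_constMod_of_mem
        (hmem _ (Finset.mem_union_right _ (Finset.mem_image_of_mem _ (Finset.mem_univ i))))) _, ?_⟩
      have h := sum_mem fun i (_ : i ∈ Finset.univ) => Subalgebra.smul_mem _ (hξ i) (v i)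
      have ev : (∑ i, v i • ξ i, fun _ => ExteriorAlgebra.ι k v) =
          ∑ i, v i • (ξ i, fun _ : Fin p → k => ExteriorAlgebra.ι k (Pi.single i (1 : k))) := by
        refine Prod.ext (by rw [Prod.fst_sum]; rfl) ?_
        rw [Prod.snd_sum]
        funext y
        rw [Finset.sum_apply]
        conv_lhs => rw [← (Pi.basisFun k (Fin q)).sum_repr v, map_sum]
        simp
      rw [ev]
      exact h
    | mul a b ha hb =>
      obtain ⟨a', ha, ha'⟩ := ha
      obtain ⟨b', hb, hb'⟩ := hb
      exact ⟨a' * b', mul_mem ha hb, mul_mem ha' hb'⟩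
    | add a b ha hb =>
      obtain ⟨a', ha, ha'⟩ := ha
      obtain ⟨b', hb, hb'⟩ := hb
      exact ⟨a' + b', add_mem ha hb, add_mem ha' hb'⟩
  obtain ⟨E, hE, hEa⟩ := exists_mem_germs (C := C) (hx := hx) a
  -- The basis expansion of Grassmann values writes the germ as a sum of scalar functions times
  -- constants.
  let b := Module.finBasis k (ExteriorAlgebra k (Fin q → k))
  choose γ hγ using fun j => exists_mem_germs_algebraMap (C := C) (hEa (b.coord j))
  choose β hβ hβ' using fun j => hconst (b j)
  have hsum : (∑ j, γ j * β j, fun y => ∑ j, algebraMap k _ (b.coord j (E y)) * b j) =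
      ∑ j, (γ j, fun y => algebraMap k _ (b.coord j (E y))) * (β j, fun _ => b j) := by
    refine Prod.ext (by rw [Prod.fst_sum]; rfl) ?_
    rw [Prod.snd_sum]
    funext y
    rw [Finset.sum_apply]
    rfl
  have h1 : (_, _) ∈ C.germs hx :=
    hsum ▸ Subalgebra.sum_mem (C.germs hx) fun j _ => mul_mem (hγ j) (hβ' j)
  have ea : a = _ := eq_of_mem_germs hE h1 (Filter.Eventually.of_forall fun y => by
    conv_lhs => rw [← b.sum_repr (E y)]
    simp [Algebra.smul_def])
  rw [ea]
  exact Subalgebra.sum_mem _ fun j _ =>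
    mul_mem (hscalar _ _ (hEa (b.coord j)) (hγ j)) (hβ j)

end Super

/-! ### The algebraic and the analytic case -/

theorem mainTheorem4 :
    (∀ (k : Type u) [Field k] [CharZero k]
      (H : Super.Supergroup (Super.IsAlgebraicSuperscheme (k := k))
        (Super.isAlgebraicSuperscheme_point k)), H.EnvelopingIsoDistributions) ∧
    (∀ (k : Type u) [NontriviallyNormedField k] [CompleteSpace k] [CharZero k]
      (H : Super.Supergroup (Super.IsAnalyticSupermanifold (k := k))
        (Super.isAnalyticSupermanifold_point k)), H.EnvelopingIsoDistributions) := by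
  refine ⟨fun k _ _ H => ?_, fun k _ _ _ H => ?_⟩
  · obtain ⟨s, hs⟩ := Super.IsAlgebraicSuperscheme.exists_finset H.hG H.e
    exact H.envelopingIsoDistributions
      (fun M _ _ _ => Super.AugSuperalgebra.isAlgebraicSuperscheme_superPoint _) hs
  · obtain ⟨s, hs⟩ := Super.IsAnalyticSupermanifold.exists_finset H.hG H.e
    exact H.envelopingIsoDistributions
      (fun M _ _ _ => Super.isAnalyticSupermanifold_superPoint _) hs
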